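/- **Conventions.** Let $V=(V,Y,\mathbf 1,\omega)$ be a vertex operator algebra over $\mathbb C$ of central charge $\mathbf c$, with modes $Y(v,x)=\sum_{n\in\mathbb Z}v(n)x^{-n-1}$ and $L(n)=\omega(n+1)$. Its square-bracket modes are defined by $Y(e^{xL(0)}v,e^x-1)=\sum_{n\in\mathbb Z}v[n]x^{-n-1}$. Let $M$ be a $V$-module, $M=\bigoplus_{N\ge 0}M_{\lambda+N}$ with $M_{\lambda+N}$ the finite-dimensional $L(0)$-eigenspace of eigenvalue $\lambda+N$. For $v$ homogeneous of weight $k$ put $o(v)=v(k-1)$, and extend linearly. Let $h_1,\dots,h_m\in V_1$ be linearly independent with $h_i(0)h_j=0$ for all $i,j$, and such that each $h_j(0)$ acts semisimply on $M$ with integer eigenvalues. Let $\underline z\in\mathbb C^m$ and $\zeta_j=e^{2\pi i z_j}$. For $v_1,\dots,v_n\in V$ let $$J(v_1,\dots,v_n)=\operatorname{tr}_M Y(q_1^{L(0)}v_1,q_1)\cdots Y(q_n^{L(0)}v_n,q_n)\,\zeta_1^{h_1(0)}\cdots\zeta_m^{h_m(0)}q^{L(0)-\mathbf c/24},$$ and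 let $J^{o(v)}(v_1,\dots,v_n)$ be the same trace with $o(v)$ inserted to the left of all the vertex operators. Both are formal series: $q^{\lambda-\mathbf c/24}$ times a power series in $q$ in each monomial in the $q_i^{\pm1}$. Their values at $\tau$ in the upper half-plane and $w_1,\dots,w_n\in\mathbb C$ are obtained by $q=e^{2\pi i\tau}$, $q_i=e^{w_i}$. For $Z\in\mathbb C$, $\zeta=e^{2\pi iZ}$ and $k\ge1$ let $$\tilde P_k(w,\tau,Z)=\frac1{(k-1)!}\sum_{\ell\in\mathbb Z}\frac{\ell^{k-1}e^{w\ell}}{1-\zeta^{-1}q^\ell}\qquad(|q|<|e^w|<1),$$ $$\tilde E_k(\tau,Z)=c_k+\frac1{(k-1)!}\sum_{\ell\ge1}\ell^{k-1}\left(\frac{\zeta^{-1}q^\ell}{1-\zeta^{-1}q^\ell}+(-1)^k\frac{\zeta q^\ell}{1-\zeta q^\ell}\right),$$ where $c_1=\frac1{1-\zeta^{-1}}-\frac12$, $c_k=2(2\pi i)^{-k}\sum_{n\ge1}n^{-k}$ for even $k$, and $c_k=0$ for odd $k\ge3$. If $Z\in\mathbb Z$, the term $\ell=0$ of $\tilde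 P_k$ and the term $\frac1{1-\zeta^{-1}}$ of $c_1$ are left out. As formal series, $\tilde E_k$ and the coefficient of each $e^{w\ell}$ in $\tilde P_k$ are expanded in non-negative powers of $q$. **Statement.** Let $v\in V$ with $h_j(0)v=\mu_jv$, $\mu_j\in\mathbb C$, for $1\le j\le m$. Put $Z=\underline z\cdot\underline\mu=\sum_jz_j\mu_j$, and let $\delta_{Z,\mathbb Z}$ be $1$ if $Z\in\mathbb Z$ and $0$ otherwise. (a) For $n\ge0$ and $v_1,\dots,v_n\in V$, with $v$ inserted at $q_0=e^{w_0}$, $$J(v,v_1,\dots,v_n)=\delta_{Z,\mathbb Z}\,J^{o(v)}(v_1,\dots,v_n)+\sum_{s=1}^n\sum_{k\ge0}\tilde P_{k+1}(w_s-w_0,\tau,Z)\,J(v_1,\dots,v[k]v_s,\dots,v_n).$$ (b) For $n\ge1$, $v_1,\dots,v_n\in V$ and $p\ge1$, $$\begin{aligned}J(v[-p]v_1,v_2,\dots,v_n)={}&\delta_{Z,\mathbb Z}\,\delta_{p,1}\,J^{o(v)}(v_1,\dots,v_n)\\&+(-1)^{p+1}\sum_{k\ge0}\binom{k+p-1}{p-1}\tilde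 E_{k+p}(\tau,Z)\,J(v[k]v_1,v_2,\dots,v_n)\\&+(-1)^{p+1}\sum_{s=2}^n\sum_{k\ge0}\binom{k+p-1}{p-1}\tilde P_{k+p}(w_s-w_1,\tau,Z)\,J(v_1,\dots,v[k]v_s,\dots,v_n).\end{aligned}$$ Both hold as identities of formal series in $q$ and the $q_i^{\pm1}$. They also hold as identities of complex numbers at every point $(\tau,w)$ such that $Z\notin(\mathbb Z+\mathbb Z\tau)\setminus\mathbb Z$, such that $|q|<|e^{w_s-w_0}|<1$ for $1\le s\le n$ in (a), respectively $|q|<|e^{w_s-w_1}|<1$ for $2\le s\le n$ in (b), and at which the series of all $(n+1)$-point functions in (a), respectively of all $n$-point functions in (b), converge absolutely. The sums over $k$ are finite. -/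

import Mathlib

noncomputable section

namespace JacobiTrace

open scoped Classical

/-! ### Vertex operator algebras and their modules -/

/-- The Jacobi identity in component form (Borcherds' identity), for states of `V` acting on `M`:
`∑ᵢ C(p,i) (u(r+i)v)(p+q-i) = ∑ᵢ (-1)ⁱ C(r,i) (u(p+r-i) v(q+i) - (-1)ʳ v(q+r-i) u(p+i))`.
All the sums are finite on each vector. -/
def BorcherdsIdentity {V M : Type*} [AddCommGroup V] [Module ℂ V] [AddCommGroup M] [Module ℂ M]
    (Y : V →ₗ[ℂ] VertexOperator ℂ V) (YM : V →ₗ[ℂ] VertexOperator ℂ M) : Prop :=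
  ∀ (u v : V) (x : M) (p q r : ℤ),
    ∑ᶠ i : ℕ, Ring.choose p i •
        VertexOperator.ncoeff (YM (VertexOperator.ncoeff (Y u) (r + i) v)) (p + q - i) x =
      ∑ᶠ i : ℕ, ((-1 : ℤ) ^ i * Ring.choose r i) •
        (VertexOperator.ncoeff (YM u) (p + r - i) (VertexOperator.ncoeff (YM v) (q + i) x) -
          ((-1 : ℂ) ^ r) •
            VertexOperator.ncoeff (YM v) (q + r - i) (VertexOperator.ncoeff (YM u) (p + i) x))

/-- A vertex operator algebra structure `(V, Y, 𝟏, ω)` of central charge `c` on `V`.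
The `n`-th mode `v(n)`, i.e. the coefficient of `z^(-n-1)` in `Y(v, z)`, is
`VertexOperator.ncoeff (Y v) n`, and `L(n) = ω(n+1)`. -/
structure VOA (V : Type*) [AddCommGroup V] [Module ℂ V] where
  Y : V →ₗ[ℂ] VertexOperator ℂ V
  vac : V
  omega : V
  c : ℂ
  vac_mode : ∀ n : ℤ, VertexOperator.ncoeff (Y vac) n = if n = -1 then 1 else 0
  mode_vac : ∀ (v : V) (n : ℤ), 0 ≤ n → VertexOperator.ncoeff (Y v) n vac = 0
  mode_neg_one_vac : ∀ v : V, VertexOperator.ncoeff (Y v) (-1) vac = v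
  borcherds : BorcherdsIdentity Y Y
  virasoro : ∀ (i j : ℤ) (x : V),
    VertexOperator.ncoeff (Y omega) (i + 1) (VertexOperator.ncoeff (Y omega) (j + 1) x) -
      VertexOperator.ncoeff (Y omega) (j + 1) (VertexOperator.ncoeff (Y omega) (i + 1) x) =
      ((i : ℂ) - j) • VertexOperator.ncoeff (Y omega) (i + j + 1) x +
        (if i + j = 0 then ((i : ℂ) ^ 3 - i) / 12 * c else 0) • x
  /-- `Y(L(-1)v, z) = d/dz Y(v, z)`. -/
  translation : ∀ (v : V) (n : ℤ),
    VertexOperator.ncoeff (Y (VertexOperator.ncoeff (Y omega) 0 v)) n =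
      (-(n : ℂ)) • VertexOperator.ncoeff (Y v) (n - 1)
  /-- `V` is the direct sum of the eigenspaces `V_n` of `L(0)`, `n ∈ ℤ`. -/
  grading : DirectSum.IsInternal
    fun n : ℤ => Module.End.eigenspace (VertexOperator.ncoeff (Y omega) 1) (n : ℂ)
  finite : ∀ n : ℤ, FiniteDimensional ℂ
    (Module.End.eigenspace (VertexOperator.ncoeff (Y omega) 1) (n : ℂ))
  bounded : ∃ N : ℤ, ∀ n < N,
    Module.End.eigenspace (VertexOperator.ncoeff (Y omega) 1) (n : ℂ) = ⊥

/-- An (ordinary) module for the vertex operator algebra `A`: the space `M` is the direct sum of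
the finite-dimensional eigenspaces of `L(0)` with eigenvalues `wt + N`, `N = 0, 1, 2, …`. -/
structure VOAModule {V : Type*} [AddCommGroup V] [Module ℂ V] (A : VOA V)
    (M : Type*) [AddCommGroup M] [Module ℂ M] where
  Y : V →ₗ[ℂ] VertexOperator ℂ M
  vac_mode : ∀ n : ℤ, VertexOperator.ncoeff (Y A.vac) n = if n = -1 then 1 else 0
  borcherds : BorcherdsIdentity A.Y Y
  /-- The conformal weight. -/
  wt : ℂ
  grading : DirectSum.IsInternal
    fun N : ℕ => Module.End.eigenspace (VertexOperator.ncoeff (Y A.omega) 1) (wt + N)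
  finite : ∀ N : ℕ, FiniteDimensional ℂ
    (Module.End.eigenspace (VertexOperator.ncoeff (Y A.omega) 1) (wt + N))

/-- The projection onto the `i`-th summand of an internal direct sum. -/
def proj {ι M : Type*} [DecidableEq ι] [AddCommGroup M] [Module ℂ M] {S : ι → Submodule ℂ M}
    (hS : DirectSum.IsInternal S) (i : ι) : M →ₗ[ℂ] S i :=
  DirectSum.component ℂ ι (fun i => S i) i ∘ₗ
    (LinearEquiv.ofBijective (DirectSum.coeLinearMap S) hS).symm.toLinearMap

/-- `exp(2πi z T)` for a semisimple operator `T` with integer eigenvalues: the operator that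
acts on the `t`-eigenspace of `T` as `ζᵗ = exp(2πi z t)`. -/
def zetaPow {M : Type*} [AddCommGroup M] [Module ℂ M] {T : Module.End ℂ M}
    (hT : DirectSum.IsInternal fun t : ℤ => T.eigenspace (t : ℂ)) (z : ℂ) : Module.End ℂ M :=
  DirectSum.toModule ℂ ℤ M
      (fun t => Complex.exp (2 * Real.pi * Complex.I * z * t) • (T.eigenspace (t : ℂ)).subtype) ∘ₗ
    (LinearEquiv.ofBijective
      (DirectSum.coeLinearMap fun t : ℤ => T.eigenspace (t : ℂ)) hT).symm.toLinearMap

namespace VOA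

variable {V : Type*} [AddCommGroup V] [Module ℂ V] (A : VOA V)

/-- The mode `v(n)` acting on `V`. -/
def mode (v : V) (n : ℤ) : Module.End ℂ V := VertexOperator.ncoeff (A.Y v) n

/-- The component of `v` of conformal weight `k`. -/
def homog (k : ℤ) (v : V) : V := (proj A.grading k v : V)

/-- The coefficient of `z^(-j-1)` in the Laurent series `e^(kz) (e^z - 1)^(-n-1)`. -/
def sqCoeff (k n j : ℤ) : ℂ :=
  (((PowerSeries.exp ℂ : PowerSeries ℂ) : LaurentSeries ℂ) ^ k *
    ((PowerSeries.exp ℂ - 1 : PowerSeries ℂ) : LaurentSeries ℂ) ^ (-n - 1)).coeff (-j - 1)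

/-- The square bracket mode `v[j]`, applied to `u`. The modes are defined by
`Y[v, z] = Y(e^(z L(0)) v, e^z - 1) = ∑ⱼ v[j] z^(-j-1)`; for `v` of weight `k` this gives
`v[j] = ∑ₙ sqCoeff k n j • v(n)`. -/
def sq (v : V) (j : ℤ) (u : V) : V :=
  ∑ᶠ k : ℤ, ∑ᶠ n : ℤ, sqCoeff k n j • A.mode (A.homog k v) n u

end VOA

/-- Condition H for `h₁, …, h_m ∈ V₁` with respect to the module `X`. -/
structure ConditionH {V M : Type*} [AddCommGroup V] [Module ℂ V] [AddCommGroup M] [Module ℂ M]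
    {A : VOA V} (X : VOAModule A M) {m : ℕ} (h : Fin m → V) : Prop where
  weight_one : ∀ j, A.mode A.omega 1 (h j) = h j
  linearIndependent : LinearIndependent ℂ h
  semisimple : ∀ j, DirectSum.IsInternal
    fun t : ℤ => Module.End.eigenspace (VertexOperator.ncoeff (X.Y (h j)) 0) (t : ℂ)
  commute : ∀ i j, A.mode (h i) 0 (h j) = 0

/-! ### Formal `n`-point functions

A formal function of `q₁, …, qₙ` and `q` is recorded by its coefficients: `F e` is the coefficient
of `q₁^(e 0) ⋯ qₙ^(e (n-1))`, a power series in `q`. The overall factor `q^(wt - c/24)` common to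
all the traces is left out of the formal series and put back in `VOAModule.value`. -/

/-- Formal series in `qᵢ^(±1)`, `i < n`, with coefficients in `ℂ[[q]]`. -/
abbrev Formal (n : ℕ) : Type := (Fin n → ℤ) → PowerSeries ℂ

namespace VOAModule

variable {V M : Type*} [AddCommGroup V] [Module ℂ V] [AddCommGroup M] [Module ℂ M]
  {A : VOA V} (X : VOAModule A M)

/-- The coefficient of `x^e` in `Y(x^(L(0)) v, x)`; for `v` of weight `k` it is `v(k-1-e)`. -/
def coefOp (v : V) (e : ℤ) : Module.End ℂ M :=
  ∑ᶠ k : ℤ, VertexOperator.ncoeff (X.Y (A.homog k v)) (k - 1 - e)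

/-- The zero mode `o(v)`; for `v` of weight `k` it is `v(k-1)`. -/
def zeroMode (v : V) : Module.End ℂ M := X.coefOp v 0

/-- The graded trace `tr_M T q^(L(0) - wt)`: the coefficient of `q^N` is the trace of the diagonal
block of `T` on the `L(0)`-eigenspace of eigenvalue `wt + N`. -/
def gradedTrace (T : Module.End ℂ M) : PowerSeries ℂ :=
  PowerSeries.mk fun N => LinearMap.trace ℂ _
    (proj X.grading N ∘ₗ T ∘ₗ
      (Module.End.eigenspace (VertexOperator.ncoeff (X.Y A.omega) 1) (X.wt + N)).subtype)

variable {X} {m : ℕ} {h : Fin m → V}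

/-- The operator `ζ₁^(h₁(0)) ⋯ ζ_m^(h_m(0))`, where `ζⱼ = exp(2πi zⱼ)`. -/
def zetaOp (hH : ConditionH X h) (z : Fin m → ℂ) : Module.End ℂ M :=
  (List.ofFn fun j => zetaPow (hH.semisimple j) (z j)).prod

/-- The `n`-point function
`tr_M Y(q₁^(L(0)) u₁, q₁) ⋯ Y(qₙ^(L(0)) uₙ, qₙ) ζ₁^(h₁(0)) ⋯ ζ_m^(h_m(0)) q^(L(0) - wt)`. -/
def nPoint (hH : ConditionH X h) (z : Fin m → ℂ) {n : ℕ} (u : Fin n → V) : Formal n :=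
  fun e => X.gradedTrace ((List.ofFn fun i => X.coefOp (u i) (e i)).prod * zetaOp hH z)

/-- The trace with an additional zero mode,
`tr_M o(v) Y(q₁^(L(0)) u₁, q₁) ⋯ Y(qₙ^(L(0)) uₙ, qₙ) ζ₁^(h₁(0)) ⋯ ζ_m^(h_m(0)) q^(L(0) - wt)`. -/
def zeroModePoint (hH : ConditionH X h) (z : Fin m → ℂ) (v : V) {n : ℕ} (u : Fin n → V) :
    Formal n :=
  fun e => X.gradedTrace
    (X.zeroMode v * (List.ofFn fun i => X.coefOp (u i) (e i)).prod * zetaOp hH z)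

end VOAModule

namespace Formal

/-- A formal function of `q₁, …, qₙ`, regarded as a function of `q₀, q₁, …, qₙ`. -/
def extend {n : ℕ} (F : Formal n) : Formal (n + 1) :=
  fun e => if e 0 = 0 then F (Fin.tail e) else 0

/-- The product of `F` with the series `∑_ℓ P(ℓ) (q_s/q_t)^ℓ`; in the cases of interest, for fixed
exponents of the `qᵢ` and of `q`, only finitely many `ℓ` contribute. -/
def mulRatio {n : ℕ} (P : ℤ → PowerSeries ℂ) (s t : Fin n) (F : Formal n) : Formal n :=
  fun e => PowerSeries.mk fun N =>
    ∑ᶠ l : ℤ, PowerSeries.coeff N (P l * F (e - Pi.single s l + Pi.single t l))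

/-- The term of `F`, times `q^a`, in which the `qᵢ` have exponents `r.1` and `q` has exponent
`r.2 + a`, evaluated at `qᵢ = exp(wᵢ)` and `q = exp(2πi τ)`. -/
def term {n : ℕ} (F : Formal n) (a : ℂ) (w : Fin n → ℂ) (τ : ℂ) (r : (Fin n → ℤ) × ℕ) : ℂ :=
  PowerSeries.coeff r.2 (F r.1) * Complex.exp (∑ i, r.1 i * w i) *
    Complex.exp (2 * Real.pi * Complex.I * τ * (r.2 + a))

end Formal

namespace VOAModule

variable {V M : Type*} [AddCommGroup V] [Module ℂ V] [AddCommGroup M] [Module ℂ M]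
  {A : VOA V} (X : VOAModule A M)

/-- The value of a trace function at `(w, τ)`, including the factor `q^(wt - c/24)`. -/
def value {n : ℕ} (F : Formal n) (w : Fin n → ℂ) (τ : ℂ) : ℂ :=
  ∑' r, F.term (X.wt - A.c / 24) w τ r

/-- All the `n`-point functions converge absolutely at `(w, τ)`. -/
def ConvergesAt {X : VOAModule A M} {m : ℕ} {h : Fin m → V} (hH : ConditionH X h)
    (z : Fin m → ℂ) {n : ℕ} (w : Fin n → ℂ) (τ : ℂ) : Prop :=
  ∀ u : Fin n → V, Summable ((nPoint hH z u).term (X.wt - A.c / 24) w τ)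

end VOAModule

/-! ### Twisted Weierstrass functions and twisted Eisenstein series

Throughout `ζ = exp(2πi Z)` and `q = exp(2πi τ)`. -/

/-- `Z` is an integer, i.e. `ζ = 1`. -/
def IsInt (Z : ℂ) : Prop := ∃ a : ℤ, Z = a

/-- `ζ = exp(2πi Z)`. -/
def zeta (Z : ℂ) : ℂ := Complex.exp (2 * Real.pi * Complex.I * Z)

/-- `1 / (1 - ζ⁻¹)`, to be left out if `ζ = 1`. -/
def zeroTerm (Z : ℂ) : ℂ := if IsInt Z then 0 else 1 / (1 - (zeta Z)⁻¹)

/-- The twisted Weierstrass function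
`P_k(w, Z, τ) = 1/(k-1)! ∑_{ℓ ∈ ℤ} ℓ^(k-1) e^(wℓ) / (1 - ζ⁻¹ q^ℓ)`, for `k ≥ 1` and
`|q| < |e^w| < 1`; the term `ℓ = 0` is left out if `ζ = 1`. -/
def twistedP (k : ℕ) (w Z τ : ℂ) : ℂ :=
  1 / ((k - 1).factorial : ℂ) * ∑' l : ℤ,
    if l = 0 then (0 : ℂ) ^ (k - 1) * zeroTerm Z
    else (l : ℂ) ^ (k - 1) * Complex.exp (w * l) /
      (1 - (zeta Z)⁻¹ * Complex.exp (2 * Real.pi * Complex.I * τ * l))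

/-- The constant term in `q` of the twisted Eisenstein series `E_k`. -/
def eisensteinConst (k : ℕ) (Z : ℂ) : ℂ :=
  if k = 1 then zeroTerm Z - 1 / 2
  else if Even k then 2 * riemannZeta k / (2 * Real.pi * Complex.I) ^ k
  else 0

/-- The twisted Eisenstein series `E_k(τ, Z)`, `k ≥ 1`. -/
def twistedE (k : ℕ) (τ Z : ℂ) : ℂ :=
  eisensteinConst k Z + 1 / ((k - 1).factorial : ℂ) * ∑' l : ℕ, ((l : ℂ) + 1) ^ (k - 1) *
    (Complex.exp (2 * Real.pi * Complex.I * τ * (l + 1)) * (zeta Z)⁻¹ /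
        (1 - Complex.exp (2 * Real.pi * Complex.I * τ * (l + 1)) * (zeta Z)⁻¹) +
      (-1) ^ k * (Complex.exp (2 * Real.pi * Complex.I * τ * (l + 1)) * zeta Z /
        (1 - Complex.exp (2 * Real.pi * Complex.I * τ * (l + 1)) * zeta Z)))

/-- The expansion in `ℂ[[q]]` of `a q^l / (1 - a q^l)`, for `l ≥ 1`. -/
def lambert (a : ℂ) (l : ℕ) : PowerSeries ℂ :=
  PowerSeries.C a * PowerSeries.X ^ l * (1 - PowerSeries.C a * PowerSeries.X ^ l)⁻¹

/-- The expansion of `P_k(w, Z, τ)`: the coefficient of `e^(wl)` as a power series in `q`, where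
`1 / (1 - ζ⁻¹ q^l)` is expanded as `-ζ q^(-l) / (1 - ζ q^(-l))` if `l < 0`. -/
def formalP (k : ℕ) (Z : ℂ) (l : ℤ) : PowerSeries ℂ :=
  PowerSeries.C ((l : ℂ) ^ (k - 1) / ((k - 1).factorial : ℂ)) *
    (if l = 0 then PowerSeries.C (zeroTerm Z)
    else if 0 < l then 1 + lambert (zeta Z)⁻¹ l.natAbs
    else -lambert (zeta Z) l.natAbs)

/-- The expansion of `E_k(τ, Z)` as a power series in `q`. (The `l`-th summand of the Lambert
series is divisible by `q^l`.) -/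
def formalE (k : ℕ) (Z : ℂ) : PowerSeries ℂ :=
  PowerSeries.C (eisensteinConst k Z) + PowerSeries.C (1 / ((k - 1).factorial : ℂ)) *
    PowerSeries.mk fun N => ∑ l ∈ Finset.Icc 1 N, PowerSeries.coeff N
      (PowerSeries.C ((l : ℂ) ^ (k - 1)) *
        (lambert (zeta Z)⁻¹ l + PowerSeries.C ((-1) ^ k) * lambert (zeta Z) l))

end JacobiTrace

end

/-!
Write `v_a` for the coefficient of `x^a` in `Y(x^(L(0)) v, x)`. Borcherds' identity becomes
`[v_a, u_b] = ∑ⱼ (-a)^j / j! (v[j]u)_(a+b)`, and with `ζ = exp(2πi Z)`,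
`ζ^(h(0)) q^(L(0)) v_a = ζ q^a v_a ζ^(h(0)) q^(L(0))`. Moving `v_a` once around a trace therefore
reproduces that trace with the factor `ζ⁻¹ q^(-a)`, up to commutators: unless `a = 0` and `ζ = 1`,
the trace is `1 / (1 - ζ⁻¹ q^(-a))` times the traces of the commutators, and summing over `a` gives
the recursion for an additional point.

The state `v[-1]u` is the normally ordered product of `v` and `u`, corrected by Bernoulli numbers
times `v[j]u`. Applied to each half of the normally ordered product, the argument above yields the
coefficients of the twisted Eisenstein series. Replacing `v` by its derivative `L[-1]v` passes from
`v[-p]u` to `v[-p-1]u`.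

The formal recursions expand `1 / (1 - ζ⁻¹ q^l)` in powers of `q`, which need not converge at the
point in question for finitely many `l`. Multiplying by the corresponding factors `1 - ζ^(±1) q^l`
makes everything converge absolutely, and these factors do not vanish there because
`Z ∉ (ℤ + ℤτ) \ ℤ`.
-/

noncomputable section

namespace JacobiTrace

open scoped LaurentSeries PowerSeries

/-! ### Coefficients of `e^(kz) (e^z - 1)^(-n-1)` -/

section LaurentSeries

/-- The Euler derivation `z d/dz` of Laurent series. -/
def eulerDerivation (R : Type*) [CommRing R] : Derivation ℤ R⸨X⸩ R⸨X⸩ :=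
  let scale (f : R⸨X⸩) : R⸨X⸩ :=
    ⟨fun n => n * f.coeff n, f.isPWO_support.mono (Function.support_mul_subset_right _ _)⟩
  have support_scale (f : R⸨X⸩) : (scale f).support ⊆ f.support :=
    Function.support_mul_subset_right _ _
  have coeff_scale (f : R⸨X⸩) (n : ℤ) : (scale f).coeff n = n * f.coeff n := rfl
  { toFun := scale
    map_add' := fun f g => by ext n; simp [coeff_scale, mul_add]
    map_smul' := fun c f => by
      simp only [Algebra.smul_def, eq_intCast, ← zsmul_eq_mul]
      ext n
      rw [coeff_scale, HahnSeries.coeff_smul, HahnSeries.coeff_smul, coeff_scale, mul_smul_comm,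
        Int.cast_id]
    map_one_eq_zero' := by
      ext n
      change (scale 1).coeff n = 0
      rw [coeff_scale, HahnSeries.coeff_one]
      split_ifs with hn <;> simp [hn]
    leibniz' := fun f g => by
      ext n
      change n * (f * g).coeff n = (f * scale g + g * scale f).coeff n
      rw [mul_comm g, HahnSeries.coeff_add, HahnSeries.coeff_mul,
        HahnSeries.coeff_mul_left' f.isPWO_support (support_scale f),
        HahnSeries.coeff_mul_right' g.isPWO_support (support_scale g), Finset.mul_sum,
        ← Finset.sum_add_distrib]
      refine Finset.sum_congr rfl fun ij hij => ?_
      rw [coeff_scale, coeff_scale, ← (Finset.mem_antidiagonal.mp hij).2.2]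
      push_cast
      ring }

lemma coeff_eulerDerivation {R : Type*} [CommRing R] (f : R⸨X⸩) (n : ℤ) :
    (eulerDerivation R f).coeff n = n * f.coeff n := rfl

lemma coeff_coe_mul_eq_sum_range {R : Type*} [Semiring R] (P : R⟦X⟧) {g : R⸨X⸩} {m : ℤ} {K : ℕ}
    (hg : ∀ i : ℕ, K ≤ i → g.coeff (m - i) = 0) :
    ((P : R⸨X⸩) * g).coeff m =
      ∑ i ∈ Finset.range K, PowerSeries.coeff i P * g.coeff (m - i) := by
  let diagonal : ℕ ↪ ℤ × ℤ := ⟨fun i => (i, m - i), fun i j h => by simpa using h⟩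
  have hdiagonal (i : ℕ) : diagonal i = (↑i, m - i) := rfl
  rw [HahnSeries.coeff_mul, Finset.sum_subset (s₂ := (Finset.range K).map diagonal), Finset.sum_map]
  · simp only [hdiagonal, LaurentSeries.coeff_coe_powerSeries]
  · rintro ⟨i, j⟩ hij
    obtain ⟨hi, hj, rfl⟩ := Finset.mem_antidiagonal.mp hij
    have hi0 : 0 ≤ i := not_lt.mp fun h => hi (by rw [PowerSeries.coeff_coe, if_pos h])
    lift i to ℕ using hi0
    refine Finset.mem_map.mpr ⟨i, Finset.mem_range.mpr (not_le.mp fun h => hj ?_), by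
      simp [hdiagonal]⟩
    simpa using hg i h
  · intro ij hij hnotMem
    obtain ⟨i, -, rfl⟩ := Finset.mem_map.mp hij
    contrapose! hnotMem
    exact Finset.mem_antidiagonal.mpr
      ⟨left_ne_zero_of_mul hnotMem, right_ne_zero_of_mul hnotMem, by simp [hdiagonal]⟩

variable (K : Type*) [Field K] [CharZero K]

/-- The exponential series `e^z`, as a Laurent series. -/
def laurentExp : K⸨X⸩ := (PowerSeries.exp K : K⟦X⟧)

variable {K}

lemma coe_exp_sub_one : ((PowerSeries.exp K - 1 : K⟦X⟧) : K⸨X⸩) = laurentExp K - 1 := by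
  rw [PowerSeries.coe_sub, PowerSeries.coe_one, laurentExp]

lemma laurentExp_ne_zero : laurentExp K ≠ 0 := by
  rw [laurentExp, Ne, map_eq_zero_iff _ HahnSeries.ofPowerSeries_injective]
  exact (PowerSeries.isUnit_exp K).ne_zero

lemma eulerDerivation_laurentExp :
    eulerDerivation K (laurentExp K) = HahnSeries.single 1 1 * laurentExp K := by
  rw [laurentExp, ← PowerSeries.coe_X, ← PowerSeries.coe_mul]
  ext n
  rw [coeff_eulerDerivation, PowerSeries.coeff_coe, PowerSeries.coeff_coe]
  split_ifs with hn
  · rw [mul_zero]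
  · obtain ⟨n | n, rfl⟩ := Int.eq_ofNat_of_zero_le (not_lt.mp hn)
    · simp
    · rw [Int.natAbs_natCast, PowerSeries.coeff_succ_X_mul, PowerSeries.coeff_exp,
        PowerSeries.coeff_exp, Nat.factorial_succ]
      push_cast
      field_simp

lemma inv_laurentExp_sub_one :
    (laurentExp K - 1)⁻¹ =
      HahnSeries.single (-1) 1 * ((bernoulliPowerSeries K : K⟦X⟧) : K⸨X⸩) := by
  refine inv_eq_of_mul_eq_one_left ?_
  rw [← coe_exp_sub_one, mul_assoc, ← PowerSeries.coe_mul, bernoulliPowerSeries_mul_exp_sub_one,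
    PowerSeries.coe_X, HahnSeries.single_mul_single]
  simp

lemma laurentExp_sub_one_ne_zero : laurentExp K - 1 ≠ 0 := by
  rw [← coe_exp_sub_one, Ne, map_eq_zero_iff _ HahnSeries.ofPowerSeries_injective]
  intro h
  simpa using congrArg (PowerSeries.coeff 1) h

lemma exists_laurentExp_sub_one_zpow_eq (n : ℤ) :
    ∃ P : K⟦X⟧, (laurentExp K - 1) ^ n = HahnSeries.single n 1 * (P : K⸨X⸩) := by
  obtain ⟨k, rfl | rfl⟩ := n.eq_nat_or_neg
  · obtain ⟨Q, hQ⟩ := (PowerSeries.X_dvd_iff (φ := PowerSeries.exp K - 1)).mpr (by simp)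
    refine ⟨Q ^ k, ?_⟩
    rw [zpow_natCast, ← coe_exp_sub_one, hQ, PowerSeries.coe_mul, PowerSeries.coe_X, mul_pow,
      HahnSeries.single_pow, PowerSeries.coe_pow, nsmul_one, one_pow]
  · refine ⟨bernoulliPowerSeries K ^ k, ?_⟩
    rw [zpow_neg, zpow_natCast, ← inv_pow, inv_laurentExp_sub_one, mul_pow, HahnSeries.single_pow,
      PowerSeries.coe_pow]
    simp

lemma laurentExp_zpow (k : ℤ) :
    laurentExp K ^ k = (PowerSeries.rescale (k : K) (PowerSeries.exp K) : K⟦X⟧) := by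
  have pow (n : ℕ) : laurentExp K ^ n =
      (PowerSeries.rescale (n : K) (PowerSeries.exp K) : K⟦X⟧) := by
    rw [laurentExp, ← PowerSeries.coe_pow, PowerSeries.exp_pow_eq_rescale_exp]
  obtain ⟨n, rfl | rfl⟩ := k.eq_nat_or_neg
  · rw [zpow_natCast, pow, Int.cast_natCast]
  · rw [zpow_neg, zpow_natCast, pow]
    refine inv_eq_of_mul_eq_one_left ?_
    rw [← PowerSeries.coe_mul, PowerSeries.exp_mul_exp_eq_exp_add]
    simp [PowerSeries.rescale_zero]

lemma coeff_rescale_exp (c : K) (j : ℕ) :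
    PowerSeries.coeff j (PowerSeries.rescale c (PowerSeries.exp K)) = c ^ j / j.factorial := by
  simp [PowerSeries.coeff_rescale, PowerSeries.coeff_exp, div_eq_mul_inv]

end LaurentSeries


namespace VOA

lemma sqCoeff_eq_coeff (k n j : ℤ) :
    sqCoeff k n j = (laurentExp ℂ ^ k * (laurentExp ℂ - 1) ^ (-n - 1)).coeff (-j - 1) := by
  rw [sqCoeff, coe_exp_sub_one, laurentExp]

lemma eulerDerivation_laurentExp_zpow_mul (k n : ℤ) :
    eulerDerivation ℂ (laurentExp ℂ ^ k * (laurentExp ℂ - 1) ^ n) =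
      HahnSeries.single 1 1 * (k • (laurentExp ℂ ^ k * (laurentExp ℂ - 1) ^ n) +
        n • (laurentExp ℂ ^ (k + 1) * (laurentExp ℂ - 1) ^ (n - 1))) := by
  have hk : laurentExp ℂ ^ k = laurentExp ℂ ^ (k - 1) * laurentExp ℂ := by
    rw [← zpow_add_one₀ laurentExp_ne_zero, sub_add_cancel]
  rw [Derivation.leibniz, Derivation.leibniz_zpow, Derivation.leibniz_zpow, map_sub,
    Derivation.map_one_eq_zero, sub_zero, eulerDerivation_laurentExp,
    zpow_add_one₀ laurentExp_ne_zero, hk]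
  simp only [zsmul_eq_mul, smul_eq_mul]
  ring

lemma sqCoeff_derivative (k n j : ℤ) :
    -(n + 1) * sqCoeff (k + 1) (n + 1) j + k * sqCoeff k n j = -j * sqCoeff k n (j - 1) := by
  have h := congrArg (fun f : ℂ⸨X⸩ => f.coeff (-j - 1 + 1))
    (eulerDerivation_laurentExp_zpow_mul k (-n - 1))
  simp only [coeff_eulerDerivation, HahnSeries.coeff_single_mul_add, HahnSeries.coeff_add,
    ← Int.cast_smul_eq_zsmul ℂ, HahnSeries.coeff_smul, smul_eq_mul, one_mul] at h
  rw [sqCoeff_eq_coeff, sqCoeff_eq_coeff, sqCoeff_eq_coeff,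
    show -(n + 1) - 1 = -n - 1 - 1 by ring, show -(j - 1) - 1 = -j - 1 + 1 by ring]
  push_cast at h
  linear_combination -h

lemma sqCoeff_of_lt {k n j : ℤ} (h : n < j) : sqCoeff k n j = 0 := by
  obtain ⟨P, hP⟩ := exists_laurentExp_sub_one_zpow_eq (K := ℂ) (-n - 1)
  rw [sqCoeff_eq_coeff, hP, laurentExp_zpow, mul_left_comm, ← PowerSeries.coe_mul,
    show -j - 1 = (n - j) + (-n - 1) by ring, HahnSeries.coeff_single_mul_add,
    PowerSeries.coeff_coe, if_pos (by lia), mul_zero]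

lemma sqCoeff_add_zero (k c n : ℤ) {K : ℕ} (hK : n < K) :
    sqCoeff (k + c) n 0 = ∑ j ∈ Finset.range K, (c : ℂ) ^ j / j.factorial * sqCoeff k n j := by
  have index (i : ℕ) : (-0 - 1 - i : ℤ) = -i - 1 := by ring
  rw [sqCoeff_eq_coeff, zpow_add₀ laurentExp_ne_zero, mul_comm (_ ^ k), mul_assoc,
    laurentExp_zpow c, coeff_coe_mul_eq_sum_range (K := K) _ fun i hi => by
      rw [index, ← sqCoeff_eq_coeff, sqCoeff_of_lt (by lia)]]
  simp only [coeff_rescale_exp, sqCoeff_eq_coeff, index]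

/-- The coefficient `Bₙ / n!` of `zⁿ` in `z / (e^z - 1)`. -/
def bern (n : ℕ) : ℂ := PowerSeries.coeff n (bernoulliPowerSeries ℂ)

lemma sqCoeff_succ_zero (k n : ℤ) {K : ℕ} (hK : n < K) :
    sqCoeff k (n + 1) 0 =
      sqCoeff k n (-1) + ∑ j ∈ Finset.range K, bern (j + 1) * sqCoeff k n j := by
  have index (i : ℕ) : (0 - i : ℤ) = -(i - 1) - 1 := by ring
  rw [sqCoeff_eq_coeff, show -(n + 1) - 1 = -n - 1 + -1 by ring,
    zpow_add₀ laurentExp_sub_one_ne_zero, zpow_neg_one, inv_laurentExp_sub_one, ← mul_assoc,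
    mul_left_comm, show (-0 - 1 : ℤ) = 0 + -1 by ring, HahnSeries.coeff_single_mul_add, one_mul,
    mul_comm, coeff_coe_mul_eq_sum_range (K := K + 1) _ fun i hi => by
      rw [index, ← sqCoeff_eq_coeff, sqCoeff_of_lt (by lia)],
    Finset.sum_range_succ', add_comm]
  simp only [index, ← sqCoeff_eq_coeff, bern]
  simp [bernoulliPowerSeries]

lemma sqCoeff_pascal (k n j : ℤ) :
    sqCoeff (k + 1) (n + 1) j = sqCoeff k n j + sqCoeff k (n + 1) j := by
  rw [sqCoeff_eq_coeff, sqCoeff_eq_coeff, sqCoeff_eq_coeff, ← HahnSeries.coeff_add,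
    show -n - 1 = -(n + 1) - 1 + 1 by ring, zpow_add_one₀ laurentExp_ne_zero,
    zpow_add_one₀ laurentExp_sub_one_ne_zero]
  congr 1
  ring

lemma sqCoeff_zero_zero (k : ℤ) : sqCoeff k 0 0 = 1 := by
  have h := sqCoeff_succ_zero k (-1) (K := 0) (by lia)
  rw [neg_add_cancel, Finset.sum_range_zero, add_zero] at h
  rw [h, sqCoeff_eq_coeff, laurentExp_zpow]
  simp [PowerSeries.coeff_coe]

lemma sqCoeff_one_succ_zero (n : ℕ) : sqCoeff 1 (n + 1) 0 = 0 := by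
  have h : -((n : ℂ) + 1) * sqCoeff 1 (n + 1) 0 = 0 := by simpa using sqCoeff_derivative 0 n 0
  exact (mul_eq_zero.mp h).resolve_left (neg_ne_zero.mpr n.cast_add_one_ne_zero)

lemma sqCoeff_succ_natCast_zero (k : ℤ) (n : ℕ) :
    sqCoeff (k + 1) n 0 = (Ring.choose k n : ℤ) := by
  induction n generalizing k with
  | zero => simpa using sqCoeff_zero_zero (k + 1)
  | succ n ih =>
    have pascal (k : ℤ) : sqCoeff (k + 1 + 1) (n + 1) 0 =
        (Ring.choose k n : ℤ) + sqCoeff (k + 1) (n + 1) 0 := by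
      rw [sqCoeff_pascal, ih]
    have pascal_choose (k : ℤ) : ((Ring.choose (k + 1) (n + 1) : ℤ) : ℂ) =
        (Ring.choose k n : ℤ) + (Ring.choose k (n + 1) : ℤ) := by
      rw [Ring.choose_succ_succ, Int.cast_add]
    rw [Nat.cast_succ]
    induction k using Int.induction_on with
    | zero => simpa using sqCoeff_one_succ_zero n
    | succ i hi => rw [pascal, pascal_choose, hi]
    | pred i hi =>
      have h := (pascal (-i - 1)).symm
      have h_choose := pascal_choose (-i - 1)
      rw [sub_add_cancel] at h h_choose
      rw [hi, h_choose] at h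
      rw [sub_add_cancel]
      exact add_left_cancel h

end VOA

/-! ### Semisimple operators -/

section Grading

lemma isInternal_induction {R ι M : Type*} [DecidableEq ι] [Semiring R] [AddCommMonoid M]
    [Module R M] {S : ι → Submodule R M} (hS : DirectSum.IsInternal S) {p : M → Prop}
    (mem : ∀ i, ∀ x ∈ S i, p x) (zero : p 0) (add : ∀ x y, p x → p y → p (x + y)) (x : M) : p x :=
  Submodule.iSup_induction S (motive := p) (hS.submodule_iSup_eq_top ▸ Submodule.mem_top)
    mem zero add

variable {ι M : Type*} [DecidableEq ι] [AddCommGroup M] [Module ℂ M] {S : ι → Submodule ℂ M}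

lemma ofBijective_symm_of_mem (hS : DirectSum.IsInternal S) {i : ι} {x : M} (hx : x ∈ S i) :
    (LinearEquiv.ofBijective (DirectSum.coeLinearMap S) hS).symm x =
      DirectSum.lof ℂ ι (fun i => S i) i ⟨x, hx⟩ := by
  rw [LinearEquiv.symm_apply_eq]
  exact (DirectSum.coeLinearMap_lof S i ⟨x, hx⟩).symm

lemma proj_of_mem (hS : DirectSum.IsInternal S) {i : ι} {x : M} (hx : x ∈ S i) :
    (proj hS i x : M) = x :=
  congrArg Subtype.val (hS.ofBijective_coeLinearMap_of_mem hx)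

lemma proj_of_mem_ne (hS : DirectSum.IsInternal S) {i j : ι} (hij : i ≠ j) {x : M}
    (hx : x ∈ S i) : proj hS j x = 0 :=
  hS.ofBijective_coeLinearMap_of_mem_ne hij hx

lemma finite_support_proj (hS : DirectSum.IsInternal S) (x : M) :
    (Function.support fun i => (proj hS i x : M)).Finite :=
  (DFinsupp.finite_support ((LinearEquiv.ofBijective (DirectSum.coeLinearMap S) hS).symm x)).subset
    fun _ hi h => hi (congrArg Subtype.val h)

lemma finsum_proj (hS : DirectSum.IsInternal S) (x : M) : ∑ᶠ i, (proj hS i x : M) = x := by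
  induction x using isInternal_induction hS with
  | mem i x hx =>
    rw [finsum_eq_single _ i fun j hj => by
      rw [proj_of_mem_ne hS hj.symm hx, ZeroMemClass.coe_zero], proj_of_mem hS hx]
  | zero => simp
  | add x y hx hy =>
    simp only [map_add, Submodule.coe_add]
    rw [finsum_add_distrib (finite_support_proj hS x) (finite_support_proj hS y), hx, hy]

variable {T : Module.End ℂ M} {f : ι → ℂ}

lemma proj_apply_eq_smul_proj (hT : DirectSum.IsInternal fun i => T.eigenspace (f i)) (i : ι)
    (x : M) : (proj hT i (T x) : M) = f i • (proj hT i x : M) := by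
  induction x using isInternal_induction hT with
  | mem j x hx =>
    rw [Module.End.mem_eigenspace_iff.mp hx, map_smul, Submodule.coe_smul]
    rcases eq_or_ne j i with rfl | hji
    · rfl
    · simp [proj_of_mem_ne hT hji hx]
  | zero => simp
  | add x y hx hy => simp only [map_add, Submodule.coe_add, hx, hy, smul_add]

lemma proj_eq_zero_of_eigenvector (hT : DirectSum.IsInternal fun i => T.eigenspace (f i)) {c : ℂ}
    {y : M} (hy : T y = c • y) {i : ι} (hi : f i ≠ c) : proj hT i y = 0 := by
  have h := proj_apply_eq_smul_proj hT i y
  rw [hy, map_smul, Submodule.coe_smul, ← sub_eq_zero, ← sub_smul, smul_eq_zero] at h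
  exact Subtype.ext (h.resolve_left (sub_ne_zero.mpr hi.symm))

lemma eq_zero_of_eigenvector (hT : DirectSum.IsInternal fun i => T.eigenspace (f i)) {c : ℂ}
    {y : M} (hy : T y = c • y) (hc : ∀ i, f i ≠ c) : y = 0 := by
  rw [← finsum_proj hT y]
  simp [proj_eq_zero_of_eigenvector hT hy (hc _)]

end Grading

section Shift

/-- `[S, T] = c T`, so that `T` maps the `s`-eigenspace of `S` into the `(s + c)`-eigenspace. -/
def IsShift {R M : Type*} [CommSemiring R] [AddCommMonoid M] [Module R M] (S : Module.End R M)
    (c : R) (T : Module.End R M) : Prop :=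
  ∀ x, S (T x) = T (S x) + c • T x

lemma IsShift.apply {R M : Type*} [CommSemiring R] [AddCommMonoid M] [Module R M]
    {S T : Module.End R M} {c : R} (h : IsShift S c T) {s : R} {x : M} (hx : S x = s • x) :
    S (T x) = (s + c) • T x := by
  rw [h x, hx, map_smul, add_smul]

lemma IsShift.add {R M : Type*} [CommSemiring R] [AddCommMonoid M] [Module R M]
    {S T U : Module.End R M} {c : R} (hT : IsShift S c T) (hU : IsShift S c U) :
    IsShift S c (T + U) := fun x => by
  simp only [LinearMap.add_apply, map_add, hT x, hU x, smul_add, add_add_add_comm]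

variable {M : Type*} [AddCommGroup M] [Module ℂ M] {T U : Module.End ℂ M}

lemma zetaPow_apply (hT : DirectSum.IsInternal fun t : ℤ => T.eigenspace (t : ℂ)) (z : ℂ) {s : ℂ}
    {x : M} (hx : T x = s • x) :
    zetaPow hT z x = Complex.exp (2 * Real.pi * Complex.I * z * s) • x := by
  by_cases h : ∃ t : ℤ, (t : ℂ) = s
  · obtain ⟨t, rfl⟩ := h
    rw [zetaPow, LinearMap.comp_apply, LinearEquiv.coe_coe,
      ofBijective_symm_of_mem hT (Module.End.mem_eigenspace_iff.mpr hx), DirectSum.toModule_lof]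
    rfl
  · rw [eq_zero_of_eigenvector hT hx fun t ht => h ⟨t, ht⟩, map_zero, smul_zero]

lemma zetaPow_mul (hT : DirectSum.IsInternal fun t : ℤ => T.eigenspace (t : ℂ)) (z : ℂ) {c : ℂ}
    (hU : IsShift T c U) :
    zetaPow hT z * U = Complex.exp (2 * Real.pi * Complex.I * z * c) • (U * zetaPow hT z) := by
  refine LinearMap.ext fun x => ?_
  induction x using isInternal_induction hT with
  | mem t x hx =>
    have hx' := Module.End.mem_eigenspace_iff.mp hx
    rw [Module.End.mul_apply, zetaPow_apply hT z (hU.apply hx'), LinearMap.smul_apply,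
      Module.End.mul_apply, zetaPow_apply hT z hx', map_smul, smul_smul, ← Complex.exp_add]
    congr 2
    ring
  | zero => simp
  | add x y hx hy => rw [map_add, map_add, hx, hy]

end Shift

/-! ### Consequences of Borcherds' identity -/

section Borcherds

lemma choose_zero_of_ne_zero {i : ℕ} (hi : i ≠ 0) : Ring.choose (0 : ℤ) i = 0 := by
  rw [← Nat.cast_zero, Ring.choose_natCast, Nat.choose_eq_zero_of_lt (Nat.pos_of_ne_zero hi),
    Nat.cast_zero]

lemma choose_one_of_two_le {i : ℕ} (hi : 2 ≤ i) : Ring.choose (1 : ℤ) i = 0 := by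
  rw [← Nat.cast_one, Ring.choose_natCast, Nat.choose_eq_zero_of_lt hi, Nat.cast_zero]

lemma neg_one_pow_mul_choose_neg (r : ℤ) (i : ℕ) :
    (-1 : ℤ) ^ i * Ring.choose (-r) i = Ring.multichoose r i := by
  rw [Ring.choose_neg, ← Ring.multichoose_eq, Units.smul_def, smul_eq_mul, ← mul_assoc,
    Int.coe_negOnePow_natCast, ← mul_pow, neg_one_mul, neg_neg, one_pow, one_mul]

variable {V M : Type*} [AddCommGroup V] [Module ℂ V] [AddCommGroup M] [Module ℂ M]

lemma exists_ncoeff_eq_zero (B : VertexOperator ℂ M) (x : M) :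
    ∃ N : ℕ, ∀ n : ℤ, (N : ℤ) ≤ n → VertexOperator.ncoeff B n x = 0 :=
  ⟨(-HahnSeries.order ((HahnModule.of ℂ).symm (B x))).toNat, fun n hn =>
    VertexOperator.ncoeff_eq_zero_of_lt_order B n x (by lia)⟩

namespace BorcherdsIdentity

variable {Y : V →ₗ[ℂ] VertexOperator ℂ V} {YM : V →ₗ[ℂ] VertexOperator ℂ M}

lemma commutator (hY : BorcherdsIdentity Y YM) (u v : V) (x : M) (p q : ℤ) :
    VertexOperator.ncoeff (YM u) p (VertexOperator.ncoeff (YM v) q x) -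
      VertexOperator.ncoeff (YM v) q (VertexOperator.ncoeff (YM u) p x) =
    ∑ᶠ i : ℕ, Ring.choose p i •
      VertexOperator.ncoeff (YM (VertexOperator.ncoeff (Y u) i v)) (p + q - i) x := by
  have h := hY u v x p q 0
  simp only [zero_add, add_zero, zpow_zero, one_smul] at h
  rw [h, finsum_eq_single _ 0 fun i hi => by
    rw [choose_zero_of_ne_zero hi, mul_zero, zero_smul]]
  simp

lemma associativity (hY : BorcherdsIdentity Y YM) (u v : V) (x : M) (p q : ℤ) :
    ∑ᶠ i : ℕ, Ring.choose p i •
      VertexOperator.ncoeff (YM (VertexOperator.ncoeff (Y u) (i - 1) v)) (p + q - i) x =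
    ∑ᶠ i : ℕ,
      (VertexOperator.ncoeff (YM u) (p - 1 - i) (VertexOperator.ncoeff (YM v) (q + i) x) +
        VertexOperator.ncoeff (YM v) (q - 1 - i) (VertexOperator.ncoeff (YM u) (p + i) x)) := by
  have h := hY u v x p q (-1)
  simp only [neg_one_pow_mul_choose_neg, Ring.multichoose_one, one_smul, neg_add_eq_sub,
    zpow_neg_one, inv_neg, inv_one, neg_smul, sub_neg_eq_add, ← sub_eq_add_neg] at h
  exact h

lemma mode_neg_two_vac (hY : BorcherdsIdentity Y YM) {vac : V}
    (hvac : ∀ n : ℤ, VertexOperator.ncoeff (YM vac) n = if n = -1 then 1 else 0) (u : V) (q : ℤ) :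
    VertexOperator.ncoeff (YM (VertexOperator.ncoeff (Y u) (-2) vac)) q =
      (-(q : ℂ)) • VertexOperator.ncoeff (YM u) (q - 1) := by
  refine LinearMap.ext fun x => ?_
  have h := hY u vac x 0 q (-2)
  rw [finsum_eq_single _ 0 fun i hi => by rw [choose_zero_of_ne_zero hi, zero_smul]] at h
  simp only [neg_one_pow_mul_choose_neg, Ring.multichoose_two, Ring.choose_zero_right, one_smul,
    Nat.cast_zero, add_zero, zero_add, sub_zero, hvac, Even.neg_one_zpow (even_neg.mpr even_two)]
    at h
  rw [h]
  -- The vacuum has a single nonzero mode, so only the summand with `i + 1 = |q|` survives.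
  have hterm (i : ℕ) : ((i : ℤ) + 1) • (VertexOperator.ncoeff (YM u) (-2 - i)
      ((if q + i = -1 then (1 : Module.End ℂ M) else 0) x) -
        (if q + -2 - i = -1 then (1 : Module.End ℂ M) else 0)
          (VertexOperator.ncoeff (YM u) i x)) =
      if i + 1 = q.natAbs then (-(q : ℂ)) • VertexOperator.ncoeff (YM u) (q - 1) x else 0 := by
    split_ifs with h1 h2 h3 h3 h2 h3 h3
    all_goals first | lia | skip
    · obtain rfl : q = -(i + 1) := by lia
      simp [← Int.cast_smul_eq_zsmul ℂ, show -2 - (i : ℤ) = -(i + 1) - 1 by ring]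
    · obtain rfl : q = i + 1 := by lia
      simp [← Int.cast_smul_eq_zsmul ℂ, ← neg_smul]
    · simp
  rw [finsum_congr hterm]
  rcases hq : q.natAbs with - | n
  · simp [Int.natAbs_eq_zero.mp hq]
  · rw [finsum_eq_single _ n fun i hi => if_neg (mt Nat.succ.inj hi), if_pos rfl,
      LinearMap.smul_apply]

end BorcherdsIdentity

end Borcherds

namespace VOA

variable {V : Type*} [AddCommGroup V] [Module ℂ V] (A : VOA V)

/-- `v` is homogeneous of conformal weight `k`. -/
def HasWt (k : ℤ) (v : V) : Prop := A.mode A.omega 1 v = (k : ℂ) • v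

lemma homog_induction {p : V → Prop} (hwt : ∀ k v, A.HasWt k v → p v)
    (hadd : ∀ u v, p u → p v → p (u + v)) (v : V) : p v :=
  isInternal_induction A.grading
    (fun k x hx => hwt k x (Module.End.mem_eigenspace_iff.mp hx))
    (hwt 0 0 (by simp [HasWt])) hadd v

lemma finite_support_homog (v : V) : (Function.support fun k => A.homog k v).Finite :=
  finite_support_proj A.grading v

lemma exists_mode_eq_zero (v u : V) : ∃ N : ℕ, ∀ n : ℤ, (N : ℤ) ≤ n → A.mode v n u = 0 :=
  exists_ncoeff_eq_zero _ _

variable {A}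

lemma HasWt.mem_eigenspace {k : ℤ} {v : V} (h : A.HasWt k v) :
    v ∈ Module.End.eigenspace (VertexOperator.ncoeff (A.Y A.omega) 1) (k : ℂ) :=
  Module.End.mem_eigenspace_iff.mpr h

lemma HasWt.homog_self {k : ℤ} {v : V} (h : A.HasWt k v) : A.homog k v = v :=
  proj_of_mem A.grading h.mem_eigenspace

lemma HasWt.homog_of_ne {k l : ℤ} {v : V} (h : A.HasWt k v) (hl : l ≠ k) : A.homog l v = 0 := by
  rw [homog, proj_of_mem_ne A.grading hl.symm h.mem_eigenspace, ZeroMemClass.coe_zero]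

lemma homog_add (k : ℤ) (u v : V) : A.homog k (u + v) = A.homog k u + A.homog k v := by
  simp only [homog, map_add, Submodule.coe_add]

lemma homog_smul (k : ℤ) (c : ℂ) (v : V) : A.homog k (c • v) = c • A.homog k v := by
  simp only [homog, map_smul, Submodule.coe_smul]

lemma mode_add_left (u v : V) (n : ℤ) : A.mode (u + v) n = A.mode u n + A.mode v n := by
  simp only [mode, map_add, Pi.add_apply]

lemma mode_zero_left (n : ℤ) : A.mode 0 n = 0 := by
  simp only [mode, map_zero, Pi.zero_apply]

lemma mode_smul_left (c : ℂ) (v : V) (n : ℤ) : A.mode (c • v) n = c • A.mode v n := by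
  simp only [mode, map_smul, Pi.smul_apply]

/-! ### Square bracket modes -/

lemma support_sqCoeff_smul_mode_subset {v u : V} {N : ℕ}
    (hN : ∀ n : ℤ, (N : ℤ) ≤ n → A.mode v n u = 0) (k j : ℤ) :
    (Function.support fun n : ℤ => sqCoeff k n j • A.mode v n u) ⊆ Set.Ico j N := fun n hn =>
  ⟨not_lt.mp fun h => hn (by simp only [sqCoeff_of_lt h, zero_smul]),
    not_le.mp fun h => hn (by simp only [hN n h, smul_zero])⟩

lemma finite_support_sqCoeff_smul_mode (k j : ℤ) (v u : V) :
    (Function.support fun n : ℤ => sqCoeff k n j • A.mode v n u).Finite :=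
  have ⟨N, hN⟩ := A.exists_mode_eq_zero v u
  (Set.finite_Ico j N).subset (support_sqCoeff_smul_mode_subset hN k j)

lemma finite_support_finsum_sqCoeff_smul_mode (j : ℤ) (v u : V) :
    (Function.support fun k : ℤ =>
      ∑ᶠ n : ℤ, sqCoeff k n j • A.mode (A.homog k v) n u).Finite :=
  (A.finite_support_homog v).subset fun k hk h => hk (by
    change A.homog k v = 0 at h
    simp [h, mode_zero_left])

lemma sq_of_wt {k : ℤ} {v : V} (hv : A.HasWt k v) (j : ℤ) (u : V) :
    A.sq v j u = ∑ᶠ n : ℤ, sqCoeff k n j • A.mode v n u := by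
  rw [sq, finsum_eq_single _ k fun l hl => by simp [hv.homog_of_ne hl, mode_zero_left],
    hv.homog_self]

lemma sq_add_left (v v' : V) (j : ℤ) (u : V) : A.sq (v + v') j u = A.sq v j u + A.sq v' j u := by
  rw [sq, sq, sq, ← finsum_add_distrib (finite_support_finsum_sqCoeff_smul_mode j v u)
    (finite_support_finsum_sqCoeff_smul_mode j v' u)]
  refine finsum_congr fun k => ?_
  rw [← finsum_add_distrib (finite_support_sqCoeff_smul_mode k j _ u)
    (finite_support_sqCoeff_smul_mode k j _ u)]
  simp [homog_add, mode_add_left]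

lemma sq_add_right (v : V) (j : ℤ) (u u' : V) : A.sq v j (u + u') = A.sq v j u + A.sq v j u' := by
  rw [sq, sq, sq, ← finsum_add_distrib (finite_support_finsum_sqCoeff_smul_mode j v u)
    (finite_support_finsum_sqCoeff_smul_mode j v u')]
  refine finsum_congr fun k => ?_
  rw [← finsum_add_distrib (finite_support_sqCoeff_smul_mode k j _ u)
    (finite_support_sqCoeff_smul_mode k j _ u')]
  simp

lemma sq_smul_left (c : ℂ) (v : V) (j : ℤ) (u : V) : A.sq (c • v) j u = c • A.sq v j u := by
  simp only [sq, smul_finsum, homog_smul, mode_smul_left, LinearMap.smul_apply, smul_comm c]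

lemma sq_eq_sum {k : ℤ} {v : V} (hv : A.HasWt k v) {u : V} {N : ℕ}
    (hN : ∀ n : ℤ, (N : ℤ) ≤ n → A.mode v n u = 0) (p : ℕ) {j : ℤ} (hj : -(p : ℤ) ≤ j) :
    A.sq v j u = ∑ i ∈ Finset.range (N + p), sqCoeff k (i - p) j • A.mode v (i - p) u := by
  let shift : ℕ ↪ ℤ := ⟨fun i => i - p, fun a b h => by simpa using h⟩
  have hshift (i : ℕ) : shift i = i - p := rfl
  rw [sq_of_wt hv, finsum_eq_sum_of_support_subset _ (s := (Finset.range (N + p)).map shift),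
    Finset.sum_map]
  · simp only [hshift]
  · intro n hn
    obtain ⟨hjn, hnN⟩ := support_sqCoeff_smul_mode_subset hN k j hn
    exact Finset.mem_coe.mpr (Finset.mem_map.mpr
      ⟨(n + p).toNat, Finset.mem_range.mpr (by lia), by rw [hshift]; lia⟩)

variable (A) in
lemma eventually_sq_eq_zero (v u : V) :
    ∀ᶠ K : ℕ in Filter.atTop, ∀ j : ℕ, K ≤ j → A.sq v j u = 0 := by
  induction v using homog_induction A with
  | hwt k v hv =>
    obtain ⟨N, hN⟩ := A.exists_mode_eq_zero v u
    filter_upwards [Filter.eventually_ge_atTop N] with K hK j hj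
    rw [sq_of_wt hv]
    refine finsum_eq_zero_of_forall_eq_zero fun n => ?_
    by_contra hn
    obtain ⟨hjn, hnN⟩ := support_sqCoeff_smul_mode_subset hN k j hn
    lia
  | hadd v v' h h' =>
    filter_upwards [h, h'] with K h h' j hj
    rw [sq_add_left, h j hj, h' j hj, add_zero]

/-! ### Weights of modes -/

variable (A) in
lemma mode_omega_zero_eq_mode_neg_two_vac (v : V) : A.mode A.omega 0 v = A.mode v (-2) A.vac := by
  have h := A.mode_neg_one_vac (A.mode A.omega 0 v)
  rw [mode, A.translation v (-1)] at h
  rw [mode, mode, ← h]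
  norm_num

lemma mode_mode_omega_zero (v : V) (n : ℤ) :
    A.mode (A.mode A.omega 0 v) n = (-(n : ℂ)) • A.mode v (n - 1) :=
  A.translation v n

lemma HasWt.isShift_ncoeff {M : Type*} [AddCommGroup M] [Module ℂ M]
    {YM : V →ₗ[ℂ] VertexOperator ℂ M} (hY : BorcherdsIdentity A.Y YM)
    (htranslation : ∀ (v : V) (n : ℤ), VertexOperator.ncoeff (YM (A.mode A.omega 0 v)) n =
      (-(n : ℂ)) • VertexOperator.ncoeff (YM v) (n - 1)) {k : ℤ} {v : V} (hv : A.HasWt k v)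
    (n : ℤ) : IsShift (VertexOperator.ncoeff (YM A.omega) 1) ((k - n - 1 : ℤ) : ℂ)
      (VertexOperator.ncoeff (YM v) n) := by
  intro x
  have hcomm := hY.commutator A.omega v x 1 n
  have hsupport : (Function.support fun i : ℕ => Ring.choose (1 : ℤ) i • VertexOperator.ncoeff
      (YM (VertexOperator.ncoeff (A.Y A.omega) i v)) (1 + n - i) x) ⊆ Finset.range 2 :=
    fun i hi => Finset.mem_coe.mpr (Finset.mem_range.mpr (not_le.mp fun h =>
      hi (by simp only [choose_one_of_two_le h, zero_smul])))
  have h0 := htranslation v (1 + n)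
  have h1 : VertexOperator.ncoeff (A.Y A.omega) 1 v = (k : ℂ) • v := hv
  rw [mode] at h0
  rw [finsum_eq_sum_of_support_subset _ hsupport, Finset.sum_range_succ, Finset.sum_range_one]
    at hcomm
  simp only [Ring.choose_zero_right, Ring.choose_one_right, one_smul, Nat.cast_zero, Nat.cast_one,
    sub_zero, h0, h1, map_smul, Pi.smul_apply, LinearMap.smul_apply, add_sub_cancel_left] at hcomm
  rw [sub_eq_iff_eq_add'] at hcomm
  rw [hcomm, ← add_smul]
  congr 2
  push_cast
  ring

lemma HasWt.mode {k l : ℤ} {v u : V} (hv : A.HasWt k v) (hu : A.HasWt l u) (n : ℤ) :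
    A.HasWt (k + l - n - 1) (A.mode v n u) := by
  have h := (hv.isShift_ncoeff A.borcherds mode_mode_omega_zero n).apply hu
  rw [HasWt, VOA.mode, VOA.mode, h]
  congr 1
  push_cast
  ring

lemma hasWt_vac : A.HasWt 0 A.vac := by
  rw [HasWt, VOA.mode, A.mode_vac _ _ zero_le_one, Int.cast_zero, zero_smul]

lemma HasWt.mode_omega_zero {k : ℤ} {v : V} (hv : A.HasWt k v) :
    A.HasWt (k + 1) (A.mode A.omega 0 v) := by
  have h := hv.mode hasWt_vac (-2)
  rwa [← mode_omega_zero_eq_mode_neg_two_vac, show k + 0 - -2 - 1 = k + 1 by ring] at h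

end VOA

namespace VOA

variable {V : Type*} [AddCommGroup V] [Module ℂ V] {A : VOA V}

variable (A) in
/-- The square bracket translation operator `L[-1] = L(-1) + L(0)`. -/
def sqTranslate (v : V) : V := A.mode A.omega 0 v + A.mode A.omega 1 v

lemma sqTranslate_add (u v : V) :
    A.sqTranslate (u + v) = A.sqTranslate u + A.sqTranslate v := by
  rw [sqTranslate, sqTranslate, sqTranslate, map_add, map_add, add_add_add_comm]

lemma HasWt.sqTranslate_eq {k : ℤ} {v : V} (hv : A.HasWt k v) :
    A.sqTranslate v = A.mode A.omega 0 v + (k : ℂ) • v :=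
  congrArg (A.mode A.omega 0 v + ·) hv

lemma sq_sqTranslate (v : V) (j : ℤ) (u : V) :
    A.sq (A.sqTranslate v) j u = (-(j : ℂ)) • A.sq v (j - 1) u := by
  induction v using homog_induction A with
  | hwt k v hv =>
    rw [hv.sqTranslate_eq, sq_add_left, sq_smul_left, sq_of_wt hv, sq_of_wt hv,
      sq_of_wt hv.mode_omega_zero, smul_finsum, smul_finsum,
      ← finsum_comp_equiv (Equiv.addRight (1 : ℤ)), ← finsum_add_distrib]
    · refine finsum_congr fun n => ?_
      rw [Equiv.coe_addRight, mode_mode_omega_zero, add_sub_cancel_right, LinearMap.smul_apply,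
        smul_smul, smul_smul, smul_smul, ← add_smul, ← sqCoeff_derivative]
      congr 1
      push_cast
      ring
    · exact (finite_support_sqCoeff_smul_mode (k + 1) j (A.mode A.omega 0 v) u).preimage
        (Equiv.addRight (1 : ℤ)).injective.injOn
    · refine (finite_support_sqCoeff_smul_mode (A := A) k j v u).subset fun n hn h => hn ?_
      simp only [h, smul_zero]
  | hadd v v' h h' => rw [sqTranslate_add, sq_add_left, sq_add_left, h, h', smul_add]

lemma mode_omega_zero_mode_zero (h v : V) :
    A.mode A.omega 0 (A.mode h 0 v) = A.mode h 0 (A.mode A.omega 0 v) := by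
  have hcomm := A.borcherds.commutator A.omega h v 0 0
  rw [finsum_eq_single _ 0 fun i hi => by rw [choose_zero_of_ne_zero hi, zero_smul]] at hcomm
  have htranslate :
      VertexOperator.ncoeff (A.Y (VertexOperator.ncoeff (A.Y A.omega) 0 h)) 0 = 0 := by
    simpa using A.translation h 0
  rw [Nat.cast_zero, add_zero, sub_zero, htranslate, LinearMap.zero_apply, smul_zero] at hcomm
  exact sub_eq_zero.mp hcomm

lemma HasWt.mode_omega_one_mode_zero {h : V} (hh : A.HasWt 1 h) (v : V) :
    A.mode A.omega 1 (A.mode h 0 v) = A.mode h 0 (A.mode A.omega 1 v) := by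
  have hshift := hh.isShift_ncoeff A.borcherds mode_mode_omega_zero 0 v
  rwa [sub_zero, sub_self, Int.cast_zero, zero_smul, add_zero] at hshift

lemma mode_zero_sqTranslate {h v : V} (hh : A.HasWt 1 h) {c : ℂ} (hv : A.mode h 0 v = c • v) :
    A.mode h 0 (A.sqTranslate v) = c • A.sqTranslate v := by
  rw [sqTranslate, map_add, ← mode_omega_zero_mode_zero, ← hh.mode_omega_one_mode_zero, hv,
    map_smul, map_smul, smul_add]

lemma sum_pow_div_factorial_smul_sq {k : ℤ} {v u : V} (hv : A.HasWt k v) {N K : ℕ}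
    (hN : ∀ n : ℤ, (N : ℤ) ≤ n → A.mode v n u = 0) (hK : N ≤ K) (c : ℤ) :
    ∑ j ∈ Finset.range K, ((c : ℂ) ^ j / j.factorial) • A.sq v j u =
      ∑ i ∈ Finset.range N, Ring.choose (k - 1 + c) i • A.mode v i u := by
  have hsq (j : ℕ) : A.sq v j u = ∑ i ∈ Finset.range N, sqCoeff k i j • A.mode v i u := by
    simpa using sq_eq_sum hv hN 0 (j := j) (by simp)
  simp only [hsq, Finset.smul_sum, smul_smul]
  rw [Finset.sum_comm]
  refine Finset.sum_congr rfl fun i hi => ?_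
  rw [Finset.mem_range] at hi
  rw [← Finset.sum_smul, ← sqCoeff_add_zero k c i (by lia : (i : ℤ) < K),
    show k + c = k - 1 + c + 1 by ring, sqCoeff_succ_natCast_zero, Int.cast_smul_eq_zsmul]

lemma sq_neg_one_add_sum_bern_smul_sq {k : ℤ} {v u : V} (hv : A.HasWt k v) {N K : ℕ}
    (hN : ∀ n : ℤ, (N : ℤ) ≤ n → A.mode v n u = 0) (hK : N ≤ K) :
    A.sq v (-1) u + ∑ j ∈ Finset.range K, bern (j + 1) • A.sq v j u =
      ∑ i ∈ Finset.range (N + 1), Ring.choose (k - 1) i • A.mode v (i - 1) u := by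
  have hsq (j : ℤ) (hj : -1 ≤ j) : A.sq v j u =
      ∑ i ∈ Finset.range (N + 1), sqCoeff k (i - 1) j • A.mode v (i - 1) u := by
    simpa using sq_eq_sum hv hN 1 (j := j) (by simpa using hj)
  simp only [hsq _ le_rfl, hsq _ (neg_one_lt_zero.le.trans (Int.natCast_nonneg _)),
    Finset.smul_sum, smul_smul]
  rw [Finset.sum_comm, ← Finset.sum_add_distrib]
  refine Finset.sum_congr rfl fun i hi => ?_
  rw [Finset.mem_range] at hi
  rw [← Finset.sum_smul, ← add_smul, ← sqCoeff_succ_zero k (i - 1) (by lia : (i : ℤ) - 1 < K),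
    sub_add_cancel, ← Int.cast_smul_eq_zsmul ℂ, ← sqCoeff_succ_natCast_zero, sub_add_cancel]

lemma HasWt.sq_zero_of_wt_one {h : V} (hh : A.HasWt 1 h) (v : V) :
    A.sq h 0 v = A.mode h 0 v := by
  obtain ⟨N, hN⟩ := A.exists_mode_eq_zero h v
  have hsum := sum_pow_div_factorial_smul_sq hh (N := N + 1) (K := N + 1)
    (fun n hn => hN n (by push_cast at hn; lia)) le_rfl 0
  rwa [Finset.sum_eq_single 0 (fun j _ hj => by simp [hj]) (by simp),
    Finset.sum_eq_single 0 (fun i _ hi => by simp [choose_zero_of_ne_zero hi]) (by simp),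
    Nat.factorial_zero, Nat.cast_one, pow_zero, div_one, one_smul, Ring.choose_zero_right,
    one_smul] at hsum

end VOA

/-! ### The operators `coefOp v e` -/

namespace VOAModule

variable {V M : Type*} [AddCommGroup V] [Module ℂ V] [AddCommGroup M] [Module ℂ M]
  {A : VOA V} (X : VOAModule A M)

lemma ncoeff_mode_omega_zero (v : V) (n : ℤ) :
    VertexOperator.ncoeff (X.Y (A.mode A.omega 0 v)) n =
      (-(n : ℂ)) • VertexOperator.ncoeff (X.Y v) (n - 1) := by
  rw [A.mode_omega_zero_eq_mode_neg_two_vac, VOA.mode]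
  exact X.borcherds.mode_neg_two_vac X.vac_mode v n

/-- The operator `L(0)` on `M`. -/
def L0 : Module.End ℂ M := VertexOperator.ncoeff (X.Y A.omega) 1

lemma coefOp_of_wt {k : ℤ} {v : V} (hv : A.HasWt k v) (e : ℤ) :
    X.coefOp v e = VertexOperator.ncoeff (X.Y v) (k - 1 - e) := by
  rw [coefOp, finsum_eq_single _ k fun l hl => by
    simp only [hv.homog_of_ne hl, map_zero, Pi.zero_apply], hv.homog_self]

lemma finite_support_coefOp (v : V) (e : ℤ) : (Function.support fun k : ℤ =>
    VertexOperator.ncoeff (X.Y (A.homog k v)) (k - 1 - e)).Finite :=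
  (A.finite_support_homog v).subset fun k hk h => hk (by simp only [h, map_zero, Pi.zero_apply])

/-- `v ↦ coefOp v e` as a linear map, so that `coefOp` commutes with finite sums. -/
def coefOpL (e : ℤ) : V →ₗ[ℂ] Module.End ℂ M where
  toFun v := X.coefOp v e
  map_add' u v := by
    rw [coefOp, coefOp, coefOp,
      ← finsum_add_distrib (X.finite_support_coefOp u e) (X.finite_support_coefOp v e)]
    simp [VOA.homog_add]
  map_smul' c v := by
    simp only [coefOp, smul_finsum, VOA.homog_smul, map_smul, Pi.smul_apply, RingHom.id_apply]

lemma coefOp_add (u v : V) (e : ℤ) : X.coefOp (u + v) e = X.coefOp u e + X.coefOp v e :=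
  (X.coefOpL e).map_add u v

lemma coefOp_smul (c : ℂ) (v : V) (e : ℤ) : X.coefOp (c • v) e = c • X.coefOp v e :=
  (X.coefOpL e).map_smul c v

lemma coefOp_sum {ι : Type*} (s : Finset ι) (f : ι → V) (e : ℤ) :
    X.coefOp (∑ i ∈ s, f i) e = ∑ i ∈ s, X.coefOp (f i) e :=
  map_sum (X.coefOpL e) f s

lemma coefOp_vac (e : ℤ) : X.coefOp A.vac e = if e = 0 then 1 else 0 := by
  rw [X.coefOp_of_wt VOA.hasWt_vac, X.vac_mode]
  congr 1
  simp

lemma exists_coefOp_apply_eq_zero (u : V) (x : M) : ∃ B : ℤ, ∀ b ≤ B, X.coefOp u b x = 0 := by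
  induction u using VOA.homog_induction A with
  | hwt k u hu =>
    obtain ⟨N, hN⟩ := exists_ncoeff_eq_zero (X.Y u) x
    exact ⟨k - 1 - N, fun b hb => by rw [X.coefOp_of_wt hu]; exact hN _ (by lia)⟩
  | hadd u v hu hv =>
    obtain ⟨B, hB⟩ := hu
    obtain ⟨C, hC⟩ := hv
    refine ⟨min B C, fun b hb => ?_⟩
    rw [coefOp_add, LinearMap.add_apply, hB b (by lia), hC b (by lia), add_zero]

lemma isShift_coefOp (v : V) (e : ℤ) : IsShift X.L0 e (X.coefOp v e) := by
  induction v using VOA.homog_induction A with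
  | hwt k v hv =>
    have h := hv.isShift_ncoeff X.borcherds X.ncoeff_mode_omega_zero (k - 1 - e)
    rwa [← X.coefOp_of_wt hv, show k - (k - 1 - e) - 1 = e by ring] at h
  | hadd u v hu hv => rw [coefOp_add]; exact hu.add hv

lemma coefOp_sqTranslate (v : V) (e : ℤ) :
    X.coefOp (A.sqTranslate v) e = (e : ℂ) • X.coefOp v e := by
  induction v using VOA.homog_induction A with
  | hwt k v hv =>
    rw [hv.sqTranslate_eq, coefOp_add, coefOp_smul, X.coefOp_of_wt hv,
      X.coefOp_of_wt hv.mode_omega_zero, ncoeff_mode_omega_zero,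
      show k + 1 - 1 - e - 1 = k - 1 - e by ring, ← add_smul]
    congr 1
    push_cast
    ring
  | hadd v v' h h' => rw [VOA.sqTranslate_add, coefOp_add, coefOp_add, h, h', smul_add]

lemma coefOp_commutator_of_wt {k l : ℤ} {v u : V} (hv : A.HasWt k v) (hu : A.HasWt l u) {N K : ℕ}
    (hN : ∀ n : ℤ, (N : ℤ) ≤ n → A.mode v n u = 0) (hK : N ≤ K) (a b : ℤ) :
    X.coefOp v a * X.coefOp u b - X.coefOp u b * X.coefOp v a =
      ∑ j ∈ Finset.range K, ((-a : ℂ) ^ j / j.factorial) • X.coefOp (A.sq v j u) (a + b) := by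
  simp only [← coefOp_smul, ← coefOp_sum, ← Int.cast_neg]
  rw [VOA.sum_pow_div_factorial_smul_sq hv hN hK, coefOp_sum]
  refine LinearMap.ext fun x => ?_
  have hsupport : (Function.support fun i : ℕ => Ring.choose (k - 1 - a) i •
      VertexOperator.ncoeff (X.Y (VertexOperator.ncoeff (A.Y v) i u)) (k - 1 - a + (l - 1 - b) - i)
        x) ⊆ Finset.range N := fun i hi => Finset.mem_coe.mpr (Finset.mem_range.mpr
    (not_le.mp fun h => hi (by
      have hmode : VertexOperator.ncoeff (A.Y v) i u = 0 := hN i (by lia)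
      simp [hmode])))
  rw [LinearMap.sub_apply, Module.End.mul_apply, Module.End.mul_apply, X.coefOp_of_wt hv,
    X.coefOp_of_wt hu, X.borcherds.commutator, finsum_eq_sum_of_support_subset _ hsupport,
    LinearMap.sum_apply]
  refine Finset.sum_congr rfl fun i _ => ?_
  rw [← Int.cast_smul_eq_zsmul ℂ, ← Int.cast_smul_eq_zsmul ℂ, coefOp_smul,
    X.coefOp_of_wt (hv.mode hu i), LinearMap.smul_apply, VOA.mode, ← sub_eq_add_neg,
    show k + l - i - 1 - 1 - (a + b) = k - 1 - a + (l - 1 - b) - i by ring]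

lemma coefOp_commutator (v u : V) : ∀ᶠ K : ℕ in Filter.atTop, ∀ a b : ℤ,
    X.coefOp v a * X.coefOp u b - X.coefOp u b * X.coefOp v a =
      ∑ j ∈ Finset.range K, ((-a : ℂ) ^ j / j.factorial) • X.coefOp (A.sq v j u) (a + b) := by
  induction v using VOA.homog_induction A with
  | hwt k v hv =>
    induction u using VOA.homog_induction A with
    | hwt l u hu =>
      obtain ⟨N, hN⟩ := A.exists_mode_eq_zero v u
      filter_upwards [Filter.eventually_ge_atTop N] with K hK a b
      exact X.coefOp_commutator_of_wt hv hu hN hK a b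
    | hadd u u' h h' =>
      filter_upwards [h, h'] with K h h' a b
      simp only [VOA.sq_add_right, coefOp_add, smul_add, Finset.sum_add_distrib, ← h, ← h', mul_add,
        add_mul]
      abel
  | hadd v v' h h' =>
    filter_upwards [h, h'] with K h h' a b
    simp only [VOA.sq_add_left, coefOp_add, smul_add, Finset.sum_add_distrib, ← h, ← h', mul_add,
      add_mul]
    abel

/-- The partial sum up to `L` of the coefficient of `x^e` in the normally ordered product of
`Y(x^(L(0)) v, x)` and `Y(x^(L(0)) u, x)`. -/
def normalOrderSum (v u : V) (e : ℤ) (L : ℕ) : Module.End ℂ M :=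
  ∑ i ∈ Finset.range L, (X.coefOp v (1 + i) * X.coefOp u (e - 1 - i) +
    X.coefOp u (e + i) * X.coefOp v (-i))

lemma eventually_sum_choose_smul_coefOp_mode {k l : ℤ} {v u : V} (hv : A.HasWt k v)
    (hu : A.HasWt l u) {N : ℕ} (hN : ∀ n : ℤ, (N : ℤ) ≤ n → A.mode v n u = 0) (e : ℤ) (x : M) :
    ∀ᶠ L : ℕ in Filter.atTop, ∑ i ∈ Finset.range (N + 1),
      Ring.choose (k - 1) i • X.coefOp (A.mode v (i - 1) u) e x =
        X.normalOrderSum v u e L x := by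
  obtain ⟨N₁, hN₁⟩ := exists_ncoeff_eq_zero (X.Y v) x
  obtain ⟨N₂, hN₂⟩ := exists_ncoeff_eq_zero (X.Y u) x
  filter_upwards [Filter.eventually_ge_atTop (N₁ + N₂ + (1 - k).toNat + (e - l).toNat)] with L hL
  have hassoc := X.borcherds.associativity v u x (k - 1) (l - e)
  rw [finsum_eq_sum_of_support_subset _ (s := Finset.range (N + 1)),
    finsum_eq_sum_of_support_subset _ (s := Finset.range L)] at hassoc
  · rw [normalOrderSum, LinearMap.sum_apply]
    convert hassoc using 2 with i _ i _
    · rw [X.coefOp_of_wt (hv.mode hu _), VOA.mode,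
        show k + l - (i - 1) - 1 - 1 - e = k - 1 + (l - e) - (i : ℤ) by ring]
    · rw [LinearMap.add_apply, Module.End.mul_apply, Module.End.mul_apply, X.coefOp_of_wt hv,
        X.coefOp_of_wt hu, X.coefOp_of_wt hv, X.coefOp_of_wt hu,
        show k - 1 - (1 + i) = k - 1 - 1 - i by ring,
        show l - 1 - (e - 1 - i) = l - e + i by ring,
        show l - 1 - (e + i) = l - e - 1 - i by ring, show k - 1 - -i = k - 1 + (i : ℤ) by ring]
  · intro i hi
    refine Finset.mem_coe.mpr (Finset.mem_range.mpr (not_le.mp fun hLi => hi ?_))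
    simp only [hN₁ (k - 1 + i) (by lia), hN₂ (l - e + i) (by lia), map_zero, add_zero]
  · intro i hi
    refine Finset.mem_coe.mpr (Finset.mem_range.mpr (not_le.mp fun hNi => hi ?_))
    have hmode : VertexOperator.ncoeff (A.Y v) (i - 1) u = 0 := hN (i - 1) (by lia)
    simp [hmode]

lemma coefOp_normalOrder (v u : V) : ∀ᶠ K : ℕ in Filter.atTop, ∀ (e : ℤ) (x : M),
    ∀ᶠ L : ℕ in Filter.atTop,
      X.coefOp (A.sq v (-1) u + ∑ j ∈ Finset.range K, VOA.bern (j + 1) • A.sq v j u) e x =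
        X.normalOrderSum v u e L x := by
  induction v using VOA.homog_induction A with
  | hwt k v hv =>
    induction u using VOA.homog_induction A with
    | hwt l u hu =>
      obtain ⟨N, hN⟩ := A.exists_mode_eq_zero v u
      filter_upwards [Filter.eventually_ge_atTop N] with K hK e x
      filter_upwards [X.eventually_sum_choose_smul_coefOp_mode hv hu hN e x] with L hL
      rw [VOA.sq_neg_one_add_sum_bern_smul_sq hv hN hK, ← hL, coefOp_sum, LinearMap.sum_apply]
      simp only [← Int.cast_smul_eq_zsmul ℂ, coefOp_smul, LinearMap.smul_apply]
    | hadd u u' h h' =>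
      filter_upwards [h, h'] with K h h' e x
      filter_upwards [h e x, h' e x] with L h h'
      simp only [normalOrderSum, coefOp_add, VOA.sq_add_right, LinearMap.add_apply, mul_add,
        add_mul, smul_add, Finset.sum_add_distrib] at h h' ⊢
      linear_combination (norm := abel) h + h'
  | hadd v v' h h' =>
    filter_upwards [h, h'] with K h h' e x
    filter_upwards [h e x, h' e x] with L h h'
    simp only [normalOrderSum, coefOp_add, VOA.sq_add_left, LinearMap.add_apply, mul_add,
      add_mul, smul_add, Finset.sum_add_distrib] at h h' ⊢
    linear_combination (norm := abel) h + h'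

lemma coefOp_zero_of_wt_one {h : V} (hh : A.HasWt 1 h) :
    X.coefOp h 0 = VertexOperator.ncoeff (X.Y h) 0 := by
  rw [X.coefOp_of_wt hh, sub_zero, sub_self]

lemma isShift_ncoeff_zero_coefOp {h v : V} (hh : A.HasWt 1 h) {c : ℂ}
    (hv : A.mode h 0 v = c • v) (e : ℤ) :
    IsShift (VertexOperator.ncoeff (X.Y h) 0) c (X.coefOp v e) := by
  intro x
  obtain ⟨K, hK⟩ := (X.coefOp_commutator h v).exists_forall_of_atTop
  have hcomm := hK (K + 1) (by lia) 0 e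
  rw [Finset.sum_eq_single 0 (fun j _ hj => by simp [hj]) (by simp), Nat.cast_zero,
    hh.sq_zero_of_wt_one, hv, coefOp_smul, X.coefOp_zero_of_wt_one hh, zero_add, pow_zero,
    Nat.factorial_zero, Nat.cast_one, div_one, one_smul, sub_eq_iff_eq_add'] at hcomm
  exact LinearMap.congr_fun hcomm x

end VOAModule

/-! ### Graded traces -/

namespace VOAModule

variable {V M : Type*} [AddCommGroup V] [Module ℂ V] [AddCommGroup M] [Module ℂ M]
  {A : VOA V} (X : VOAModule A M)

/-- The graded trace as a linear map, so that it commutes with finite sums. -/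
def gradedTraceL : Module.End ℂ M →ₗ[ℂ] PowerSeries ℂ where
  toFun := X.gradedTrace
  map_add' T U := by
    ext N
    simp only [gradedTrace, PowerSeries.coeff_mk, map_add, LinearMap.add_comp, LinearMap.comp_add]
  map_smul' c T := by
    ext N
    simp only [gradedTrace, PowerSeries.coeff_mk, map_smul, LinearMap.smul_comp,
      LinearMap.comp_smul, RingHom.id_apply]

lemma gradedTrace_add (T U : Module.End ℂ M) :
    X.gradedTrace (T + U) = X.gradedTrace T + X.gradedTrace U := X.gradedTraceL.map_add T U

lemma gradedTrace_sub (T U : Module.End ℂ M) :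
    X.gradedTrace (T - U) = X.gradedTrace T - X.gradedTrace U := X.gradedTraceL.map_sub T U

lemma gradedTrace_smul (c : ℂ) (T : Module.End ℂ M) :
    X.gradedTrace (c • T) = PowerSeries.C c * X.gradedTrace T := by
  rw [← PowerSeries.smul_eq_C_mul]
  exact X.gradedTraceL.map_smul c T

lemma gradedTrace_zero : X.gradedTrace 0 = 0 := X.gradedTraceL.map_zero

lemma gradedTrace_sum {ι : Type*} (s : Finset ι) (f : ι → Module.End ℂ M) :
    X.gradedTrace (∑ i ∈ s, f i) = ∑ i ∈ s, X.gradedTrace (f i) :=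
  map_sum X.gradedTraceL f s

lemma coeff_gradedTrace_eq_zero {T : Module.End ℂ M} {N : ℕ}
    (hT : ∀ x, X.L0 x = (X.wt + N) • x → proj X.grading N (T x) = 0) :
    PowerSeries.coeff N (X.gradedTrace T) = 0 := by
  rw [gradedTrace, PowerSeries.coeff_mk]
  refine (congrArg _ (LinearMap.ext fun x => ?_)).trans (map_zero _)
  exact hT x (Module.End.mem_eigenspace_iff.mp x.2)

lemma eventually_coeff_gradedTrace {ι : Type*} {F : Filter ι} {T U : ι → Module.End ℂ M}
    (h : ∀ x, ∀ᶠ i in F, T i x = U i x) (N : ℕ) :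
    ∀ᶠ i in F, ∀ n ≤ N, PowerSeries.coeff n (X.gradedTrace (T i)) =
      PowerSeries.coeff n (X.gradedTrace (U i)) := by
  refine (Filter.eventually_all_finite (Set.finite_le_nat N)).mpr fun n _ => ?_
  have := X.finite n
  let b := Module.finBasis ℂ
    (Module.End.eigenspace (VertexOperator.ncoeff (X.Y A.omega) 1) (X.wt + n))
  filter_upwards [Filter.eventually_all.mpr fun k => h (b k)] with i hi
  simp only [gradedTrace, PowerSeries.coeff_mk]
  congr 1
  refine b.ext fun k => ?_
  simp only [LinearMap.comp_apply, Submodule.subtype_apply, hi]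

lemma wt_add_natCast_eq_iff {N j : ℕ} {a : ℤ} :
    X.wt + N = X.wt + j + a ↔ (N : ℤ) = j + a := by
  rw [add_assoc, add_right_inj]
  exact_mod_cast Iff.rfl

variable {X} {T : Module.End ℂ M} {a : ℤ}

lemma apply_eq_zero_of_shift (hT : IsShift X.L0 a T) {N : ℕ} (h : N + a < 0) {x : M}
    (hx : X.L0 x = (X.wt + N) • x) : T x = 0 := by
  refine eq_zero_of_eigenvector X.grading (hT.apply hx) fun i hi => ?_
  have hweight := X.wt_add_natCast_eq_iff.mp hi
  lia

lemma proj_shift (hT : IsShift X.L0 a T) {N N' : ℕ} (h : (N : ℤ) = N' + a) (x : M) :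
    (proj X.grading N (T x) : M) = T (proj X.grading N' x) := by
  induction x using isInternal_induction X.grading with
  | mem j x hx =>
    have hTx := hT.apply (Module.End.mem_eigenspace_iff.mp hx)
    rcases eq_or_ne j N' with rfl | hj
    · rw [proj_of_mem X.grading hx, proj_of_mem]
      rw [← X.wt_add_natCast_eq_iff.mpr h] at hTx
      exact Module.End.mem_eigenspace_iff.mpr hTx
    · rw [proj_of_mem_ne X.grading hj hx, proj_eq_zero_of_eigenvector X.grading hTx,
        ZeroMemClass.coe_zero, ZeroMemClass.coe_zero, map_zero]
      intro hi
      have hweight := X.wt_add_natCast_eq_iff.mp hi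
      lia
  | zero => simp
  | add x y hx hy => simp only [map_add, Submodule.coe_add, hx, hy]

lemma proj_shift_eq_zero (hT : IsShift X.L0 a T) {N : ℕ} (h : (N : ℤ) < a) (x : M) :
    proj X.grading N (T x) = 0 := by
  induction x using isInternal_induction X.grading with
  | mem j x hx =>
    refine proj_eq_zero_of_eigenvector X.grading
      (hT.apply (Module.End.mem_eigenspace_iff.mp hx)) fun hi => ?_
    have hweight := X.wt_add_natCast_eq_iff.mp hi
    lia
  | zero => simp
  | add x y hx hy => rw [map_add, map_add, hx, hy, add_zero]

lemma coeff_gradedTrace_mul_comm (hT : IsShift X.L0 a T) {N N' : ℕ} (h : (N : ℤ) = N' + a)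
    (U : Module.End ℂ M) :
    PowerSeries.coeff N (X.gradedTrace (T * U)) = PowerSeries.coeff N' (X.gradedTrace (U * T)) := by
  have := X.finite N
  have := X.finite N'
  let ι (n : ℕ) := (Module.End.eigenspace (VertexOperator.ncoeff (X.Y A.omega) 1)
    (X.wt + n)).subtype
  have hTU : proj X.grading N ∘ₗ (T * U) ∘ₗ ι N =
      (proj X.grading N ∘ₗ T ∘ₗ ι N') ∘ₗ (proj X.grading N' ∘ₗ U ∘ₗ ι N) := by
    refine LinearMap.ext fun x => Subtype.ext ?_
    simp only [LinearMap.comp_apply, Module.End.mul_apply, ι, Submodule.subtype_apply]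
    rw [← proj_shift hT h (U x), proj_of_mem X.grading (Subtype.coe_prop _)]
  have hUT : proj X.grading N' ∘ₗ (U * T) ∘ₗ ι N' =
      (proj X.grading N' ∘ₗ U ∘ₗ ι N) ∘ₗ (proj X.grading N ∘ₗ T ∘ₗ ι N') := by
    refine LinearMap.ext fun x => Subtype.ext ?_
    simp only [LinearMap.comp_apply, Module.End.mul_apply, ι, Submodule.subtype_apply]
    rw [proj_shift hT h, proj_of_mem X.grading x.2]
  simp only [gradedTrace, PowerSeries.coeff_mk]
  rw [hTU, hUT, LinearMap.trace_comp_comm']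

lemma gradedTrace_mul_of_shift {a : ℕ} (hT : IsShift X.L0 (a : ℤ) T) (U : Module.End ℂ M) :
    X.gradedTrace (T * U) = PowerSeries.X ^ a * X.gradedTrace (U * T) := by
  ext N
  rw [PowerSeries.coeff_X_pow_mul']
  split_ifs with h
  · exact coeff_gradedTrace_mul_comm hT (by lia) U
  · exact X.coeff_gradedTrace_eq_zero fun x _ => proj_shift_eq_zero hT (by lia) (U x)

lemma gradedTrace_mul_of_shift_neg {a : ℕ} (hT : IsShift X.L0 (-a : ℤ) T) (U : Module.End ℂ M) :
    X.gradedTrace (U * T) = PowerSeries.X ^ a * X.gradedTrace (T * U) := by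
  ext N
  rw [PowerSeries.coeff_X_pow_mul']
  split_ifs with h
  · exact (coeff_gradedTrace_mul_comm hT (by lia) U).symm
  · refine X.coeff_gradedTrace_eq_zero fun x hx => ?_
    rw [Module.End.mul_apply, apply_eq_zero_of_shift hT (by lia) hx, map_zero, map_zero]

end VOAModule

section ListProd

lemma commutator_list_prod {R : Type*} [Ring R] (T : R) {n : ℕ} (f : Fin n → R) :
    T * (List.ofFn f).prod - (List.ofFn f).prod * T =
      ∑ s, (List.ofFn (Function.update f s (T * f s - f s * T))).prod := by
  induction n with
  | zero => simp
  | succ n ih =>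
    obtain ⟨x, f, rfl⟩ : ∃ x g, f = Fin.cons x g := ⟨f 0, Fin.tail f, (Fin.cons_self_tail f).symm⟩
    simp only [Fin.sum_univ_succ, Fin.cons_zero, Fin.cons_succ, Fin.update_cons_zero,
      ← Fin.cons_update, List.ofFn_cons, List.prod_cons, ← Finset.mul_sum, ← ih]
    noncomm_ring

lemma list_prod_mul_of_mul_eq_smul_mul {R B : Type*} [CommSemiring R] [Semiring B] [Algebra R B]
    {m : ℕ} {f : Fin m → B} {c : Fin m → R} {U : B} (h : ∀ j, f j * U = c j • (U * f j)) :
    (List.ofFn f).prod * U = (∏ j, c j) • (U * (List.ofFn f).prod) := by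
  induction m with
  | zero => simp
  | succ m ih =>
    rw [List.ofFn_succ, List.prod_cons, mul_assoc, ih fun j => h j.succ, mul_smul_comm, ← mul_assoc,
      h 0, Fin.prod_univ_succ, smul_mul_assoc, smul_smul, mul_assoc, mul_comm (c 0)]

end ListProd

/-! ### The kernel of the recursion -/

/-- The expansion of `1 / (1 - ζ⁻¹ q^l)` in nonnegative powers of `q`, replaced by `0` if `l = 0`
and `ζ = 1`. -/
def kernelP (Z : ℂ) (l : ℤ) : PowerSeries ℂ :=
  if l = 0 then PowerSeries.C (zeroTerm Z)
  else if 0 < l then 1 + lambert (zeta Z)⁻¹ l.natAbs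
  else -lambert (zeta Z) l.natAbs

lemma formalP_eq (k : ℕ) (Z : ℂ) (l : ℤ) :
    formalP k Z l = PowerSeries.C ((l : ℂ) ^ (k - 1) / ((k - 1).factorial : ℂ)) * kernelP Z l := rfl

lemma kernelP_zero (Z : ℂ) : kernelP Z 0 = PowerSeries.C (zeroTerm Z) := if_pos rfl

lemma kernelP_natCast (Z : ℂ) {l : ℕ} (hl : l ≠ 0) : kernelP Z l = 1 + lambert (zeta Z)⁻¹ l := by
  rw [kernelP, if_neg (by lia), if_pos (by lia), Int.natAbs_natCast]

lemma kernelP_neg_natCast (Z : ℂ) {l : ℕ} (hl : l ≠ 0) : kernelP Z (-l) = -lambert (zeta Z) l := by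
  rw [kernelP, if_neg (by lia), if_neg (by lia), Int.natAbs_neg, Int.natAbs_natCast]

lemma zeta_ne_zero (Z : ℂ) : zeta Z ≠ 0 := Complex.exp_ne_zero _

lemma zeta_eq_one_iff (Z : ℂ) : zeta Z = 1 ↔ IsInt Z := by
  rw [zeta, Complex.exp_eq_one_iff, IsInt]
  refine exists_congr fun n => ?_
  rw [mul_comm (n : ℂ)]
  exact mul_right_inj' Complex.two_pi_I_ne_zero

lemma one_sub_inv_zeta_ne_zero {Z : ℂ} (hZ : ¬IsInt Z) : 1 - (zeta Z)⁻¹ ≠ 0 :=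
  sub_ne_zero.mpr fun h => hZ ((zeta_eq_one_iff Z).mp (inv_eq_one.mp h.symm))

lemma one_sub_mul_lambert (a : ℂ) {l : ℕ} (hl : l ≠ 0) :
    (1 - PowerSeries.C a * PowerSeries.X ^ l) * lambert a l =
      PowerSeries.C a * PowerSeries.X ^ l := by
  rw [lambert, mul_left_comm, PowerSeries.mul_inv_cancel, mul_one]
  simp [hl]

lemma one_sub_C_mul_X_pow_ne_zero (a : ℂ) {l : ℕ} (hl : l ≠ 0) :
    (1 - PowerSeries.C a * PowerSeries.X ^ l : PowerSeries ℂ) ≠ 0 := fun h => by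
  simpa [hl] using congrArg PowerSeries.constantCoeff h

lemma kernelP_natCast_mul (Z : ℂ) {l : ℕ} (hl : l ≠ 0) (F : PowerSeries ℂ) :
    kernelP Z l * (F - PowerSeries.C (zeta Z)⁻¹ * (PowerSeries.X ^ l * F)) = F := by
  rw [kernelP_natCast Z hl]
  linear_combination F * one_sub_mul_lambert (zeta Z)⁻¹ hl

lemma kernelP_neg_natCast_mul (Z : ℂ) {l : ℕ} (hl : l ≠ 0) (F : PowerSeries ℂ) :
    kernelP Z (-l) * (PowerSeries.X ^ l * F - PowerSeries.C (zeta Z)⁻¹ * F) =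
      PowerSeries.X ^ l * F := by
  have hC : (PowerSeries.C (zeta Z) : PowerSeries ℂ) * PowerSeries.C (zeta Z)⁻¹ = 1 := by
    rw [← map_mul, mul_inv_cancel₀ (zeta_ne_zero Z), map_one]
  rw [kernelP_neg_natCast Z hl]
  linear_combination (PowerSeries.C (zeta Z)⁻¹ * F) * one_sub_mul_lambert (zeta Z) hl +
    (PowerSeries.X ^ l * F + PowerSeries.X ^ l * lambert (zeta Z) l * F) * hC

lemma kernelP_zero_mul {Z : ℂ} (hZ : ¬IsInt Z) (F : PowerSeries ℂ) :
    kernelP Z 0 * (F - PowerSeries.C (zeta Z)⁻¹ * F) = F := by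
  rw [kernelP_zero, zeroTerm, if_neg hZ,
    show F - PowerSeries.C (zeta Z)⁻¹ * F = PowerSeries.C (1 - (zeta Z)⁻¹) * F by
      rw [map_sub, map_one]; ring,
    ← mul_assoc, ← map_mul, one_div_mul_cancel (one_sub_inv_zeta_ne_zero hZ), map_one, one_mul]

lemma kernelP_zero_of_isInt {Z : ℂ} (hZ : IsInt Z) : kernelP Z 0 = 0 := by
  rw [kernelP_zero, zeroTerm, if_pos hZ, map_zero]

/-! ### The recursion for an additional point -/

namespace VOAModule

variable {V M : Type*} [AddCommGroup V] [Module ℂ V] [AddCommGroup M] [Module ℂ M]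
  {A : VOA V} (X : VOAModule A M) {n : ℕ}

/-- The coefficient of `∏ᵢ qᵢ^(eᵢ)` in the product of vertex operators of an `n`-point function. -/
def opProd (u : Fin n → V) (e : Fin n → ℤ) : Module.End ℂ M :=
  (List.ofFn fun i => X.coefOp (u i) (e i)).prod

lemma opProd_succ (u : Fin (n + 1) → V) (e : Fin (n + 1) → ℤ) :
    X.opProd u e = X.coefOp (u 0) (e 0) * X.opProd (Fin.tail u) (Fin.tail e) := by
  rw [opProd, List.ofFn_succ, List.prod_cons]
  rfl

lemma opProd_update (u : Fin n → V) (e : Fin n → ℤ) (s : Fin n) (w : V) (b : ℤ) :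
    X.opProd (Function.update u s w) (e + Pi.single s b) =
      MultilinearMap.mkPiAlgebraFin ℂ n (Module.End ℂ M)
        (Function.update (fun i => X.coefOp (u i) (e i)) s (X.coefOp w (b + e s))) := by
  rw [opProd, MultilinearMap.mkPiAlgebraFin_apply]
  congr 2
  funext i
  rcases eq_or_ne i s with rfl | h
  · simp [add_comm]
  · simp [h]

lemma opProd_commutator (v : V) (u : Fin n → V) : ∀ᶠ K : ℕ in Filter.atTop, ∀ (a : ℤ)
    (e : Fin n → ℤ), X.coefOp v a * X.opProd u e - X.opProd u e * X.coefOp v a =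
      ∑ s, ∑ j ∈ Finset.range K, ((-a : ℂ) ^ j / j.factorial) •
        X.opProd (Function.update u s (A.sq v j (u s))) (e + Pi.single s a) := by
  filter_upwards [Filter.eventually_all.mpr fun s => X.coefOp_commutator v (u s)] with K hK a e
  rw [opProd, commutator_list_prod]
  refine Finset.sum_congr rfl fun s _ => ?_
  rw [hK s a (e s), ← MultilinearMap.mkPiAlgebraFin_apply (R := ℂ), MultilinearMap.map_update_sum]
  refine Finset.sum_congr rfl fun j _ => ?_
  rw [MultilinearMap.map_update_smul, opProd_update]

variable {X}

open Classical in
lemma gradedTrace_mul_of_mul_eq_zeta_smul {S T W : Module.End ℂ M} {a : ℤ}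
    (hS : IsShift X.L0 a S) {Z : ℂ} (hW : W * S = zeta Z • (S * W)) :
    X.gradedTrace (S * T * W) =
      (if IsInt Z ∧ a = 0 then X.gradedTrace (S * T * W) else 0) +
        kernelP Z (-a) * X.gradedTrace ((S * T - T * S) * W) := by
  have hcomm : X.gradedTrace ((S * T - T * S) * W) =
      X.gradedTrace (S * (T * W)) - PowerSeries.C (zeta Z)⁻¹ * X.gradedTrace (T * W * S) := by
    rw [sub_mul, gradedTrace_sub, ← gradedTrace_smul, mul_assoc T W, hW, mul_smul_comm, smul_smul,
      inv_mul_cancel₀ (zeta_ne_zero Z), one_smul, mul_assoc, mul_assoc]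
  rw [hcomm, mul_assoc S T W]
  rcases lt_trichotomy a 0 with ha | rfl | ha
  · obtain ⟨l, rfl⟩ : ∃ l : ℕ, a = -l := ⟨a.natAbs, by lia⟩
    rw [if_neg (by lia), zero_add, neg_neg, gradedTrace_mul_of_shift_neg hS,
      kernelP_natCast_mul Z (by lia)]
  · have hcyc : X.gradedTrace (S * (T * W)) = X.gradedTrace (T * W * S) := by
      simpa using gradedTrace_mul_of_shift (a := 0) hS (T * W)
    rw [← hcyc, neg_zero]
    by_cases hZ : IsInt Z
    · rw [if_pos ⟨hZ, rfl⟩, kernelP_zero_of_isInt hZ, zero_mul, add_zero]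
    · rw [if_neg (by tauto), zero_add, kernelP_zero_mul hZ]
  · obtain ⟨l, rfl⟩ : ∃ l : ℕ, a = l := ⟨a.natAbs, by lia⟩
    rw [if_neg (by lia), zero_add, gradedTrace_mul_of_shift hS,
      kernelP_neg_natCast_mul Z (by lia)]

variable {m : ℕ} {h : Fin m → V} (hH : ConditionH X h) (z : Fin m → ℂ)

lemma nPoint_apply (u : Fin n → V) (e : Fin n → ℤ) :
    nPoint hH z u e = X.gradedTrace (X.opProd u e * zetaOp hH z) := rfl

lemma zeroModePoint_apply (v : V) (u : Fin n → V) (e : Fin n → ℤ) :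
    zeroModePoint hH z v u e =
      X.gradedTrace (X.coefOp v 0 * X.opProd u e * zetaOp hH z) := rfl

variable {v : V} {μ : Fin m → ℂ}

include hH in
lemma hasWt_one (j : Fin m) : A.HasWt 1 (h j) := by
  rw [VOA.HasWt, hH.weight_one, Int.cast_one, one_smul]

lemma zetaOp_mul_coefOp (hv : ∀ j, A.mode (h j) 0 v = μ j • v) (e : ℤ) :
    zetaOp hH z * X.coefOp v e =
      zeta (∑ j, z j * μ j) • (X.coefOp v e * zetaOp hH z) := by
  rw [zetaOp, list_prod_mul_of_mul_eq_smul_mul (c := fun j =>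
    Complex.exp (2 * Real.pi * Complex.I * z j * μ j)) fun j =>
      zetaPow_mul (hH.semisimple j) (z j)
        (X.isShift_ncoeff_zero_coefOp (hasWt_one hH j) (hv j) e),
    ← Complex.exp_sum, zeta, Finset.mul_sum]
  simp only [mul_assoc]

open Classical in
lemma gradedTrace_coefOp_mul_opProd (hv : ∀ j, A.mode (h j) 0 v = μ j • v) (u : Fin n → V) :
    ∀ᶠ K : ℕ in Filter.atTop, ∀ (a : ℤ) (e : Fin n → ℤ),
      X.gradedTrace (X.coefOp v a * X.opProd u e * zetaOp hH z) =
        (if IsInt (∑ j, z j * μ j) ∧ a = 0 then zeroModePoint hH z v u e else 0) +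
        ∑ s, ∑ j ∈ Finset.range K, formalP (j + 1) (∑ j, z j * μ j) (-a) *
          nPoint hH z (Function.update u s (A.sq v j (u s))) (e + Pi.single s a) := by
  filter_upwards [X.opProd_commutator v u] with K hK a e
  rw [gradedTrace_mul_of_mul_eq_zeta_smul (X.isShift_coefOp v a) (zetaOp_mul_coefOp hH z hv a), hK,
    Finset.sum_mul, gradedTrace_sum, Finset.mul_sum]
  congr 1
  · refine if_ctx_congr Iff.rfl (fun h => ?_) fun _ => rfl
    rw [h.2, zeroModePoint_apply]
  · refine Finset.sum_congr rfl fun s _ => ?_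
    rw [Finset.sum_mul, gradedTrace_sum, Finset.mul_sum]
    refine Finset.sum_congr rfl fun j _ => ?_
    rw [smul_mul_assoc, gradedTrace_smul, ← nPoint_apply, formalP_eq, add_tsub_cancel_right,
      Int.cast_neg]
    ring

end VOAModule

/-! ### Products of formal functions with series in `q_s / q_t` -/

section Coeff

variable {R : Type*} [CommRing R] {P Q F : PowerSeries R} {N : ℕ}

lemma coeff_mul_eq_zero (h : ∀ i ≤ N, PowerSeries.coeff i F = 0) :
    PowerSeries.coeff N (P * F) = 0 :=
  PowerSeries.X_pow_dvd_iff.mp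
    ((PowerSeries.X_pow_dvd_iff.mpr fun i hi => h i (Nat.lt_succ_iff.mp hi)).mul_left P) N
    N.lt_succ_self

lemma coeff_mul_eq_zero_of_X_pow_dvd {l : ℕ} (h : PowerSeries.X ^ l ∣ P) (hl : N < l) :
    PowerSeries.coeff N (P * F) = 0 :=
  PowerSeries.X_pow_dvd_iff.mp (h.mul_right F) N hl

lemma coeff_mul_congr_left (h : ∀ i ≤ N, PowerSeries.coeff i P = PowerSeries.coeff i Q) :
    PowerSeries.coeff N (P * F) = PowerSeries.coeff N (Q * F) := by
  rw [← sub_eq_zero, ← map_sub, ← sub_mul, mul_comm]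
  exact coeff_mul_eq_zero fun i hi => by rw [map_sub, h i hi, sub_self]

end Coeff

lemma sum_Ico_neg_natCast {R : Type*} [AddCommMonoid R] (f : ℤ → R) (L : ℕ) :
    ∑ l ∈ Finset.Ico (-L : ℤ) L, f l = ∑ i ∈ Finset.range L, (f (-(1 + i)) + f i) := by
  induction L with
  | zero => simp
  | succ L ih =>
    have hIco : Finset.Ico (-((L + 1 : ℕ) : ℤ)) (L + 1 : ℕ) =
        insert (-(1 + L) : ℤ) (insert (L : ℤ) (Finset.Ico (-L : ℤ) L)) := by
      ext x
      simp only [Finset.mem_Ico, Finset.mem_insert]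
      lia
    rw [hIco, Finset.sum_insert, Finset.sum_insert, ih, Finset.sum_range_succ, ← add_assoc,
      add_comm]
    · simp
    · simp only [Finset.mem_Ico, Finset.mem_insert]
      lia

namespace Formal

variable {n : ℕ}

lemma mulRatio_zero (P : ℤ → PowerSeries ℂ) (s t : Fin n) : mulRatio P s t (0 : Formal n) = 0 := by
  funext e
  ext N
  simp [mulRatio]

lemma mulRatio_C_mul (P : ℤ → PowerSeries ℂ) (s t : Fin n) (c : ℂ) (F : Formal n) :
    mulRatio P s t (fun e => PowerSeries.C c * F e) =
      fun e => PowerSeries.C c * mulRatio P s t F e := by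
  funext e
  ext N
  simp only [mulRatio, PowerSeries.coeff_mk, mul_left_comm _ (PowerSeries.C c),
    PowerSeries.coeff_C_mul, ← smul_eq_mul (a := c), smul_finsum]

lemma extend_zero : (0 : Formal n).extend = 0 := by
  funext e
  simp [extend]

lemma mulRatio_extend (P : ℤ → PowerSeries ℂ) (s : Fin n) (F : Formal n) (a : ℤ) (e : Fin n → ℤ) :
    mulRatio P s.succ 0 F.extend (Fin.cons a e : Fin (n + 1) → ℤ) =
      P (-a) * F (e + Pi.single s a) := by
  have hs : (0 : Fin (n + 1)) ≠ s.succ := (Fin.succ_ne_zero s).symm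
  ext N
  rw [mulRatio, PowerSeries.coeff_mk, finsum_eq_single _ (-a)]
  · congr 2
    rw [extend, if_pos (by simp [hs])]
    congr 1
    funext i
    rcases eq_or_ne i s with rfl | h
    · simp [Fin.tail]
    · simp [Fin.tail, h]
  · intro l hl
    rw [extend, if_neg, mul_zero, map_zero]
    simp only [Pi.add_apply, Pi.sub_apply, Fin.cons_zero, Pi.single_eq_of_ne hs, Pi.single_eq_same]
    lia

/-- For fixed exponents of the `qᵢ` and of `q`, the coefficients of `(q_t / q_s)^l F` vanish for
large `l`. This is what makes the product `mulRatio P s t F` with a series of Weierstrass type a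
locally finite sum. -/
def VanishesFar (F : Formal n) (s t : Fin n) : Prop :=
  ∀ (e : Fin n → ℤ) (N : ℕ), ∃ B : ℤ, ∀ l, B ≤ l → ∀ i ≤ N,
    PowerSeries.coeff i (F (e - Pi.single s l + Pi.single t l)) = 0

lemma vanishesFar_extend (F : Formal n) (s : Fin n) : F.extend.VanishesFar s.succ 0 := by
  have hs : (0 : Fin (n + 1)) ≠ s.succ := (Fin.succ_ne_zero s).symm
  intro e N
  refine ⟨-e 0 + 1, fun l hl i _ => ?_⟩
  rw [extend, if_neg, map_zero]
  simp only [Pi.add_apply, Pi.sub_apply, Pi.single_eq_of_ne hs, Pi.single_eq_same]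
  lia

namespace VanishesFar

variable {F : Formal n} {s t : Fin n} (hF : F.VanishesFar s t) {P : ℤ → PowerSeries ℂ}
  (hP : ∀ l < 0, PowerSeries.X ^ l.natAbs ∣ P l)

include hF hP

lemma exists_bound (e : Fin n → ℤ) (N : ℕ) : ∃ B : ℕ, ∀ l : ℤ, PowerSeries.coeff N
    (P l * F (e - Pi.single s l + Pi.single t l)) ≠ 0 → l.natAbs ≤ B := by
  obtain ⟨B, hB⟩ := hF e N
  refine ⟨B.natAbs + N, fun l hl => ?_⟩
  contrapose! hl
  rcases lt_or_ge l 0 with h | h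
  · exact coeff_mul_eq_zero_of_X_pow_dvd (hP l h) (by lia)
  · exact coeff_mul_eq_zero (hB l (by lia))

lemma finite_support (e : Fin n → ℤ) (N : ℕ) : (Function.support fun l : ℤ => PowerSeries.coeff N
    (P l * F (e - Pi.single s l + Pi.single t l))).Finite := by
  obtain ⟨B, hB⟩ := hF.exists_bound hP e N
  refine (Set.finite_Icc (-B : ℤ) B).subset fun l hl => ?_
  have hbound := hB l hl
  exact ⟨by lia, by lia⟩

lemma eventually_coeff_mulRatio (e : Fin n → ℤ) (N : ℕ) :
    ∀ᶠ L : ℕ in Filter.atTop, PowerSeries.coeff N (mulRatio P s t F e) =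
      PowerSeries.coeff N (∑ i ∈ Finset.range L,
        (P (-(1 + i)) * F (e - Pi.single s (-(1 + i) : ℤ) + Pi.single t (-(1 + i) : ℤ)) +
          P i * F (e - Pi.single s (i : ℤ) + Pi.single t (i : ℤ)))) := by
  obtain ⟨B, hB⟩ := hF.exists_bound hP e N
  filter_upwards [Filter.eventually_gt_atTop B] with L hL
  rw [mulRatio, PowerSeries.coeff_mk,
    finsum_eq_sum_of_support_subset _ (s := Finset.Ico (-L : ℤ) L) fun l hl => ?_,
    sum_Ico_neg_natCast]
  · simp only [map_sum, map_add]
  · have hbound := hB l hl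
    simp only [Finset.coe_Ico, Set.mem_Ico]
    lia

lemma mul_mulRatio (D : PowerSeries ℂ) :
    (fun e => D * mulRatio P s t F e) = mulRatio (fun l => D * P l) s t F := by
  funext e
  ext N
  simp only [mulRatio, PowerSeries.coeff_mul _ D, PowerSeries.coeff_mk, mul_assoc]
  rw [finsum_sum_comm]
  · refine Finset.sum_congr rfl fun ij _ => ?_
    simp only [← smul_eq_mul (a := PowerSeries.coeff ij.1 D), smul_finsum]
  · intro ij _
    refine (hF.finite_support hP e ij.2).subset fun l hl h => hl ?_
    simp only [h, mul_zero]

end VanishesFar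

end Formal

lemma X_pow_dvd_lambert (a : ℂ) (l : ℕ) : (PowerSeries.X : PowerSeries ℂ) ^ l ∣ lambert a l :=
  (Dvd.intro_left _ rfl).mul_right _

lemma coeff_lambert_of_lt (a : ℂ) {l N : ℕ} (h : N < l) :
    PowerSeries.coeff N (lambert a l) = 0 :=
  PowerSeries.X_pow_dvd_iff.mp (X_pow_dvd_lambert a l) N h

lemma X_pow_dvd_formalP (k : ℕ) (Z : ℂ) (l : ℤ) (hl : l < 0) :
    (PowerSeries.X : PowerSeries ℂ) ^ l.natAbs ∣ formalP k Z l := by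
  obtain ⟨l, rfl⟩ : ∃ i : ℕ, l = -i := ⟨l.natAbs, by lia⟩
  rw [formalP_eq, kernelP_neg_natCast Z (by lia), Int.natAbs_neg, Int.natAbs_natCast]
  exact (dvd_neg.mpr (X_pow_dvd_lambert _ _)).mul_left _

/-! ### Twisted Eisenstein series as sums of twisted Weierstrass kernels -/

lemma bern_eq (k : ℕ) : VOA.bern k = (bernoulli k : ℂ) / k.factorial := by
  simp [VOA.bern, bernoulliPowerSeries]

lemma riemannZeta_two_mul_eq_bern {r : ℕ} (hr : r ≠ 0) :
    2 * riemannZeta (2 * r : ℕ) / (2 * Real.pi * Complex.I) ^ (2 * r) = -VOA.bern (2 * r) := by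
  have hpi : (Real.pi : ℂ) ≠ 0 := by exact_mod_cast Real.pi_ne_zero
  have htwo : (2 : ℂ) ^ (2 * r) = 2 * 2 ^ (2 * r - 1) := by
    rw [← pow_succ', Nat.sub_add_cancel (by lia)]
  have hsign_ne : (-1 : ℂ) ^ r ≠ 0 := by simp
  have hfact : ((2 * r).factorial : ℂ) ≠ 0 := by exact_mod_cast (2 * r).factorial_ne_zero
  rw [bern_eq, Nat.cast_mul, Nat.cast_ofNat, riemannZeta_two_mul_nat hr, mul_pow, mul_pow,
    pow_mul Complex.I, Complex.I_sq, htwo, pow_succ]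
  field_simp

lemma eisensteinConst_succ (j : ℕ) (Z : ℂ) : eisensteinConst (j + 1) Z =
    -VOA.bern (j + 1) + (0 : ℂ) ^ j / j.factorial * (zeroTerm Z - 1) := by
  rcases Nat.eq_zero_or_pos j with rfl | hj
  · simp only [eisensteinConst, bern_eq, zero_add, if_true, bernoulli_one, Nat.factorial]
    push_cast
    ring
  · rw [eisensteinConst, if_neg (by lia), zero_pow (by lia), zero_div, zero_mul, add_zero]
    split_ifs with heven
    · obtain ⟨r, hr⟩ := even_iff_exists_two_mul.mp heven
      rw [hr, riemannZeta_two_mul_eq_bern (by lia)]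
    · rw [bern_eq, bernoulli_eq_zero_of_odd (Nat.not_even_iff_odd.mp heven) (by lia)]
      simp

lemma sum_coeff_formalP_neg (j : ℕ) (Z : ℂ) {N L : ℕ} (hL : N < L) :
    ∑ i ∈ Finset.range L, PowerSeries.coeff N (formalP (j + 1) Z (-(1 + i))) =
      ∑ l ∈ Finset.Icc 1 N, (l : ℂ) ^ j / j.factorial *
        ((-1) ^ (j + 1) * PowerSeries.coeff N (lambert (zeta Z) l)) := by
  have hterm (l : ℕ) (hl : l ≠ 0) : PowerSeries.coeff N (formalP (j + 1) Z (-l)) =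
      (l : ℂ) ^ j / j.factorial * ((-1) ^ (j + 1) * PowerSeries.coeff N (lambert (zeta Z) l)) := by
    rw [formalP_eq, kernelP_neg_natCast Z hl, PowerSeries.coeff_C_mul, map_neg,
      add_tsub_cancel_right, Int.cast_neg, Int.cast_natCast, neg_pow]
    ring
  have hshift := Finset.sum_Ico_add
    (fun l : ℕ => PowerSeries.coeff N (formalP (j + 1) Z (-l))) 0 L 1
  push_cast at hshift
  rw [Finset.range_eq_Ico, hshift]
  symm
  refine Finset.sum_subset_zero_on_sdiff (fun l hl => ?_) (fun l hl => ?_) fun l hl => ?_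
  · simp only [Finset.mem_Icc, Finset.mem_Ico] at hl ⊢; lia
  · simp only [Finset.mem_sdiff, Finset.mem_Icc, Finset.mem_Ico] at hl
    rw [hterm l (by lia), coeff_lambert_of_lt _ (by lia), mul_zero, mul_zero]
  · rw [hterm l (by have := (Finset.mem_Icc.mp hl).1; lia)]

/-- The summands of `∑_{l ≥ 0} formalP (j + 1) Z l` do not tend to `0`; their constant terms are
subtracted. -/
lemma sum_coeff_formalP_natCast_sub (j : ℕ) (Z : ℂ) {N L : ℕ} (hL : N < L) :
    ∑ i ∈ Finset.range L, PowerSeries.coeff N (formalP (j + 1) Z i -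
        PowerSeries.C ((i : ℂ) ^ j / j.factorial)) =
      PowerSeries.coeff N (PowerSeries.C ((0 : ℂ) ^ j / j.factorial * (zeroTerm Z - 1))) +
        ∑ l ∈ Finset.Icc 1 N, (l : ℂ) ^ j / j.factorial *
          PowerSeries.coeff N (lambert (zeta Z)⁻¹ l) := by
  have hterm (l : ℕ) (hl : l ≠ 0) : PowerSeries.coeff N (formalP (j + 1) Z l -
      PowerSeries.C ((l : ℂ) ^ j / j.factorial)) =
        (l : ℂ) ^ j / j.factorial * PowerSeries.coeff N (lambert (zeta Z)⁻¹ l) := by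
    rw [formalP_eq, kernelP_natCast Z hl, mul_add, mul_one, add_tsub_cancel_right,
      Int.cast_natCast, add_sub_cancel_left, PowerSeries.coeff_C_mul]
  rw [Finset.range_eq_Ico, Finset.sum_eq_sum_Ico_succ_bot (by lia), zero_add]
  congr 1
  · rw [formalP_eq, Nat.cast_zero, kernelP_zero, ← map_mul, ← map_sub]
    push_cast
    ring_nf
  · symm
    refine Finset.sum_subset_zero_on_sdiff (fun l hl => ?_) (fun l hl => ?_) fun l hl => ?_
    · simp only [Finset.mem_Icc, Finset.mem_Ico] at hl ⊢; lia
    · simp only [Finset.mem_sdiff, Finset.mem_Icc, Finset.mem_Ico] at hl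
      rw [hterm l (by lia), coeff_lambert_of_lt _ (by lia), mul_zero]
    · rw [hterm l (by have := (Finset.mem_Icc.mp hl).1; lia)]

lemma coeff_formalE_succ (j : ℕ) (Z : ℂ) {N L : ℕ} (hL : N < L) :
    PowerSeries.coeff N (formalE (j + 1) Z) =
      PowerSeries.coeff N (PowerSeries.C (-VOA.bern (j + 1)) +
        ∑ i ∈ Finset.range L, (formalP (j + 1) Z (-(1 + i)) + (formalP (j + 1) Z i -
          PowerSeries.C ((i : ℂ) ^ j / j.factorial)))) := by
  simp only [map_add, map_sum, Finset.sum_add_distrib]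
  rw [sum_coeff_formalP_neg j Z hL, sum_coeff_formalP_natCast_sub j Z hL, formalE,
    eisensteinConst_succ, map_add, map_add, map_add, PowerSeries.coeff_C_mul, PowerSeries.coeff_mk,
    Finset.mul_sum, add_assoc, add_left_comm (∑ l ∈ Finset.Icc 1 N, _), ← Finset.sum_add_distrib]
  congr 2
  refine Finset.sum_congr rfl fun l _ => ?_
  rw [PowerSeries.coeff_C_mul, map_add, PowerSeries.coeff_C_mul, add_tsub_cancel_right]
  ring

/-! ### The formal recursions -/

lemma finsum_eq_sum_range_of_forall_le {R : Type*} [AddCommMonoid R] {f : ℕ → R} {K : ℕ}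
    (hf : ∀ k, K ≤ k → f k = 0) : ∑ᶠ k, f k = ∑ k ∈ Finset.range K, f k :=
  finsum_eq_sum_of_support_subset f fun k hk =>
    Finset.mem_coe.mpr (Finset.mem_range.mpr (not_le.mp fun hKk => hk (hf k hKk)))

lemma coeff_sum_formalE_mul (K : ℕ) (Z : ℂ) (G : ℕ → PowerSeries ℂ) {N L : ℕ} (hL : N < L) :
    PowerSeries.coeff N (∑ k ∈ Finset.range K, formalE (k + 1) Z * G k) =
      PowerSeries.coeff N (∑ i ∈ Finset.range L,
        (∑ k ∈ Finset.range K, formalP (k + 1) Z (-(1 + i)) * G k +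
          (∑ k ∈ Finset.range K, formalP (k + 1) Z i * G k -
            ∑ k ∈ Finset.range K, PowerSeries.C ((i : ℂ) ^ k / k.factorial) * G k)) -
        ∑ k ∈ Finset.range K, PowerSeries.C (VOA.bern (k + 1)) * G k) := by
  have hterm (k : ℕ) := coeff_mul_congr_left (F := G k) fun i (hi : i ≤ N) =>
    coeff_formalE_succ k Z (hi.trans_lt hL)
  rw [map_sum, Finset.sum_congr rfl fun k _ => hterm k, ← map_sum]
  congr 1
  simp only [← Finset.sum_add_distrib, ← Finset.sum_sub_distrib]
  rw [Finset.sum_comm, ← Finset.sum_sub_distrib]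
  refine Finset.sum_congr rfl fun k _ => ?_
  rw [map_neg, add_mul, Finset.sum_mul, neg_mul, neg_add_eq_sub]
  simp only [add_mul, sub_mul]

lemma Formal.eventually_coeff_sum_mulRatio {n : ℕ} {ι κ : Type*} [Fintype ι] (S : Finset κ)
    {s : ι → Fin n} {t : Fin n} {P : κ → ℤ → PowerSeries ℂ} {F : ι → κ → Formal n}
    (hF : ∀ i k, (F i k).VanishesFar (s i) t)
    (hP : ∀ k, ∀ l < 0, PowerSeries.X ^ l.natAbs ∣ P k l) (e : Fin n → ℤ) (N : ℕ) :
    ∀ᶠ L : ℕ in Filter.atTop,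
      PowerSeries.coeff N (∑ i, ∑ k ∈ S, mulRatio (P k) (s i) t (F i k) e) =
      PowerSeries.coeff N (∑ r ∈ Finset.range L,
        (∑ i, ∑ k ∈ S, P k (-(1 + r)) * F i k
            (e - Pi.single (s i) (-(1 + r) : ℤ) + Pi.single t (-(1 + r) : ℤ)) +
          ∑ i, ∑ k ∈ S, P k r * F i k (e - Pi.single (s i) (r : ℤ) + Pi.single t (r : ℤ)))) := by
  filter_upwards [Filter.eventually_all.mpr fun i => (Finset.eventually_all S).mpr fun k _ =>
    (hF i k).eventually_coeff_mulRatio (hP k) e N] with L hL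
  simp only [← Finset.sum_add_distrib]
  rw [map_sum, Finset.sum_comm, map_sum]
  refine Finset.sum_congr rfl fun i _ => ?_
  rw [map_sum, Finset.sum_comm, map_sum]
  exact Finset.sum_congr rfl fun k hk => hL i k hk

namespace VOAModule

variable {V M : Type*} [AddCommGroup V] [Module ℂ V] [AddCommGroup M] [Module ℂ M]
  {A : VOA V} {X : VOAModule A M} {n : ℕ} {m : ℕ} {h : Fin m → V}

variable (X) in
lemma eventually_opProd_apply_eq_zero (u : Fin n → V) (e : ℤ → Fin n → ℤ) (s : Fin n)
    (hs : Filter.Tendsto (fun l => e l s) Filter.atTop Filter.atBot)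
    (hc : ∀ i, s < i → ∀ l, e l i = e 0 i) (y : M) :
    ∀ᶠ l in Filter.atTop, X.opProd u (e l) y = 0 := by
  induction n with
  | zero => exact s.elim0
  | succ n ih =>
    simp only [opProd_succ, Module.End.mul_apply]
    induction s using Fin.cases with
    | zero =>
      obtain ⟨B, hB⟩ := X.exists_coefOp_apply_eq_zero (u 0)
        (X.opProd (Fin.tail u) (Fin.tail (e 0)) y)
      filter_upwards [hs.eventually (Filter.eventually_le_atBot B)] with l hl
      rw [show Fin.tail (e l) = Fin.tail (e 0) from funext fun i => hc i.succ (Fin.succ_pos i) l]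
      exact hB _ hl
    | succ s =>
      filter_upwards [ih (Fin.tail u) (fun l => Fin.tail (e l)) s hs
        fun i hi l => hc i.succ (Fin.succ_lt_succ_iff.mpr hi) l] with l hl
      rw [hl, map_zero]

variable (hH : ConditionH X h) (z : Fin m → ℂ)

lemma vanishesFar_nPoint (u : Fin (n + 1) → V) (s : Fin n) :
    (nPoint hH z u).VanishesFar s.succ 0 := by
  intro e N
  have hzero (x : M) : ∀ᶠ l : ℤ in Filter.atTop,
      (X.opProd u (e - Pi.single s.succ l + Pi.single 0 l) * zetaOp hH z) x =
        (0 : Module.End ℂ M) x := by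
    have hopProd := X.eventually_opProd_apply_eq_zero u
      (fun l : ℤ => e - Pi.single s.succ l + Pi.single 0 l) s.succ ?_ ?_ (zetaOp hH z x)
    · filter_upwards [hopProd] with l hl
      rw [Module.End.mul_apply, hl, LinearMap.zero_apply]
    · simp only [Pi.add_apply, Pi.sub_apply, Pi.single_eq_same,
        Pi.single_eq_of_ne (Fin.succ_ne_zero s), add_zero]
      refine Filter.tendsto_atBot.mpr fun b => ?_
      filter_upwards [Filter.eventually_ge_atTop (e s.succ - b)] with l hl
      lia
    · intro i hi l
      simp [Pi.single_eq_of_ne hi.ne', Pi.single_eq_of_ne ((Fin.succ_pos s).trans hi).ne']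
  obtain ⟨B, hB⟩ := (X.eventually_coeff_gradedTrace hzero N).exists_forall_of_atTop
  refine ⟨B, fun l hl i hi => ?_⟩
  rw [nPoint_apply, hB l hl i hi, gradedTrace_zero, map_zero]

lemma nPoint_update_smul (u : Fin n → V) (s : Fin n) (c : ℂ) (w : V) :
    nPoint hH z (Function.update u s (c • w)) =
      fun e => PowerSeries.C c * nPoint hH z (Function.update u s w) e := by
  funext e
  have hupdate (x : V) := X.opProd_update u e s x 0
  simp only [Pi.single_zero, add_zero] at hupdate
  rw [nPoint_apply, nPoint_apply, hupdate, hupdate, coefOp_smul, MultilinearMap.map_update_smul,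
    smul_mul_assoc, gradedTrace_smul]

lemma nPoint_update_zero (u : Fin n → V) (s : Fin n) :
    nPoint hH z (Function.update u s 0) = 0 := by
  rw [← zero_smul ℂ (0 : V), nPoint_update_smul]
  funext e
  rw [map_zero, zero_mul, Pi.zero_apply]

variable {v : V} {μ : Fin m → ℂ}

open Classical in
theorem nPoint_cons (hv : ∀ j, A.mode (h j) 0 v = μ j • v) (u : Fin n → V) :
    X.nPoint hH z (Fin.cons v u : Fin (n + 1) → V) =
      (if IsInt (∑ j, z j * μ j) then (zeroModePoint hH z v u).extend else 0) +
      ∑ s : Fin n, ∑ᶠ k : ℕ,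
        Formal.mulRatio (formalP (k + 1) (∑ j, z j * μ j)) s.succ 0
          (nPoint hH z (Function.update u s (A.sq v k (u s)))).extend := by
  obtain ⟨K, hK, hsq⟩ := ((gradedTrace_coefOp_mul_opProd hH z hv u).and
    (Filter.eventually_all.mpr fun s => A.eventually_sq_eq_zero v (u s))).exists
  rw [Finset.sum_congr rfl fun s _ => finsum_eq_sum_range_of_forall_le (K := K) fun k hk => by
    rw [hsq s k hk, nPoint_update_zero, Formal.extend_zero, Formal.mulRatio_zero]]
  funext e
  obtain ⟨a, e, rfl⟩ : ∃ a e', e = (Fin.cons a e' : Fin (n + 1) → ℤ) :=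
    ⟨e 0, Fin.tail e, (Fin.cons_self_tail e).symm⟩
  simp only [Pi.add_apply, Finset.sum_apply, Formal.mulRatio_extend]
  rw [nPoint_apply, opProd_succ, Fin.cons_zero, Fin.cons_zero, Fin.tail_cons, Fin.tail_cons, hK]
  congr 1
  by_cases hint : IsInt (∑ j, z j * μ j)
  · simp [hint, Formal.extend]
  · simp [hint]

lemma nPoint_update_zero_apply (u : Fin (n + 1) → V) (w : V) (e : Fin (n + 1) → ℤ) :
    nPoint hH z (Function.update u 0 w) e =
      X.gradedTrace (X.coefOp w (e 0) * (X.opProd (Fin.tail u) (Fin.tail e) * zetaOp hH z)) := by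
  rw [nPoint_apply, opProd_succ, Function.update_self, Fin.tail_update_zero, mul_assoc]

lemma gradedTrace_normalOrderSum_mul (v : V) (u : Fin (n + 1) → V) :
    ∀ᶠ K : ℕ in Filter.atTop, ∀ (e : Fin (n + 1) → ℤ) (L : ℕ),
      X.gradedTrace (X.normalOrderSum v (u 0) (e 0) L *
        (X.opProd (Fin.tail u) (Fin.tail e) * zetaOp hH z)) =
      ∑ i ∈ Finset.range L,
        (X.gradedTrace (X.coefOp v (1 + i) * X.opProd u (e - Pi.single 0 (1 + i : ℤ)) *
            zetaOp hH z) +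
          (X.gradedTrace (X.coefOp v (-i) * X.opProd u (e - Pi.single 0 (-i : ℤ)) * zetaOp hH z) -
            ∑ j ∈ Finset.range K, PowerSeries.C ((i : ℂ) ^ j / j.factorial) *
              nPoint hH z (Function.update u 0 (A.sq v j (u 0))) e)) := by
  filter_upwards [X.coefOp_commutator v (u 0)] with K hK e L
  set R := X.opProd (Fin.tail u) (Fin.tail e) * zetaOp hH z with hR
  have hprod (a : ℤ) : X.opProd u (e - Pi.single 0 a) * zetaOp hH z =
      X.coefOp (u 0) (e 0 - a) * R := by
    have htail : Fin.tail (e - Pi.single 0 a) = Fin.tail e := by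
      funext i
      simp [Fin.tail]
    rw [opProd_succ, htail, mul_assoc, Pi.sub_apply, Pi.single_eq_same]
  have hswap (i : ℕ) : X.coefOp (u 0) (e 0 + i) * X.coefOp v (-i) =
      X.coefOp v (-i) * X.coefOp (u 0) (e 0 + i) -
        ∑ j ∈ Finset.range K, ((i : ℂ) ^ j / j.factorial) • X.coefOp (A.sq v j (u 0)) (e 0) := by
    rw [eq_sub_iff_add_eq', ← eq_sub_iff_add_eq, hK (-i) (e 0 + i)]
    simp
  rw [normalOrderSum, Finset.sum_mul, gradedTrace_sum]
  refine Finset.sum_congr rfl fun i _ => ?_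
  simp only [nPoint_update_zero_apply, ← hR]
  rw [hswap, mul_assoc _ (X.opProd _ _), mul_assoc _ (X.opProd _ _), hprod, hprod, sub_neg_eq_add,
    sub_sub, add_mul, sub_mul, Finset.sum_mul, gradedTrace_add, gradedTrace_sub, gradedTrace_sum]
  simp only [smul_mul_assoc, gradedTrace_smul, mul_assoc]

lemma coeff_nPoint_sq_neg_one_add (v : V) (u : Fin (n + 1) → V) :
    ∀ᶠ K : ℕ in Filter.atTop, ∀ (e : Fin (n + 1) → ℤ) (N : ℕ), ∀ᶠ L : ℕ in Filter.atTop,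
      PowerSeries.coeff N (nPoint hH z (Function.update u 0 (A.sq v (-1) (u 0))) e +
        ∑ j ∈ Finset.range K, PowerSeries.C (VOA.bern (j + 1)) *
          nPoint hH z (Function.update u 0 (A.sq v j (u 0))) e) =
      PowerSeries.coeff N (X.gradedTrace (X.normalOrderSum v (u 0) (e 0) L *
        (X.opProd (Fin.tail u) (Fin.tail e) * zetaOp hH z))) := by
  filter_upwards [X.coefOp_normalOrder v (u 0)] with K hK e N
  set R := X.opProd (Fin.tail u) (Fin.tail e) * zetaOp hH z with hR
  filter_upwards [X.eventually_coeff_gradedTrace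
    (T := fun _ => X.coefOp (A.sq v (-1) (u 0) +
      ∑ j ∈ Finset.range K, VOA.bern (j + 1) • A.sq v j (u 0)) (e 0) * R)
    (U := fun L => X.normalOrderSum v (u 0) (e 0) L * R) (fun x => hK (e 0) (R x)) N] with L hL
  rw [← hL N le_rfl, coefOp_add, coefOp_sum, add_mul, Finset.sum_mul, gradedTrace_add,
    gradedTrace_sum]
  simp only [coefOp_smul, smul_mul_assoc, gradedTrace_smul, nPoint_update_zero_apply, ← hR]

open Classical in
lemma eventually_gradedTrace_coefOp_neg_mul_opProd (hv : ∀ j, A.mode (h j) 0 v = μ j • v)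
    (u : Fin (n + 1) → V) :
    ∀ᶠ K : ℕ in Filter.atTop, ∀ (e : Fin (n + 1) → ℤ) (l : ℤ),
      X.gradedTrace (X.coefOp v (-l) * X.opProd u (e - Pi.single 0 (-l)) * zetaOp hH z) =
        (if IsInt (∑ j, z j * μ j) ∧ l = 0 then zeroModePoint hH z v u e else 0) +
        (∑ k ∈ Finset.range K, formalP (k + 1) (∑ j, z j * μ j) l *
            nPoint hH z (Function.update u 0 (A.sq v k (u 0))) e +
          ∑ s : Fin n, ∑ k ∈ Finset.range K, formalP (k + 1) (∑ j, z j * μ j) l *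
            nPoint hH z (Function.update u s.succ (A.sq v k (u s.succ)))
              (e - Pi.single s.succ l + Pi.single 0 l)) := by
  filter_upwards [gradedTrace_coefOp_mul_opProd hH z hv u] with K hK e l
  rw [hK, Fin.sum_univ_succ, neg_neg]
  refine congrArg₂ (· + ·) ?_ (congrArg₂ (· + ·) ?_ ?_)
  · refine if_ctx_congr (by rw [neg_eq_zero]) (fun hl => ?_) fun _ => rfl
    rw [hl.2, neg_zero, Pi.single_zero, sub_zero]
  · simp only [sub_add_cancel]
  · simp only [Pi.single_neg, sub_neg_eq_add, ← sub_eq_add_neg, add_sub_right_comm]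

open Classical in
lemma eventually_nPoint_sq_neg_one (hv : ∀ j, A.mode (h j) 0 v = μ j • v) (u : Fin (n + 1) → V) :
    ∀ᶠ K : ℕ in Filter.atTop, ∀ e : Fin (n + 1) → ℤ,
      nPoint hH z (Function.update u 0 (A.sq v (-1) (u 0))) e =
        (if IsInt (∑ j, z j * μ j) then zeroModePoint hH z v u e else 0) +
        (∑ k ∈ Finset.range K, formalE (k + 1) (∑ j, z j * μ j) *
          nPoint hH z (Function.update u 0 (A.sq v k (u 0))) e) +
        ∑ s : Fin n, ∑ k ∈ Finset.range K,
          Formal.mulRatio (formalP (k + 1) (∑ j, z j * μ j)) s.succ 0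
            (nPoint hH z (Function.update u s.succ (A.sq v k (u s.succ)))) e := by
  filter_upwards [coeff_nPoint_sq_neg_one_add hH z v u, gradedTrace_normalOrderSum_mul hH z v u,
    eventually_gradedTrace_coefOp_neg_mul_opProd hH z hv u] with K hexpand horder htrace e
  set Z := ∑ j, z j * μ j
  ext N
  obtain ⟨L, hL, hmul, hNL⟩ := ((hexpand e N).and
    ((Formal.eventually_coeff_sum_mulRatio (Finset.range K) (P := fun k => formalP (k + 1) Z)
      (fun (s : Fin n) (k : ℕ) => vanishesFar_nPoint hH z
        (Function.update u s.succ (A.sq v k (u s.succ))) s)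
      (fun k => X_pow_dvd_formalP (k + 1) Z) e N).and (Filter.eventually_gt_atTop N))).exists
  have hE := coeff_sum_formalE_mul K Z
    (fun k => nPoint hH z (Function.update u 0 (A.sq v k (u 0))) e) hNL
  have hneg (i : ℕ) := htrace e (-(1 + i))
  have hdelta (i : ℕ) : ¬(IsInt Z ∧ (-(1 + i : ℤ)) = 0) := by lia
  have hzero : ∑ i ∈ Finset.range L,
      (if IsInt Z ∧ (i : ℤ) = 0 then zeroModePoint hH z v u e else 0) =
        if IsInt Z then zeroModePoint hH z v u e else 0 := by
    rw [Finset.sum_eq_single 0 (fun i _ hi => if_neg (by lia))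
      fun h => absurd (Finset.mem_range.mpr (by lia)) h]
    simp
  simp only [neg_neg, hdelta, if_false, zero_add] at hneg
  simp only [horder, hneg, htrace] at hL
  rw [map_add, map_add, hE, hmul, ← hzero, ← map_add, ← map_add, eq_sub_of_add_eq
    ((map_add _ _ _).symm.trans hL), ← map_sub]
  congr 1
  simp only [Finset.sum_add_distrib, Finset.sum_sub_distrib]
  ring

lemma zeroModePoint_sqTranslate (v : V) (u : Fin n → V) :
    zeroModePoint hH z (A.sqTranslate v) u = 0 := by
  funext e
  rw [zeroModePoint_apply, coefOp_sqTranslate]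
  simp [gradedTrace_zero]

end VOAModule

lemma natCast_choose_mul_neg_succ {R : Type*} [CommRing R] (k p : ℕ) :
    ((k + 1 + p).choose p : R) * (-(k + 1)) = -((p + 1) * ((k + (p + 1)).choose (p + 1) : R)) := by
  have h := congrArg (Nat.cast : ℕ → R) (Nat.choose_succ_right_eq (k + 1 + p) p)
  rw [Nat.add_sub_cancel] at h
  push_cast at h
  rw [show k + (p + 1) = k + 1 + p by lia]
  linear_combination h

/-- Since `(L[-1]v)[k] = -k v[k-1]`, replacing `v` by `L[-1]v` turns the coefficients of the
recursion for `v[-p]` into those of the recursion for `v[-p-1]`, up to the factor `-p`. -/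
lemma VOA.sum_choose_mul_sq_sqTranslate {V : Type*} [AddCommGroup V] [Module ℂ V] {A : VOA V}
    (v u : V) (p K : ℕ) {Φ : ℕ → V → PowerSeries ℂ}
    (hΦ : ∀ l (c : ℂ) w, Φ l (c • w) = PowerSeries.C c * Φ l w) :
    ∑ k ∈ Finset.range (K + 1), ((k + p).choose p : PowerSeries ℂ) *
        Φ (k + (p + 1)) (A.sq (A.sqTranslate v) k u) =
      -((p + 1) * ∑ k ∈ Finset.range K, ((k + (p + 1)).choose (p + 1) : PowerSeries ℂ) *
        Φ (k + (p + 1 + 1)) (A.sq v k u)) := by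
  have hzero (l : ℕ) : Φ l 0 = 0 := by simpa using hΦ l 0 0
  rw [Finset.sum_range_succ', Nat.cast_zero, sq_sqTranslate, Int.cast_zero, neg_zero, zero_smul,
    hzero, mul_zero, add_zero, Finset.mul_sum, ← Finset.sum_neg_distrib]
  refine Finset.sum_congr rfl fun k _ => ?_
  rw [sq_sqTranslate, hΦ, Nat.cast_succ, add_sub_cancel_right,
    show k + (p + 1 + 1) = k + 1 + (p + 1) by lia]
  simp only [Int.cast_add, Int.cast_natCast, Int.cast_one, map_neg, map_add, map_natCast, map_one]
  linear_combination Φ (k + 1 + (p + 1)) (A.sq v k u) *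
    natCast_choose_mul_neg_succ (R := PowerSeries ℂ) k p

namespace VOAModule

variable {V M : Type*} [AddCommGroup V] [Module ℂ V] [AddCommGroup M] [Module ℂ M]
  {A : VOA V} {X : VOAModule A M} {n : ℕ} {m : ℕ} {h : Fin m → V}
  (hH : ConditionH X h) (z : Fin m → ℂ)

open Classical in
lemma eventually_nPoint_sq_neg (u : Fin (n + 1) → V) (p : ℕ) {v : V} {μ : Fin m → ℂ}
    (hv : ∀ j, A.mode (h j) 0 v = μ j • v) :
    ∀ᶠ K : ℕ in Filter.atTop, ∀ e : Fin (n + 1) → ℤ,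
      nPoint hH z (Function.update u 0 (A.sq v (-(p + 1 : ℕ)) (u 0))) e =
        (if IsInt (∑ j, z j * μ j) ∧ p = 0 then zeroModePoint hH z v u e else 0) +
        (-1) ^ p * (∑ k ∈ Finset.range K, ((k + p).choose p : PowerSeries ℂ) *
          (formalE (k + (p + 1)) (∑ j, z j * μ j) *
            nPoint hH z (Function.update u 0 (A.sq v k (u 0))) e)) +
        (-1) ^ p * ∑ s : Fin n, ∑ k ∈ Finset.range K, ((k + p).choose p : PowerSeries ℂ) *
          Formal.mulRatio (formalP (k + (p + 1)) (∑ j, z j * μ j)) s.succ 0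
            (nPoint hH z (Function.update u s.succ (A.sq v k (u s.succ)))) e := by
  induction p generalizing v with
  | zero =>
    filter_upwards [eventually_nPoint_sq_neg_one hH z hv u] with K hK e
    simpa using hK e
  | succ p ih =>
    filter_upwards [(Filter.tendsto_add_atTop_nat 1).eventually
      (ih fun j => VOA.mode_zero_sqTranslate (hasWt_one hH j) (hv j))] with K hK e
    have hp : ((p : PowerSeries ℂ) + 1) ≠ 0 := by
      rw [← map_natCast (PowerSeries.C (R := ℂ)), ← map_one (PowerSeries.C (R := ℂ)), ← map_add,
        Ne, map_eq_zero_iff _ PowerSeries.C_injective]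
      exact Nat.cast_add_one_ne_zero p
    have hneg : A.sq (A.sqTranslate v) (-(p + 1 : ℕ)) (u 0) =
        ((p : ℂ) + 1) • A.sq v (-(p + 1 + 1 : ℕ)) (u 0) := by
      rw [VOA.sq_sqTranslate]
      push_cast
      rw [neg_neg, show (-((p : ℤ) + 1) - 1) = -((p : ℤ) + 1 + 1) by ring]
    have hE := VOA.sum_choose_mul_sq_sqTranslate (A := A) v (u 0) p K (Φ := fun l w =>
      formalE l (∑ j, z j * μ j) * nPoint hH z (Function.update u 0 w) e) fun l c w => by
        rw [nPoint_update_smul, mul_left_comm]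
    have hP (s : Fin n) := VOA.sum_choose_mul_sq_sqTranslate (A := A) v (u s.succ) p K
      (Φ := fun l w => Formal.mulRatio (formalP l (∑ j, z j * μ j)) s.succ 0
        (nPoint hH z (Function.update u s.succ w)) e) fun l c w => by
          rw [nPoint_update_smul, Formal.mulRatio_C_mul]
    have hlower := hK e
    rw [hneg, nPoint_update_smul, zeroModePoint_sqTranslate, Pi.zero_apply, ite_self, zero_add, hE,
      Finset.sum_congr (s₁ := Finset.univ) rfl fun s _ => hP s, Finset.sum_neg_distrib,
      ← Finset.mul_sum] at hlower
    rw [if_neg (by lia), zero_add]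
    apply mul_left_cancel₀ hp
    simp only [map_add, map_natCast, map_one] at hlower
    linear_combination hlower

variable {v : V} {μ : Fin m → ℂ}

open Classical in
theorem nPoint_sq_neg (hv : ∀ j, A.mode (h j) 0 v = μ j • v) (u : Fin (n + 1) → V) (p : ℕ)
    (hp : 1 ≤ p) :
    nPoint hH z (Function.update u 0 (A.sq v (-p) (u 0))) =
      (if IsInt (∑ j, z j * μ j) ∧ p = 1 then zeroModePoint hH z v u else 0) +
      (-1) ^ (p + 1) * (∑ᶠ k : ℕ, fun e =>
        ((k + p - 1).choose (p - 1) : PowerSeries ℂ) * formalE (k + p) (∑ j, z j * μ j) *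
          nPoint hH z (Function.update u 0 (A.sq v k (u 0))) e) +
      (-1) ^ (p + 1) * ∑ s : Fin n, ∑ᶠ k : ℕ, fun e =>
        ((k + p - 1).choose (p - 1) : PowerSeries ℂ) *
          Formal.mulRatio (formalP (k + p) (∑ j, z j * μ j)) s.succ 0
            (nPoint hH z (Function.update u s.succ (A.sq v k (u s.succ)))) e := by
  obtain ⟨p, rfl⟩ := Nat.exists_eq_add_of_le' hp
  obtain ⟨K, hK, hsq⟩ := ((eventually_nPoint_sq_neg hH z u p hv).and
    (Filter.eventually_all.mpr fun s => A.eventually_sq_eq_zero v (u s))).exists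
  rw [finsum_eq_sum_range_of_forall_le (K := K) fun k hk => by
      rw [hsq 0 k hk, nPoint_update_zero]; funext _; exact mul_zero _,
    Finset.sum_congr rfl fun s _ => finsum_eq_sum_range_of_forall_le (K := K) fun k hk => by
      rw [hsq s.succ k hk, nPoint_update_zero, Formal.mulRatio_zero]; funext _; exact mul_zero _]
  funext e
  rw [hK e, pow_succ _ (p + 1), pow_succ, mul_assoc _ (-1 : Formal _) (-1), neg_mul_neg, one_mul,
    mul_one]
  simp only [Pi.add_apply, Pi.mul_apply, Pi.pow_apply, Pi.neg_apply, Pi.one_apply,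
    Finset.sum_apply, ← add_assoc, add_tsub_cancel_right, Nat.add_eq_right, ite_apply,
    Pi.zero_apply, mul_assoc]

end VOAModule

/-! ### Values of formal series -/

lemma hasSum_prod_mul {α β R : Type*} [NormedRing R] [NormedSpace ℝ R] [FiniteDimensional ℝ R]
    {f : α → R} {g : β → R} {x y : R} (hf : HasSum f x) (hg : HasSum g y) :
    HasSum (fun r : α × β => f r.1 * g r.2) (x * y) :=
  have : CompleteSpace R := FiniteDimensional.complete ℝ R
  hf.mul hg (summable_mul_of_summable_norm hf.summable.norm hg.summable.norm)

/-- The power series `G` converges absolutely at `q`, with value `x`. -/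
def EvalAt (G : PowerSeries ℂ) (q x : ℂ) : Prop :=
  HasSum (fun N => PowerSeries.coeff N G * q ^ N) x

namespace EvalAt

variable {F G : PowerSeries ℂ} {q x y : ℂ}

lemma coeff_mul_mul_pow {R : Type*} [CommSemiring R] (F G : PowerSeries R) (q : R) (N : ℕ) :
    PowerSeries.coeff N (F * G) * q ^ N = ∑ ij ∈ Finset.HasAntidiagonal.antidiagonal N,
      (PowerSeries.coeff ij.1 F * q ^ ij.1) * (PowerSeries.coeff ij.2 G * q ^ ij.2) := by
  rw [PowerSeries.coeff_mul, Finset.sum_mul]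
  refine Finset.sum_congr rfl fun ij hij => ?_
  rw [← Finset.HasAntidiagonal.mem_antidiagonal.mp hij, pow_add]
  ring

lemma mul (hF : EvalAt F q x) (hG : EvalAt G q y) : EvalAt (F * G) q (x * y) := by
  rw [EvalAt, ← hF.tsum_eq, ← hG.tsum_eq, tsum_mul_tsum_eq_tsum_sum_antidiagonal_of_summable_norm
    hF.summable.norm hG.summable.norm]
  simp only [coeff_mul_mul_pow]
  exact (summable_norm_sum_mul_antidiagonal_of_summable_norm hF.summable.norm
    hG.summable.norm).of_norm.hasSum

lemma add (hF : EvalAt F q x) (hG : EvalAt G q y) : EvalAt (F + G) q (x + y) :=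
  (HasSum.add hF hG).congr_fun fun N => by rw [map_add, add_mul]

lemma neg (hF : EvalAt F q x) : EvalAt (-F) q (-x) :=
  (HasSum.neg hF).congr_fun fun N => by rw [map_neg, neg_mul]

lemma sub (hF : EvalAt F q x) (hG : EvalAt G q y) : EvalAt (F - G) q (x - y) := by
  simpa only [sub_eq_add_neg] using hF.add hG.neg

lemma C_mul_X_pow (c : ℂ) (l : ℕ) (q : ℂ) :
    EvalAt (PowerSeries.C c * PowerSeries.X ^ l) q (c * q ^ l) := by
  have hsum := hasSum_single (f := fun N =>
    PowerSeries.coeff N (PowerSeries.C c * PowerSeries.X ^ l) * q ^ N) l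
    fun N hN => by simp [PowerSeries.coeff_X_pow, hN]
  simpa [EvalAt, PowerSeries.coeff_X_pow] using hsum

lemma C (c q : ℂ) : EvalAt (PowerSeries.C c) q c := by
  simpa using C_mul_X_pow c 0 q

lemma one (q : ℂ) : EvalAt 1 q 1 := by
  simpa using C 1 q

lemma C_mul (c : ℂ) (hF : EvalAt F q x) : EvalAt (PowerSeries.C c * F) q (c * x) :=
  (C c q).mul hF

lemma prod {ι : Type*} {S : Finset ι} {F : ι → PowerSeries ℂ} {x : ι → ℂ}
    (h : ∀ i ∈ S, EvalAt (F i) q (x i)) : EvalAt (∏ i ∈ S, F i) q (∏ i ∈ S, x i) := by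
  induction S using Finset.cons_induction with
  | empty => simpa using EvalAt.one q
  | cons i S hi ih =>
    rw [Finset.prod_cons, Finset.prod_cons]
    exact (h i (Finset.mem_cons_self i S)).mul (ih fun j hj => h j (Finset.mem_cons_of_mem hj))

end EvalAt

local notation "q[" τ "]" => Complex.exp (2 * Real.pi * Complex.I * τ)

namespace Formal

variable {n : ℕ} {F G : Formal n} {a : ℂ} {w : Fin n → ℂ} {τ x y : ℂ}

lemma term_apply (F : Formal n) (a : ℂ) (w : Fin n → ℂ) (τ : ℂ) (e : Fin n → ℤ) (N : ℕ) :
    F.term a w τ (e, N) = PowerSeries.coeff N (F e) * Complex.exp (∑ i, e i * w i) *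
      (q[τ] ^ N * Complex.exp (2 * Real.pi * Complex.I * τ * a)) := by
  rw [term, ← Complex.exp_nat_mul, ← Complex.exp_add]
  congr 2
  ring

lemma hasSum_term_zero (a : ℂ) (w : Fin n → ℂ) (τ : ℂ) :
    HasSum (Formal.term (0 : Formal n) a w τ) 0 :=
  hasSum_zero.congr_fun fun r => by simp [term]

lemma hasSum_term_add (hF : HasSum (F.term a w τ) x) (hG : HasSum (G.term a w τ) y) :
    HasSum (Formal.term (F + G) a w τ) (x + y) :=
  (hF.add hG).congr_fun fun r => by simp only [term, Pi.add_apply, map_add, add_mul]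

lemma hasSum_term_sub (hF : HasSum (F.term a w τ) x) (hG : HasSum (G.term a w τ) y) :
    HasSum (Formal.term (F - G) a w τ) (x - y) :=
  (hF.sub hG).congr_fun fun r => by simp only [term, Pi.sub_apply, map_sub, sub_mul]

lemma hasSum_term_sum {ι : Type*} {S : Finset ι} {F : ι → Formal n} {x : ι → ℂ}
    (hF : ∀ i ∈ S, HasSum ((F i).term a w τ) (x i)) :
    HasSum (Formal.term (∑ i ∈ S, F i) a w τ) (∑ i ∈ S, x i) :=
  (hasSum_sum hF).congr_fun fun r => by
    simp only [term, Finset.sum_apply, map_sum, Finset.sum_mul]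

lemma hasSum_term_C_mul (c : ℂ) (hF : HasSum (F.term a w τ) x) :
    HasSum (Formal.term (fun e => PowerSeries.C c * F e) a w τ) (c * x) :=
  (hF.mul_left c).congr_fun fun r => by
    simp only [term, PowerSeries.coeff_C_mul, mul_assoc]

/-- Reindexes the product of a series in `q_s / q_t` with a formal function by the exponents of the
product: a pair of terms is given by the exponents `(e, N)` of its product, the exponent `l` of
`q_s / q_t` in the first factor, and a decomposition of `N`. -/
def pairIndex (s t : Fin n)
    (x : Σ r : (Fin n → ℤ) × ℕ, ℤ × Finset.HasAntidiagonal.antidiagonal r.2) :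
    (ℤ × ℕ) × ((Fin n → ℤ) × ℕ) :=
  ((x.2.1, x.2.2.1.1), (x.1.1 - Pi.single s x.2.1 + Pi.single t x.2.1, x.2.2.1.2))

lemma pairIndex_bijective (s t : Fin n) : Function.Bijective (pairIndex s t) := by
  constructor
  · rintro ⟨⟨e, N⟩, l, ⟨⟨i, j⟩, hij⟩⟩ ⟨⟨e', N'⟩, l', ⟨⟨i', j'⟩, hij'⟩⟩ h
    obtain rfl : i + j = N := Finset.HasAntidiagonal.mem_antidiagonal.mp hij
    obtain rfl : i' + j' = N' := Finset.HasAntidiagonal.mem_antidiagonal.mp hij'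
    simp only [pairIndex, Prod.mk.injEq] at h
    obtain ⟨⟨rfl, rfl⟩, he, rfl⟩ := h
    obtain rfl : e = e' := by simpa using he
    rfl
  · rintro ⟨⟨l, i⟩, e, j⟩
    refine ⟨⟨(e + Pi.single s l - Pi.single t l, i + j), l, ⟨(i, j), by simp⟩⟩, ?_⟩
    simp only [pairIndex, Prod.mk.injEq, true_and, and_true]
    abel

lemma sum_shift_mul (e : Fin n → ℤ) (s t : Fin n) (l : ℤ) (w : Fin n → ℂ) :
    ∑ i, ((e - Pi.single s l + Pi.single t l : Fin n → ℤ) i : ℂ) * w i =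
      ∑ i, (e i : ℂ) * w i - (w s - w t) * l := by
  have hsingle (s : Fin n) : ∑ i, ((Pi.single s l : Fin n → ℤ) i : ℂ) * w i = l * w s := by
    rw [Finset.sum_eq_single s (fun i _ hi => by simp [hi]) (by simp), Pi.single_eq_same]
  simp only [Pi.add_apply, Pi.sub_apply, Int.cast_add, Int.cast_sub, add_mul, sub_mul,
    Finset.sum_add_distrib, Finset.sum_sub_distrib, hsingle]
  ring

lemma mul_term_shift (F : Formal n) (c a : ℂ) (w : Fin n → ℂ) (τ : ℂ) (s t : Fin n)
    (e : Fin n → ℤ) (l : ℤ) {i j N : ℕ} (hN : i + j = N) :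
    c * Complex.exp ((w s - w t) * l) * q[τ] ^ i *
        F.term a w τ (e - Pi.single s l + Pi.single t l, j) =
      c * PowerSeries.coeff j (F (e - Pi.single s l + Pi.single t l)) *
        (Complex.exp (∑ i, e i * w i) *
          (q[τ] ^ N * Complex.exp (2 * Real.pi * Complex.I * τ * a))) := by
  have hexp : Complex.exp (∑ i, (e i : ℂ) * w i) = Complex.exp ((w s - w t) * l) *
      Complex.exp (∑ i, (e i : ℂ) * w i - (w s - w t) * l) := by
    rw [← Complex.exp_add, add_sub_cancel]
  rw [term_apply, sum_shift_mul, hexp, ← hN, pow_add]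
  ring

lemma hasSum_mulRatio {P : ℤ → PowerSeries ℂ} {s t : Fin n} (hF : HasSum (F.term a w τ) x)
    (hP : HasSum (fun r : ℤ × ℕ => PowerSeries.coeff r.2 (P r.1) *
      Complex.exp ((w s - w t) * r.1) * q[τ] ^ r.2) y)
    (hfin : ∀ (e : Fin n → ℤ) (N : ℕ), (Function.support fun l : ℤ => PowerSeries.coeff N
      (P l * F (e - Pi.single s l + Pi.single t l))).Finite) :
    HasSum ((mulRatio P s t F).term a w τ) (y * x) := by
  have hprod := hasSum_prod_mul hP hF
  rw [← (Equiv.ofBijective _ (pairIndex_bijective s t)).hasSum_iff] at hprod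
  refine (hprod.sigma fun r => (hprod.summable.sigma_factor r).hasSum).congr_fun fun ⟨e, N⟩ => ?_
  rw [(hprod.summable.sigma_factor (e, N)).tsum_prod]
  have hterm (l : ℤ) : ∑' b : Finset.HasAntidiagonal.antidiagonal N,
      ((fun r : (ℤ × ℕ) × ((Fin n → ℤ) × ℕ) => PowerSeries.coeff r.1.2 (P r.1.1) *
          Complex.exp ((w s - w t) * r.1.1) * q[τ] ^ r.1.2 * F.term a w τ r.2) ∘
        Equiv.ofBijective _ (pairIndex_bijective s t)) ⟨(e, N), l, b⟩ =
      PowerSeries.coeff N (P l * F (e - Pi.single s l + Pi.single t l)) *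
        (Complex.exp (∑ i, e i * w i) *
          (q[τ] ^ N * Complex.exp (2 * Real.pi * Complex.I * τ * a))) := by
    rw [tsum_fintype, PowerSeries.coeff_mul, Finset.sum_mul,
      ← Finset.sum_coe_sort (Finset.HasAntidiagonal.antidiagonal N)]
    exact Finset.sum_congr rfl fun b _ =>
      mul_term_shift F _ a w τ s t e l (Finset.HasAntidiagonal.mem_antidiagonal.mp b.2)
  rw [tsum_congr hterm, tsum_mul_right, tsum_eq_finsum (hfin e N), term_apply, mulRatio,
    PowerSeries.coeff_mk, mul_assoc]

lemma mulRatio_single_zero (D : PowerSeries ℂ) (s t : Fin n) (F : Formal n) :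
    mulRatio (Pi.single 0 D) s t F = fun e => D * F e := by
  funext e
  ext N
  rw [mulRatio, PowerSeries.coeff_mk, finsum_eq_single _ 0 fun l hl => by
    rw [Pi.single_eq_of_ne hl, zero_mul, map_zero]]
  simp

lemma hasSum_term_mul {F : Formal (n + 1)} {w : Fin (n + 1) → ℂ} {D : PowerSeries ℂ} {d : ℂ}
    (hD : EvalAt D q[τ] d) (hF : HasSum (F.term a w τ) x) :
    HasSum (Formal.term (fun e => D * F e) a w τ) (d * x) := by
  have hP : HasSum (fun r : ℤ × ℕ => PowerSeries.coeff r.2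
      ((Pi.single 0 D : ℤ → PowerSeries ℂ) r.1) *
        Complex.exp ((w 0 - w 0) * r.1) * q[τ] ^ r.2) d := by
    have hinj : Function.Injective fun N : ℕ => ((0, N) : ℤ × ℕ) := Prod.mk_right_injective 0
    rw [← hinj.hasSum_iff]
    · exact hD.congr_fun fun N => by simp
    · rintro ⟨l, N⟩ h
      obtain hl : l ≠ 0 := fun hl => h ⟨N, by rw [hl]⟩
      simp [hl]
  rw [← mulRatio_single_zero D 0 0 F]
  refine hasSum_mulRatio hF hP fun e N => (Set.finite_singleton 0).subset fun l hl => ?_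
  by_contra hne
  exact hl (by simp [Pi.single_eq_of_ne hne])

lemma hasSum_term_extend {F : Formal n} {w : Fin (n + 1) → ℂ} :
    HasSum (F.extend.term a w τ) x ↔ HasSum (F.term a (Fin.tail w) τ) x := by
  have hinj : Function.Injective fun r : (Fin n → ℤ) × ℕ =>
      ((Fin.cons 0 r.1 : Fin (n + 1) → ℤ), r.2) := fun r r' h => by
    simp only [Prod.mk.injEq] at h
    exact Prod.ext (Fin.cons_injective2 h.1).2 h.2
  rw [← hinj.hasSum_iff]
  · refine Eq.to_iff (congrArg (fun f => HasSum f x) (funext fun r => ?_))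
    simp only [Function.comp_apply, term, extend, Fin.cons_zero, if_true, Fin.tail_cons,
      Fin.sum_univ_succ, Fin.cons_succ, Int.cast_zero, zero_mul, zero_add]
    rfl
  · rintro ⟨e, N⟩ h
    have he : e 0 ≠ 0 := fun h0 =>
      h ⟨(Fin.tail e, N), by simp only [Prod.mk.injEq, and_true]; rw [← h0, Fin.cons_self_tail]⟩
    simp [term, extend, he]

lemma tsum_term_extend (F : Formal n) (a : ℂ) (w : Fin (n + 1) → ℂ) (τ : ℂ) :
    ∑' r, F.extend.term a w τ r = ∑' r, F.term a (Fin.tail w) τ r :=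
  tsum_eq_tsum_of_hasSum_iff_hasSum hasSum_term_extend

end Formal

open Filter Asymptotics

lemma tsum_norm_sum_mul_antidiagonal_le {R : Type*} [NormedRing R] {f g : ℕ → R}
    (hf : Summable fun N => ‖f N‖) (hg : Summable fun N => ‖g N‖) :
    ∑' N, ‖∑ ij ∈ Finset.HasAntidiagonal.antidiagonal N, f ij.1 * g ij.2‖ ≤
      (∑' N, ‖f N‖) * ∑' N, ‖g N‖ := by
  have hprod : Summable fun r : ℕ × ℕ => ‖f r.1‖ * ‖g r.2‖ :=
    hf.mul_of_nonneg hg (fun _ => norm_nonneg _) fun _ => norm_nonneg _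
  rw [hf.tsum_mul_tsum_eq_tsum_sum_antidiagonal hg hprod]
  exact (summable_norm_sum_mul_antidiagonal_of_summable_norm hf hg).tsum_le_tsum
    (fun N => (norm_sum_le _ _).trans (Finset.sum_le_sum fun _ _ => norm_mul_le _ _))
    (summable_sum_mul_antidiagonal_of_summable_mul (f := (‖f ·‖)) (g := (‖g ·‖)) hprod)

/-- The sum of the absolute values of the terms of `G` at `q`; it is `0` if the series diverges. -/
def absSum (G : PowerSeries ℂ) (q : ℂ) : ℝ := ∑' N, ‖PowerSeries.coeff N G * q ^ N‖

section AbsSum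

variable {F G : PowerSeries ℂ} {q x y : ℂ}

lemma absSum_nonneg (G : PowerSeries ℂ) (q : ℂ) : 0 ≤ absSum G q :=
  tsum_nonneg fun _ => norm_nonneg _

lemma absSum_neg (G : PowerSeries ℂ) (q : ℂ) : absSum (-G) q = absSum G q := by
  simp only [absSum, map_neg, neg_mul, norm_neg]

lemma absSum_C_mul (c : ℂ) (G : PowerSeries ℂ) (q : ℂ) :
    absSum (PowerSeries.C c * G) q = ‖c‖ * absSum G q := by
  simp only [absSum, PowerSeries.coeff_C_mul, mul_assoc, norm_mul c, tsum_mul_left]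

namespace EvalAt

lemma absSum_add_le (hF : EvalAt F q x) (hG : EvalAt G q y) :
    absSum (F + G) q ≤ absSum F q + absSum G q := by
  rw [absSum, absSum, absSum, ← hF.summable.norm.tsum_add hG.summable.norm]
  refine (hF.add hG).summable.norm.tsum_le_tsum (fun N => ?_)
    (hF.summable.norm.add hG.summable.norm)
  rw [map_add, add_mul]
  exact norm_add_le _ _

lemma absSum_mul_le (hF : EvalAt F q x) (hG : EvalAt G q y) :
    absSum (F * G) q ≤ absSum F q * absSum G q := by
  simpa only [absSum, coeff_mul_mul_pow] using
    tsum_norm_sum_mul_antidiagonal_le hF.summable.norm hG.summable.norm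

lemma hasSum_prod {ι : Type*} {F : ι → PowerSeries ℂ} {x : ι → ℂ}
    (h : ∀ i, EvalAt (F i) q (x i)) (hs : Summable fun i => absSum (F i) q) :
    HasSum (fun p : ι × ℕ => PowerSeries.coeff p.2 (F p.1) * q ^ p.2) (∑' i, x i) := by
  have hnorm : Summable fun p : ι × ℕ => ‖PowerSeries.coeff p.2 (F p.1) * q ^ p.2‖ :=
    (summable_prod_of_nonneg fun _ => norm_nonneg _).mpr ⟨fun i => (h i).summable.norm, hs⟩
  have hsum := hnorm.of_norm
  rw [(hsum.hasSum.prod_fiberwise h).tsum_eq]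
  exact hsum.hasSum

lemma mul_mk_sum {D : PowerSeries ℂ} {F : ℕ → PowerSeries ℂ} {x : ℕ → ℂ}
    (hF : ∀ l, PowerSeries.X ^ l ∣ F l) (h : ∀ l, EvalAt (D * F (l + 1)) q (x l))
    (hs : Summable fun l => absSum (D * F (l + 1)) q) :
    EvalAt (D * PowerSeries.mk fun N => ∑ l ∈ Finset.Icc 1 N, PowerSeries.coeff N (F l)) q
      (∑' l, x l) := by
  have hcoeff (N : ℕ) : PowerSeries.coeff N
      (D * PowerSeries.mk fun N => ∑ l ∈ Finset.Icc 1 N, PowerSeries.coeff N (F l)) =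
        ∑ l ∈ Finset.range N, PowerSeries.coeff N (D * F (l + 1)) := by
    rw [← map_sum, ← Finset.mul_sum, mul_comm, mul_comm D]
    refine coeff_mul_congr_left fun i hi => ?_
    rw [PowerSeries.coeff_mk, map_sum, Finset.range_eq_Ico,
      Finset.sum_Ico_add' (fun l => PowerSeries.coeff i (F l)) 0 N 1]
    refine Finset.sum_subset (fun l hl => ?_) fun l hl hl' => ?_
    · simp only [Finset.mem_Icc, Finset.mem_Ico] at hl ⊢
      lia
    · simp only [Finset.mem_Icc, Finset.mem_Ico] at hl hl'
      exact PowerSeries.X_pow_dvd_iff.mp (hF l) i (by lia)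
  have hswap := (Equiv.prodComm ℕ ℕ).hasSum_iff.mpr (hasSum_prod h hs)
  refine hswap.prod_fiberwise fun N => ?_
  rw [hcoeff, Finset.sum_mul]
  refine hasSum_sum_of_ne_finset_zero fun l hl => ?_
  rw [Finset.mem_range, not_lt] at hl
  rw [Function.comp_apply, Equiv.prodComm_apply, Prod.swap_prod_mk, mul_comm D,
    coeff_mul_eq_zero_of_X_pow_dvd (hF (l + 1)) (by lia), zero_mul]

end EvalAt

end AbsSum

/-! ### Values of Lambert series -/

section Lambert

variable {a q : ℂ} {l : ℕ}

lemma lambert_eq_mk (a : ℂ) (hl : l ≠ 0) :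
    lambert a l = PowerSeries.mk fun N => if l ∣ N ∧ N ≠ 0 then a ^ (N / l) else 0 := by
  apply mul_left_cancel₀ (one_sub_C_mul_X_pow_ne_zero a hl)
  rw [one_sub_mul_lambert a hl]
  ext N
  rw [sub_mul, one_mul, mul_assoc, map_sub, PowerSeries.coeff_C_mul, PowerSeries.coeff_C_mul,
    PowerSeries.coeff_X_pow, PowerSeries.coeff_X_pow_mul', PowerSeries.coeff_mk]
  rcases lt_or_ge N l with hN | hN
  · have hdvd : ¬(l ∣ N ∧ N ≠ 0) := fun h =>
      hN.not_ge (Nat.le_of_dvd (Nat.pos_of_ne_zero h.2) h.1)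
    rw [if_neg hN.not_ge, if_neg hN.ne, if_neg hdvd, mul_zero, sub_zero]
  · obtain ⟨M, rfl⟩ := Nat.exists_eq_add_of_le hN
    rw [if_pos hN, PowerSeries.coeff_mk, add_tsub_cancel_left,
      Nat.add_div_left _ (Nat.pos_of_ne_zero hl)]
    rcases eq_or_ne M 0 with rfl | hM
    · simp [hl]
    · by_cases hd : l ∣ M <;> simp [hl, hM, hd, pow_succ']

lemma hasSum_lambert {R : Type*} [AddCommMonoid R] [TopologicalSpace R] (a q : ℂ)
    (hl : l ≠ 0) {φ : ℂ → R} (hφ : φ 0 = 0) {x : R} :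
    HasSum (fun N => φ (PowerSeries.coeff N (lambert a l) * q ^ N)) x ↔
      HasSum (fun j : ℕ => φ ((a * q ^ l) ^ (j + 1))) x := by
  have hl' := Nat.pos_of_ne_zero hl
  have hinj : Function.Injective fun j : ℕ => l * (j + 1) :=
    (mul_right_injective₀ hl).comp (add_left_injective 1)
  rw [lambert_eq_mk a hl, ← hinj.hasSum_iff]
  · refine Eq.to_iff (congrArg (fun f => HasSum f x) (funext fun j => ?_))
    rw [Function.comp_apply, PowerSeries.coeff_mk, if_pos ⟨dvd_mul_right _ _, by positivity⟩,
      Nat.mul_div_cancel_left _ hl', mul_pow, ← pow_mul]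
  · intro N hN
    rw [PowerSeries.coeff_mk, if_neg, zero_mul, hφ]
    rintro ⟨⟨j, rfl⟩, h⟩
    obtain ⟨i, rfl⟩ := Nat.exists_eq_succ_of_ne_zero (right_ne_zero_of_mul h)
    exact hN ⟨i, rfl⟩

lemma evalAt_lambert (hl : l ≠ 0) (h : ‖a * q ^ l‖ < 1) :
    EvalAt (lambert a l) q (a * q ^ l / (1 - a * q ^ l)) := by
  refine (hasSum_lambert a q hl (φ := id) rfl).mpr ?_
  simpa only [id, ← pow_succ', ← div_eq_mul_inv] using
    (hasSum_geometric_of_norm_lt_one h).mul_left (a * q ^ l)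

lemma absSum_lambert (hl : l ≠ 0) (h : ‖a * q ^ l‖ < 1) :
    absSum (lambert a l) q = ‖a * q ^ l‖ / (1 - ‖a * q ^ l‖) := by
  refine ((hasSum_lambert a q hl norm_zero).mpr ?_).tsum_eq
  simpa only [norm_pow, ← pow_succ', ← div_eq_mul_inv] using
    (hasSum_geometric_of_lt_one (norm_nonneg _) h).mul_left ‖a * q ^ l‖

lemma tendsto_norm_mul_pow (a : ℂ) (hq : ‖q‖ < 1) :
    Tendsto (fun l : ℕ => ‖a * q ^ l‖) atTop (nhds 0) := by
  simpa using ((tendsto_pow_atTop_nhds_zero_of_norm_lt_one hq).const_mul a).norm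

lemma isBigO_absSum_lambert (a : ℂ) (hq : ‖q‖ < 1) :
    (fun l => absSum (lambert a l) q) =O[atTop] fun l => ‖q‖ ^ l := by
  refine IsBigO.of_bound (2 * ‖a‖) ?_
  filter_upwards [(tendsto_norm_mul_pow a hq).eventually_le_const (u := 1 / 2) (by norm_num),
    eventually_ne_atTop 0] with l hle hl
  rw [absSum_lambert hl (hle.trans_lt (by norm_num)), Real.norm_of_nonneg
    (div_nonneg (norm_nonneg _) (by linarith)), norm_pow, norm_norm, mul_assoc, ← norm_pow,
    ← norm_mul, div_le_iff₀ (by linarith)]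
  nlinarith [norm_nonneg (a * q ^ l)]

end Lambert

/-- The power series `D` clears the denominators of the Lambert series with parameter `a` at `q`:
its value `d` at `q` is nonzero, and all its products with these Lambert series converge at `q` to
the expected values, with bounds as if no denominator had vanished in the disc. -/
structure Clears (D : PowerSeries ℂ) (d a q : ℂ) : Prop where
  evalAt : EvalAt D q d
  ne_zero : d ≠ 0
  mul_pow_ne_one : ∀ l : ℕ, l ≠ 0 → a * q ^ l ≠ 1
  evalAt_mul_lambert : ∀ l : ℕ, l ≠ 0 →
    EvalAt (D * lambert a l) q (d * (a * q ^ l / (1 - a * q ^ l)))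
  isBigO : (fun l => absSum (D * lambert a l) q) =O[atTop] fun l => ‖q‖ ^ l

namespace Clears

variable {D D' : PowerSeries ℂ} {d d' a q : ℂ}

lemma mul_left (h : Clears D d a q) (hD' : EvalAt D' q d') (hd' : d' ≠ 0) :
    Clears (D' * D) (d' * d) a q where
  evalAt := hD'.mul h.evalAt
  ne_zero := mul_ne_zero hd' h.ne_zero
  mul_pow_ne_one := h.mul_pow_ne_one
  evalAt_mul_lambert l hl := by
    simpa only [mul_assoc] using hD'.mul (h.evalAt_mul_lambert l hl)
  isBigO := by
    refine IsBigO.trans (IsBigO.of_bound (absSum D' q) ?_) h.isBigO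
    filter_upwards [eventually_ne_atTop 0] with l hl
    rw [Real.norm_of_nonneg (absSum_nonneg _ _), Real.norm_of_nonneg (absSum_nonneg _ _), mul_assoc]
    exact hD'.absSum_mul_le (h.evalAt_mul_lambert l hl)

lemma prod_one_sub (hq : ‖q‖ < 1) (hne : ∀ l : ℕ, l ≠ 0 → a * q ^ l ≠ 1) {L : ℕ}
    (hL : ∀ l, L < l → ‖a * q ^ l‖ < 1) :
    Clears (∏ l ∈ Finset.range L, (1 - PowerSeries.C a * PowerSeries.X ^ (l + 1)))
      (∏ l ∈ Finset.range L, (1 - a * q ^ (l + 1))) a q := by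
  have hfactor (l : ℕ) : EvalAt (1 - PowerSeries.C a * PowerSeries.X ^ (l + 1)) q
      (1 - a * q ^ (l + 1)) := (EvalAt.one q).sub (EvalAt.C_mul_X_pow a _ q)
  have hD := EvalAt.prod fun l (_ : l ∈ Finset.range L) => hfactor l
  refine ⟨hD, Finset.prod_ne_zero_iff.mpr fun l _ => sub_ne_zero.mpr (hne _ l.succ_ne_zero).symm,
    hne, fun l hl => ?_, ?_⟩
  · rcases lt_or_ge L l with hlt | hle
    · exact hD.mul (evalAt_lambert hl (hL l hlt))
    · obtain ⟨l, rfl⟩ := Nat.exists_eq_succ_of_ne_zero hl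
      have hmem : l ∈ Finset.range L := Finset.mem_range.mpr hle
      rw [← Finset.prod_erase_mul _ _ hmem, ← Finset.prod_erase_mul _ _ hmem, mul_assoc, mul_assoc,
        one_sub_mul_lambert a hl, mul_div_cancel₀ _ (sub_ne_zero.mpr (hne _ hl).symm)]
      exact (EvalAt.prod fun l _ => hfactor l).mul (EvalAt.C_mul_X_pow a _ q)
  · refine IsBigO.trans (IsBigO.of_bound (absSum (∏ l ∈ Finset.range L,
      (1 - PowerSeries.C a * PowerSeries.X ^ (l + 1))) q) ?_) (isBigO_absSum_lambert a hq)
    filter_upwards [eventually_gt_atTop L] with l hl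
    rw [Real.norm_of_nonneg (absSum_nonneg _ _), Real.norm_of_nonneg (absSum_nonneg _ _)]
    exact hD.absSum_mul_le (evalAt_lambert (by lia) (hL l hl))

end Clears

lemma exists_clears {a q : ℂ} (hq : ‖q‖ < 1) (hne : ∀ l : ℕ, l ≠ 0 → a * q ^ l ≠ 1) :
    ∃ D d, Clears D d a q := by
  obtain ⟨L, hL⟩ := eventually_atTop.mp ((tendsto_norm_mul_pow a hq).eventually_lt_const one_pos)
  exact ⟨_, _, Clears.prod_one_sub hq hne fun l hl => hL l hl.le⟩

lemma clears_one {q : ℂ} (hq : ‖q‖ < 1) : Clears 1 1 1 q := by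
  have hlt (l : ℕ) (hl : l ≠ 0) : ‖1 * q ^ l‖ < 1 := by
    rw [one_mul, norm_pow]
    exact pow_lt_one₀ (norm_nonneg _) hq hl
  simpa using Clears.prod_one_sub (a := 1) (L := 0) hq
    (fun l hl h => (hlt l hl).ne (by rw [h, norm_one])) fun l hl => hlt l hl.ne'

/-! ### Values of the twisted Weierstrass functions and Eisenstein series -/

lemma norm_nome_lt_one {τ : ℂ} (hτ : 0 < τ.im) : ‖q[τ]‖ < 1 := by
  have hre : (2 * Real.pi * Complex.I * τ).re = -(2 * Real.pi * τ.im) := by simp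
  rw [Complex.norm_exp, hre, Real.exp_lt_one_iff, neg_lt_zero]
  positivity

lemma nome_zpow (τ : ℂ) (l : ℤ) : Complex.exp (2 * Real.pi * Complex.I * τ * l) = q[τ] ^ l := by
  rw [← Complex.exp_int_mul, mul_comm]

lemma zeta_mul_nome_zpow_ne_one {Z τ : ℂ} (hZ : ∀ a b : ℤ, Z = a + b * τ → b = 0) {l : ℤ}
    (hl : l ≠ 0) : zeta Z * q[τ] ^ l ≠ 1 := by
  rw [zeta, ← nome_zpow, ← Complex.exp_add]
  intro h
  obtain ⟨a, ha⟩ := Complex.exp_eq_one_iff.mp h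
  have hlattice : Z + τ * l = a :=
    mul_left_cancel₀ Complex.two_pi_I_ne_zero (by linear_combination ha)
  have := hZ a (-l) (by push_cast; linear_combination hlattice)
  lia

lemma inv_zeta_mul_nome_zpow_ne_one {Z τ : ℂ} (hZ : ∀ a b : ℤ, Z = a + b * τ → b = 0) {l : ℤ}
    (hl : l ≠ 0) : (zeta Z)⁻¹ * q[τ] ^ l ≠ 1 := fun h => by
  apply zeta_mul_nome_zpow_ne_one hZ (neg_ne_zero.mpr hl)
  rw [zpow_neg, (inv_mul_eq_one₀ (zeta_ne_zero Z)).mp h, mul_inv_cancel₀]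
  exact zpow_ne_zero l (Complex.exp_ne_zero _)

lemma exists_clears_zeta {Z τ : ℂ} (hτ : 0 < τ.im) (hZ : ∀ a b : ℤ, Z = a + b * τ → b = 0) :
    ∃ D d, Clears D d (zeta Z)⁻¹ q[τ] ∧ Clears D d (zeta Z) q[τ] ∧ (IsInt Z → D = 1) := by
  have hq := norm_nome_lt_one hτ
  by_cases hI : IsInt Z
  · rw [(zeta_eq_one_iff Z).mpr hI, inv_one]
    exact ⟨1, 1, clears_one hq, clears_one hq, fun _ => rfl⟩
  · obtain ⟨D, d, h⟩ := exists_clears hq fun l hl =>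
      mod_cast inv_zeta_mul_nome_zpow_ne_one hZ (Int.natCast_ne_zero.mpr hl)
    obtain ⟨D', d', h'⟩ := exists_clears hq fun l hl =>
      mod_cast zeta_mul_nome_zpow_ne_one hZ (Int.natCast_ne_zero.mpr hl)
    refine ⟨D' * D, d' * d, h.mul_left h'.evalAt h'.ne_zero, ?_, fun hI' => absurd hI' hI⟩
    rw [mul_comm D', mul_comm d']
    exact h'.mul_left h.evalAt h.ne_zero

/-- The value `1 / (1 - ζ⁻¹ q^l)` of `kernelP Z l`, to be left out if `l = 0` and `ζ = 1`. -/
def kernelVal (Z q : ℂ) (l : ℤ) : ℂ :=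
  if l = 0 then zeroTerm Z else 1 / (1 - (zeta Z)⁻¹ * q ^ l)

lemma twistedP_eq_tsum_kernelVal (k : ℕ) (w Z τ : ℂ) :
    twistedP (k + 1) w Z τ = ∑' l : ℤ, (l : ℂ) ^ k / (k.factorial : ℂ) * Complex.exp (w * l) *
      kernelVal Z q[τ] l := by
  rw [twistedP, add_tsub_cancel_right, ← tsum_mul_left]
  refine tsum_congr fun l => ?_
  rcases eq_or_ne l 0 with rfl | hl
  · simp [kernelVal, div_eq_inv_mul, mul_assoc]
  · rw [kernelVal, if_neg hl, if_neg hl, nome_zpow]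
    ring

lemma twistedE_eq_tsum (k : ℕ) (τ Z : ℂ) :
    twistedE k τ Z = eisensteinConst k Z + 1 / ((k - 1).factorial : ℂ) *
      ∑' l : ℕ, ((l + 1 : ℕ) : ℂ) ^ (k - 1) *
        ((zeta Z)⁻¹ * q[τ] ^ (l + 1) / (1 - (zeta Z)⁻¹ * q[τ] ^ (l + 1)) +
          (-1) ^ k * (zeta Z * q[τ] ^ (l + 1) / (1 - zeta Z * q[τ] ^ (l + 1)))) := by
  have hpow (l : ℕ) : Complex.exp (2 * Real.pi * Complex.I * τ * (l + 1)) = q[τ] ^ (l + 1) := by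
    rw [← zpow_natCast, ← nome_zpow]
    push_cast
    rfl
  simp only [twistedE, hpow, Nat.cast_add_one, mul_comm (zeta Z), mul_comm (zeta Z)⁻¹]

lemma summable_norm_pow_div_mul_exp (k : ℕ) {w : ℂ} {r : ℝ} (hr : 0 ≤ r)
    (h : ‖Complex.exp w‖ * r < 1) : Summable fun n : ℕ =>
      ‖(n : ℂ) ^ k / (k.factorial : ℂ) * Complex.exp (w * n)‖ * r ^ n := by
  have hgeom := summable_pow_mul_geometric_of_norm_lt_one k
    (r := ‖Complex.exp w‖ * r) (by rwa [Real.norm_of_nonneg (by positivity)])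
  refine (hgeom.mul_left (k.factorial : ℝ)⁻¹).congr fun n => ?_
  rw [mul_comm w, Complex.exp_nat_mul, norm_mul, norm_div, norm_pow, norm_pow,
    Complex.norm_natCast, Complex.norm_natCast, mul_pow]
  ring

section Clears

variable {Z τ w : ℂ} {D : PowerSeries ℂ} {d q : ℂ}

lemma evalAt_mul_kernelP (hq : q ≠ 0) (h : Clears D d (zeta Z)⁻¹ q) (h' : Clears D d (zeta Z) q)
    (l : ℤ) : EvalAt (D * kernelP Z l) q (d * kernelVal Z q l) := by
  obtain ⟨l, rfl | rfl⟩ := l.eq_nat_or_neg <;> rcases eq_or_ne l 0 with rfl | hl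
  · simpa [kernelP_zero, kernelVal] using h.evalAt.mul (EvalAt.C (zeroTerm Z) q)
  · have hne := sub_ne_zero.mpr (h.mul_pow_ne_one l hl).symm
    rw [kernelP_natCast Z hl, kernelVal, if_neg (mod_cast hl), zpow_natCast,
      show 1 / (1 - (zeta Z)⁻¹ * q ^ l) = 1 + (zeta Z)⁻¹ * q ^ l / (1 - (zeta Z)⁻¹ * q ^ l) by
        rw [one_add_div hne, sub_add_cancel], mul_one_add, mul_one_add]
    exact h.evalAt.add (h.evalAt_mul_lambert l hl)
  · simpa [kernelP_zero, kernelVal] using h.evalAt.mul (EvalAt.C (zeroTerm Z) q)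
  · have hz := zeta_ne_zero Z
    have hql := pow_ne_zero l hq
    have hne : zeta Z * q ^ l - 1 ≠ 0 := sub_ne_zero.mpr (h'.mul_pow_ne_one l hl)
    have hval : 1 / (1 - (zeta Z)⁻¹ * (q ^ l)⁻¹) = -(zeta Z * q ^ l / (1 - zeta Z * q ^ l)) := by
      rw [show 1 - (zeta Z)⁻¹ * (q ^ l)⁻¹ = (zeta Z * q ^ l - 1) / (zeta Z * q ^ l) by field_simp,
        one_div_div, ← div_neg, neg_sub]
    rw [kernelP_neg_natCast Z hl, kernelVal, if_neg (by lia), zpow_neg, zpow_natCast, hval,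
      mul_neg, mul_neg]
    exact (h'.evalAt_mul_lambert l hl).neg

lemma Clears.isBigO_absSum_mul_kernelP_natCast (hq : ‖q‖ < 1) (h : Clears D d (zeta Z)⁻¹ q) :
    (fun l : ℕ => absSum (D * kernelP Z l) q) =O[atTop] fun _ => (1 : ℝ) := by
  have hlambert : (fun l => absSum (D * lambert (zeta Z)⁻¹ l) q) =O[atTop] fun _ => (1 : ℝ) :=
    h.isBigO.trans (IsBigO.of_bound 1 (Eventually.of_forall fun l => by
      simpa using pow_le_one₀ (norm_nonneg q) hq.le))
  refine IsBigO.trans (IsBigO.of_norm_eventuallyLE ?_)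
    ((isBigO_const_const (absSum D q) one_ne_zero atTop).add hlambert)
  filter_upwards [eventually_ne_atTop 0] with l hl
  rw [Real.norm_of_nonneg (absSum_nonneg _ _), kernelP_natCast Z hl, mul_one_add]
  exact h.evalAt.absSum_add_le (h.evalAt_mul_lambert l hl)

lemma Clears.isBigO_absSum_mul_kernelP_neg_natCast (h : Clears D d (zeta Z) q) :
    (fun l : ℕ => absSum (D * kernelP Z (-l)) q) =O[atTop] fun l => ‖q‖ ^ l := by
  refine IsBigO.congr' h.isBigO ?_ EventuallyEq.rfl
  filter_upwards [eventually_ne_atTop 0] with l hl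
  rw [kernelP_neg_natCast Z hl, mul_neg, absSum_neg]

lemma summable_absSum_mul_kernelP (h : Clears D d (zeta Z)⁻¹ q) (h' : Clears D d (zeta Z) q)
    (hqw : ‖q‖ < ‖Complex.exp w‖) (hw : ‖Complex.exp w‖ < 1) (k : ℕ) :
    Summable fun l : ℤ => absSum (PowerSeries.C ((l : ℂ) ^ k / (k.factorial : ℂ) *
      Complex.exp (w * l)) * (D * kernelP Z l)) q := by
  simp only [absSum_C_mul]
  refine Summable.of_nat_of_neg ?_ ?_
  · have hsum := summable_norm_pow_div_mul_exp k (w := w) zero_le_one (by rwa [mul_one])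
    refine summable_of_isBigO_nat hsum ?_
    simpa only [one_pow, Int.cast_natCast] using
      (isBigO_refl _ _).mul (h.isBigO_absSum_mul_kernelP_natCast (hqw.trans hw))
  · have hsum := summable_norm_pow_div_mul_exp k (w := -w) (norm_nonneg q) (by
      rwa [Complex.exp_neg, norm_inv, inv_mul_lt_one₀ (norm_pos_iff.mpr (Complex.exp_ne_zero w))])
    refine summable_of_isBigO_nat hsum ((IsBigO.of_norm_eventuallyLE (.of_forall fun n => ?_)).mul
      h'.isBigO_absSum_mul_kernelP_neg_natCast)
    simp

lemma hasSum_mul_formalP (h : Clears D d (zeta Z)⁻¹ q[τ]) (h' : Clears D d (zeta Z) q[τ])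
    (hqw : ‖q[τ]‖ < ‖Complex.exp w‖) (hw : ‖Complex.exp w‖ < 1) (k : ℕ) :
    HasSum (fun r : ℤ × ℕ => PowerSeries.coeff r.2 (D * formalP (k + 1) Z r.1) *
      Complex.exp (w * r.1) * q[τ] ^ r.2) (d * twistedP (k + 1) w Z τ) := by
  have hsum := EvalAt.hasSum_prod
    (fun l => (evalAt_mul_kernelP (Complex.exp_ne_zero _) h h' l).C_mul
      ((l : ℂ) ^ k / (k.factorial : ℂ) * Complex.exp (w * l)))
    (summable_absSum_mul_kernelP h h' hqw hw k)
  simp only [mul_left_comm _ d, tsum_mul_left, ← twistedP_eq_tsum_kernelVal] at hsum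
  refine hsum.congr_fun fun r => ?_
  rw [formalP_eq, add_tsub_cancel_right, mul_left_comm, PowerSeries.coeff_C_mul,
    PowerSeries.coeff_C_mul]
  ring

lemma summable_absSum_mul_lambert_add (hq : ‖q‖ < 1) (h : Clears D d (zeta Z)⁻¹ q)
    (h' : Clears D d (zeta Z) q) (k : ℕ) (c : ℂ) :
    Summable fun l : ℕ => absSum (PowerSeries.C ((l : ℂ) ^ k) *
      (D * lambert (zeta Z)⁻¹ l + PowerSeries.C c * (D * lambert (zeta Z) l))) q := by
  refine summable_of_isBigO_nat (summable_pow_mul_geometric_of_norm_lt_one k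
    (by rwa [norm_norm] : ‖‖q‖‖ < 1)) ?_
  simp only [absSum_C_mul]
  refine (IsBigO.of_norm_eventuallyLE (.of_forall fun l => by simp)).mul
    (IsBigO.trans (IsBigO.of_norm_eventuallyLE ?_) (h.isBigO.add (h'.isBigO.const_mul_left ‖c‖)))
  filter_upwards [eventually_ne_atTop 0] with l hl
  rw [Real.norm_of_nonneg (absSum_nonneg _ _), ← absSum_C_mul]
  exact (h.evalAt_mul_lambert l hl).absSum_add_le ((h'.evalAt_mul_lambert l hl).C_mul c)

lemma evalAt_mul_formalE (hτ : 0 < τ.im) (h : Clears D d (zeta Z)⁻¹ q[τ])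
    (h' : Clears D d (zeta Z) q[τ]) (k : ℕ) :
    EvalAt (D * formalE k Z) q[τ] (d * twistedE k τ Z) := by
  set F : ℕ → PowerSeries ℂ := fun l => PowerSeries.C ((l : ℂ) ^ (k - 1)) *
    (lambert (zeta Z)⁻¹ l + PowerSeries.C ((-1) ^ k) * lambert (zeta Z) l) with hF
  have hmul (l : ℕ) : D * F l = PowerSeries.C ((l : ℂ) ^ (k - 1)) * (D * lambert (zeta Z)⁻¹ l +
      PowerSeries.C ((-1) ^ k) * (D * lambert (zeta Z) l)) := by
    rw [hF]
    ring
  have hdvd (l : ℕ) : PowerSeries.X ^ l ∣ F l :=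
    ((X_pow_dvd_lambert _ l).add ((X_pow_dvd_lambert _ l).mul_left _)).mul_left _
  have hseries := EvalAt.mul_mk_sum (D := D) hdvd (fun l => (hmul (l + 1)).symm ▸
      ((h.evalAt_mul_lambert (l + 1) l.succ_ne_zero).add
        ((h'.evalAt_mul_lambert (l + 1) l.succ_ne_zero).C_mul ((-1) ^ k))).C_mul
          (((l + 1 : ℕ) : ℂ) ^ (k - 1))) (by
    simp only [hmul]
    exact (summable_nat_add_iff 1).mpr
      (summable_absSum_mul_lambert_add (norm_nome_lt_one hτ) h h' (k - 1) ((-1) ^ k)))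
  simp only [mul_left_comm _ d, ← mul_add, tsum_mul_left] at hseries
  convert (h.evalAt.C_mul (eisensteinConst k Z)).add
    (hseries.C_mul (1 / ((k - 1).factorial : ℂ))) using 1
  · rw [formalE]
    ring
  · rw [twistedE_eq_tsum]
    ring

end Clears

/-! ### The recursions for the values -/

/-- After multiplication by `D`, whose value is `d`, the formal function `S` converges absolutely to
`d * y`. Thus `y` is the value of `S` although `S` itself may diverge. -/
def HasClearedValue {n : ℕ} (D : PowerSeries ℂ) (d a : ℂ) (w : Fin n → ℂ) (τ : ℂ) (S : Formal n)
    (y : ℂ) : Prop :=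
  HasSum (Formal.term (fun e => D * S e) a w τ) (d * y)

namespace HasClearedValue

variable {n : ℕ} {D : PowerSeries ℂ} {d a τ x y : ℂ}

section Algebra

variable {w : Fin n → ℂ} {S T : Formal n}

lemma add (hS : HasClearedValue D d a w τ S x) (hT : HasClearedValue D d a w τ T y) :
    HasClearedValue D d a w τ (S + T) (x + y) := by
  simp only [HasClearedValue, Pi.add_apply, mul_add] at *
  exact Formal.hasSum_term_add hS hT

lemma C_mul (c : ℂ) (hS : HasClearedValue D d a w τ S y) :
    HasClearedValue D d a w τ (fun e => PowerSeries.C c * S e) (c * y) := by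
  simp only [HasClearedValue, mul_left_comm _ (PowerSeries.C c), mul_left_comm _ c] at *
  exact Formal.hasSum_term_C_mul c hS

lemma natCast_mul (c : ℕ) (hS : HasClearedValue D d a w τ S y) :
    HasClearedValue D d a w τ (fun e => (c : PowerSeries ℂ) * S e) (c * y) := by
  simpa only [map_natCast] using hS.C_mul c

lemma neg_one_pow_mul (p : ℕ) (hS : HasClearedValue D d a w τ S y) :
    HasClearedValue D d a w τ ((-1) ^ p * S) ((-1) ^ p * y) := by
  have hmul := hS.C_mul ((-1) ^ p)
  simp only [map_pow, map_neg, map_one] at hmul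
  exact hmul

lemma sum {ι : Type*} (s : Finset ι) {S : ι → Formal n} {y : ι → ℂ}
    (h : ∀ i, HasClearedValue D d a w τ (S i) (y i)) :
    HasClearedValue D d a w τ (∑ i ∈ s, S i) (∑ i ∈ s, y i) := by
  have hsum := Formal.hasSum_term_sum (S := s) fun i _ => h i
  rw [← Finset.mul_sum] at hsum
  refine (congrArg (fun F => HasSum (Formal.term F a w τ) _) (funext fun e => ?_)).mp hsum
  rw [Finset.sum_apply, Finset.sum_apply, Finset.mul_sum]

lemma eq_zero (hd : d ≠ 0) (h : HasClearedValue D d a w τ (0 : Formal n) y) : y = 0 := by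
  simp only [HasClearedValue, Pi.zero_apply, mul_zero] at h
  exact (mul_eq_zero.mp (h.unique (Formal.hasSum_term_zero a w τ))).resolve_left hd

lemma finsum {ι : Type*} (hd : d ≠ 0) {S : ι → Formal n} {y : ι → ℂ}
    (h : ∀ i, HasClearedValue D d a w τ (S i) (y i)) (hfin : (Function.support S).Finite) :
    HasClearedValue D d a w τ (∑ᶠ i, S i) (∑ᶠ i, y i) := by
  have hsupp : Function.support y ⊆ hfin.toFinset := fun i hi =>
    hfin.mem_toFinset.mpr fun hS => hi ((hS ▸ h i).eq_zero hd)
  rw [finsum_eq_sum S hfin, finsum_eq_sum_of_support_subset y hsupp]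
  exact sum _ h

end Algebra

variable {w : Fin (n + 1) → ℂ} {F G S : Formal (n + 1)} {Z : ℂ}

lemma formalE_mul (hτ : 0 < τ.im) (hc : Clears D d (zeta Z)⁻¹ q[τ]) (hc' : Clears D d (zeta Z) q[τ])
    (k : ℕ) (hF : HasSum (F.term a w τ) x) :
    HasClearedValue D d a w τ (fun e => formalE k Z * F e) (twistedE k τ Z * x) := by
  simp only [HasClearedValue, ← mul_assoc]
  exact Formal.hasSum_term_mul (evalAt_mul_formalE hτ hc hc' k) hF

lemma mulRatio (hc : Clears D d (zeta Z)⁻¹ q[τ]) (hc' : Clears D d (zeta Z) q[τ])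
    {s t : Fin (n + 1)} (hw : ‖q[τ]‖ < ‖Complex.exp (w s - w t)‖ ∧ ‖Complex.exp (w s - w t)‖ < 1)
    (k : ℕ) (hvanish : F.VanishesFar s t) (hF : HasSum (F.term a w τ) x) :
    HasClearedValue D d a w τ (Formal.mulRatio (formalP (k + 1) Z) s t F)
      (twistedP (k + 1) (w s - w t) Z τ * x) := by
  rw [HasClearedValue, hvanish.mul_mulRatio (X_pow_dvd_formalP (k + 1) Z), ← mul_assoc]
  exact Formal.hasSum_mulRatio hF (hasSum_mul_formalP hc hc' hw.1 hw.2 k)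
    (hvanish.finite_support fun l hl => (X_pow_dvd_formalP (k + 1) Z l hl).mul_left D)

-- If `c` holds then `D = 1`, and the convergence of `G` follows from that of `F` and `S`.
lemma eq_ite_add (hD : EvalAt D q[τ] d) (hd : d ≠ 0) {c : Prop} [Decidable c] (hc : c → D = 1)
    (hFS : F = (if c then G else 0) + S) (hF : HasSum (F.term a w τ) x)
    (hS : HasClearedValue D d a w τ S y) :
    x = (if c then ∑' r, G.term a w τ r else 0) + y := by
  by_cases hcc : c
  · obtain rfl := hc hcc
    obtain rfl : d = 1 := hD.unique (EvalAt.one q[τ])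
    simp only [HasClearedValue, one_mul] at hS
    rw [if_pos hcc] at hFS ⊢
    have hG := Formal.hasSum_term_sub hF hS
    rw [hFS, add_sub_cancel_right] at hG
    rw [hG.tsum_eq, sub_add_cancel]
  · rw [if_neg hcc, zero_add] at hFS ⊢
    subst hFS
    exact mul_left_cancel₀ hd ((Formal.hasSum_term_mul hD hF).unique hS)

end HasClearedValue

lemma VOA.finite_support_sq {V : Type*} [AddCommGroup V] [Module ℂ V] (A : VOA V) (v u : V) :
    (Function.support fun k : ℕ => A.sq v k u).Finite := by
  obtain ⟨K, hK⟩ := (A.eventually_sq_eq_zero v u).exists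
  exact (Set.finite_lt_nat K).subset fun k hk => not_le.mp fun hKk => hk (hK k hKk)

namespace VOAModule

variable {V M : Type*} [AddCommGroup V] [Module ℂ V] [AddCommGroup M] [Module ℂ M]
  {A : VOA V} {X : VOAModule A M} {n m : ℕ} {h : Fin m → V} (hH : ConditionH X h) (z : Fin m → ℂ)

lemma nPoint_cons_vac (u : Fin n → V) :
    nPoint hH z (Fin.cons A.vac u : Fin (n + 1) → V) = (nPoint hH z u).extend := by
  funext e
  obtain ⟨a, e, rfl⟩ : ∃ a e', e = (Fin.cons a e' : Fin (n + 1) → ℤ) :=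
    ⟨e 0, Fin.tail e, (Fin.cons_self_tail e).symm⟩
  rw [nPoint_apply, opProd_succ, Fin.cons_zero, Fin.cons_zero, Fin.tail_cons, Fin.tail_cons,
    coefOp_vac, Formal.extend, Fin.cons_zero, Fin.tail_cons]
  split_ifs
  · rw [one_mul, nPoint_apply]
  · rw [zero_mul, zero_mul, gradedTrace_zero]

variable {hH z} {w : Fin (n + 1) → ℂ} {τ : ℂ}

-- Inserting the vacuum turns a function of `n` points into one of `n + 1` points.
lemma ConvergesAt.hasSum_extend (hconv : ConvergesAt hH z w τ) (u : Fin n → V) :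
    HasSum ((nPoint hH z u).extend.term (X.wt - A.c / 24) w τ)
      (X.value (nPoint hH z u) (Fin.tail w) τ) := by
  have hsum := (hconv (Fin.cons A.vac u)).hasSum
  rwa [nPoint_cons_vac, Formal.tsum_term_extend] at hsum

variable (hH z) {v : V} {μ : Fin m → ℂ}

open Classical in
theorem value_nPoint_cons (hv : ∀ j, A.mode (h j) 0 v = μ j • v) (hτ : 0 < τ.im)
    (hw : ∀ s : Fin n, ‖q[τ]‖ < ‖Complex.exp (w s.succ - w 0)‖ ∧
      ‖Complex.exp (w s.succ - w 0)‖ < 1)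
    (hZ : ∀ a b : ℤ, ∑ j, z j * μ j = a + b * τ → b = 0) (hconv : ConvergesAt hH z w τ)
    (u : Fin n → V) :
    X.value (nPoint hH z (Fin.cons v u : Fin (n + 1) → V)) w τ =
      (if IsInt (∑ j, z j * μ j) then
        X.value (zeroModePoint hH z v u) (Fin.tail w) τ else 0) +
      ∑ s : Fin n, ∑ᶠ k : ℕ, twistedP (k + 1) (w s.succ - w 0) (∑ j, z j * μ j) τ *
        X.value (nPoint hH z (Function.update u s (A.sq v k (u s)))) (Fin.tail w) τ := by
  obtain ⟨D, d, hc, hc', hD⟩ := exists_clears_zeta hτ hZ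
  simp only [value, ← Formal.tsum_term_extend (zeroModePoint hH z v u)]
  refine HasClearedValue.eq_ite_add hc.evalAt hc.ne_zero hD (nPoint_cons hH z hv u)
    (hconv _).hasSum (.sum _ fun s => .finsum hc.ne_zero (fun k => ?_) ?_)
  · exact .mulRatio hc hc' (hw s) k (Formal.vanishesFar_extend _ s) (hconv.hasSum_extend _)
  · refine (A.finite_support_sq v (u s)).subset fun k hk (hsq : A.sq v k (u s) = 0) => hk ?_
    simp only [hsq, nPoint_update_zero, Formal.extend_zero, Formal.mulRatio_zero]

open Classical in
theorem value_nPoint_sq_neg (hv : ∀ j, A.mode (h j) 0 v = μ j • v) (hτ : 0 < τ.im)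
    (hw : ∀ s : Fin n, ‖q[τ]‖ < ‖Complex.exp (w s.succ - w 0)‖ ∧
      ‖Complex.exp (w s.succ - w 0)‖ < 1)
    (hZ : ∀ a b : ℤ, ∑ j, z j * μ j = a + b * τ → b = 0) (hconv : ConvergesAt hH z w τ)
    (u : Fin (n + 1) → V) (p : ℕ) (hp : 1 ≤ p) :
    X.value (nPoint hH z (Function.update u 0 (A.sq v (-p) (u 0)))) w τ =
      (if IsInt (∑ j, z j * μ j) ∧ p = 1 then
        X.value (zeroModePoint hH z v u) w τ else 0) +
      (-1) ^ (p + 1) * (∑ᶠ k : ℕ,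
        ((k + p - 1).choose (p - 1) : ℂ) * twistedE (k + p) τ (∑ j, z j * μ j) *
          X.value (nPoint hH z (Function.update u 0 (A.sq v k (u 0)))) w τ) +
      (-1) ^ (p + 1) * ∑ s : Fin n, ∑ᶠ k : ℕ,
        ((k + p - 1).choose (p - 1) : ℂ) *
          twistedP (k + p) (w s.succ - w 0) (∑ j, z j * μ j) τ *
          X.value (nPoint hH z (Function.update u s.succ (A.sq v k (u s.succ)))) w τ := by
  obtain ⟨D, d, hc, hc', hD⟩ := exists_clears_zeta hτ hZ
  have hformal := nPoint_sq_neg hH z hv u p hp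
  obtain ⟨p, rfl⟩ := Nat.exists_eq_add_of_le' hp
  simp only [mul_assoc, add_assoc] at hformal ⊢
  refine HasClearedValue.eq_ite_add hc.evalAt hc.ne_zero (fun hint => hD hint.1) hformal
    (hconv _).hasSum (.add (.neg_one_pow_mul _ (.finsum hc.ne_zero (fun k => ?_) ?_))
      (.neg_one_pow_mul _ (.sum _ fun s => .finsum hc.ne_zero (fun k => ?_) ?_)))
  · exact .natCast_mul _ (.formalE_mul hτ hc hc' _ (hconv _).hasSum)
  · refine (A.finite_support_sq v (u 0)).subset fun k hk (hsq : A.sq v k (u 0) = 0) => hk ?_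
    simp only [hsq, nPoint_update_zero, Pi.zero_apply, mul_zero]
    rfl
  · exact .natCast_mul _
      (.mulRatio hc hc' (hw s) _ (vanishesFar_nPoint hH z _ s) (hconv _).hasSum)
  · refine (A.finite_support_sq v (u s.succ)).subset
      fun k hk (hsq : A.sq v k (u s.succ) = 0) => hk ?_
    simp only [hsq, nPoint_update_zero, Formal.mulRatio_zero, Pi.zero_apply, mul_zero]
    rfl

end VOAModule

end JacobiTrace

end

open JacobiTrace Classical in
theorem mainTheorem4 {V M : Type*} [AddCommGroup V] [Module ℂ V] [AddCommGroup M] [Module ℂ M]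
    (A : VOA V) (X : VOAModule A M) {m : ℕ} (h : Fin m → V) (hH : ConditionH X h)
    (z : Fin m → ℂ) (v : V) (μ : Fin m → ℂ) (hv : ∀ j, A.mode (h j) 0 v = μ j • v) :
    -- the recursion for an additional point, as an identity of formal series
    (∀ (n : ℕ) (u : Fin n → V),
      X.nPoint hH z (Fin.cons v u : Fin (n + 1) → V) =
        (if IsInt (∑ j, z j * μ j) then (VOAModule.zeroModePoint hH z v u).extend else 0) +
        ∑ s : Fin n, ∑ᶠ k : ℕ,
          Formal.mulRatio (formalP (k + 1) (∑ j, z j * μ j)) s.succ 0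
            (VOAModule.nPoint hH z (Function.update u s (A.sq v k (u s)))).extend) ∧
    -- the recursion for `v[-p]u₁`, as an identity of formal series
    (∀ (n : ℕ) (u : Fin (n + 1) → V) (p : ℕ), 1 ≤ p →
      VOAModule.nPoint hH z (Function.update u 0 (A.sq v (-p) (u 0))) =
        (if IsInt (∑ j, z j * μ j) ∧ p = 1 then VOAModule.zeroModePoint hH z v u else 0) +
        (-1) ^ (p + 1) * (∑ᶠ k : ℕ, fun e =>
          ((k + p - 1).choose (p - 1) : PowerSeries ℂ) * formalE (k + p) (∑ j, z j * μ j) *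
            VOAModule.nPoint hH z (Function.update u 0 (A.sq v k (u 0))) e) +
        (-1) ^ (p + 1) * ∑ s : Fin n, ∑ᶠ k : ℕ, fun e =>
          ((k + p - 1).choose (p - 1) : PowerSeries ℂ) *
            Formal.mulRatio (formalP (k + p) (∑ j, z j * μ j)) s.succ 0
              (VOAModule.nPoint hH z (Function.update u s.succ (A.sq v k (u s.succ)))) e) ∧
    -- the same two recursions for the values of the functions, wherever they converge
    (∀ (n : ℕ) (w : Fin (n + 1) → ℂ) (τ : ℂ), 0 < τ.im →
      (∀ s : Fin n, ‖Complex.exp (2 * Real.pi * Complex.I * τ)‖ < ‖Complex.exp (w s.succ - w 0)‖ ∧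
        ‖Complex.exp (w s.succ - w 0)‖ < 1) →
      (∀ a b : ℤ, ∑ j, z j * μ j = a + b * τ → b = 0) →
      VOAModule.ConvergesAt hH z w τ →
      (∀ u : Fin n → V,
        X.value (VOAModule.nPoint hH z (Fin.cons v u : Fin (n + 1) → V)) w τ =
          (if IsInt (∑ j, z j * μ j) then
            X.value (VOAModule.zeroModePoint hH z v u) (Fin.tail w) τ else 0) +
          ∑ s : Fin n, ∑ᶠ k : ℕ, twistedP (k + 1) (w s.succ - w 0) (∑ j, z j * μ j) τ *
            X.value (VOAModule.nPoint hH z (Function.update u s (A.sq v k (u s))))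
              (Fin.tail w) τ) ∧
      (∀ (u : Fin (n + 1) → V) (p : ℕ), 1 ≤ p →
        X.value (VOAModule.nPoint hH z (Function.update u 0 (A.sq v (-p) (u 0)))) w τ =
          (if IsInt (∑ j, z j * μ j) ∧ p = 1 then
            X.value (VOAModule.zeroModePoint hH z v u) w τ else 0) +
          (-1) ^ (p + 1) * (∑ᶠ k : ℕ,
            ((k + p - 1).choose (p - 1) : ℂ) * twistedE (k + p) τ (∑ j, z j * μ j) *
              X.value (VOAModule.nPoint hH z (Function.update u 0 (A.sq v k (u 0)))) w τ) +
          (-1) ^ (p + 1) * ∑ s : Fin n, ∑ᶠ k : ℕ,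
            ((k + p - 1).choose (p - 1) : ℂ) *
              twistedP (k + p) (w s.succ - w 0) (∑ j, z j * μ j) τ *
              X.value (VOAModule.nPoint hH z
                (Function.update u s.succ (A.sq v k (u s.succ)))) w τ)) := by
  exact ⟨fun _ u => VOAModule.nPoint_cons hH z hv u,
    fun _ u p hp => VOAModule.nPoint_sq_neg hH z hv u p hp,
    fun _ _ _ hτ hw hZ hconv =>
      ⟨fun u => VOAModule.value_nPoint_cons hH z hv hτ hw hZ hconv u,
        fun u p hp => VOAModule.value_nPoint_sq_neg hH z hv hτ hw hZ hconv u p hp⟩⟩
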